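/- **Problem.** Let $Q,R_1,\dots,R_e\in\mathbb R^{n\times n}$, $A\in\mathbb R^{d\times n}$, $b\in\mathbb R^d$, $r\in\mathbb R^e$, and consider the quadratic constrained binary optimization (QCBO) problem $$\min_{x\in\{0,1\}^n} x^\top Qx\quad\text{s.t. } Ax=b,\;\; x^\top R_kx\le r_k\ (1\le k\le e),$$ assumed feasible. Put $p=n+1$, $\Delta^p=\mathrm{conv}\{ww^\top: w\in\{0,1\}^p\}$, and write $V=\begin{pmatrix}s&x^\top\\x&X\end{pmatrix}$. The associated completely positive program is: minimize $\mathrm{Tr}(CV)=\mathrm{Tr}(QX)$ over $V\in\Delta^p$ subject to the linear equalities $\mathcal L V=v$, namely $s=1$, $X_{jj}=x_j$, $(Ax)_i=b_i$, $(AXA^\top)_{ii}=b_i^2$, and the linear inequalities $\mathcal L'V\le v'$, namely $\mathrm{Tr}(R_kX)\le r_k$. Let $\mathrm{Opt}$ be its set of optimal solutions and $\mathrm{val}$ its optimal value. **Algorithm (Q-FW/QCGD).** Fix $\delta\in(0,1]$, $\alpha_0>0$, $V_1\in\Delta^p$ and multipliers $z_1,z_1'$. Put $\gamma_t=\frac{2}{\delta(t+1)}$,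 $\alpha_t=\alpha_0\sqrt{\delta t+1}$. Iteration $t=1,2,\dots$ forms the gradient in $V$ of the augmented Lagrangian, $$G_t=C+\mathcal L^*\big(z_t+\alpha_t g_t\big)+\mathcal L'^*\big(z'_t+\alpha_t g'_t\big),\quad g_t=\mathcal LV_t-v,\quad g'_t=\max\{\mathcal L'V_t-v',-z_t'/\alpha_t\},$$ calls a random oracle $m_t$ times on the QUBO problem $\min_{w\in\{0,1\}^p}w^\top G_tw$, lets $w_t$ be the best of the $m_t$ answers, and sets $$V_{t+1}=(1-\gamma_t)V_t+\gamma_tw_tw_t^\top,\quad z_{t+1}=z_t+\gamma_t(\mathcal LV_{t+1}-v),\quad z'_{t+1}=z'_t+\gamma_t\max\{\mathcal L'V_{t+1}-v',-z'_t/\alpha_t\}.$$ **Oracle.** Given the answers of the earlier iterations, the $m_t$ answers of iteration $t$ are independent, with the law that the oracle assigns to $G_t$ (it may depend on $t$). For every iteration and every QUBO matrix the oracle returns an optimal QUBO solution with probability at least $p_0\in(0,1]$. The objective error $w^\top G_tw-\min_{w'}w'^\top G_tw'$ of a single call has mean at most $\mu$ and variance at most $\sigma$, with $\mu,\sigma$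 independent of $t$ (and of the run). Let $c=\frac{2}{-\log(1-p_0)}$ ($c=0$ if $p_0=1$). For each $T\ge1$ let $V^{(T)}_{1},\dots,V^{(T)}_{T+1}$ be the iterates of a run of $T$ iterations with $m_t=m^{(T)}:=\lceil c\log T\rceil+1$ samples in every iteration; all these runs live on one probability space, with an arbitrary joint law. Let $\mathrm{Gap}_T=\mathrm{Tr}(CV^{(T)}_{T+1})-\mathrm{val}$ and $$\mathrm{Infeas}_T=\Big(\|\mathcal LV^{(T)}_{T+1}-v\|^2+\|(\mathcal L'V^{(T)}_{T+1}-v')_+\|^2\Big)^{1/2}.$$ **Theorem.** There is a constant $C$ depending only on the problem, on $\delta,\alpha_0,V_1,z_1,z_1'$ and on $p_0,\mu,\sigma$ such that the following holds. 1. *Almost sure convergence.* Almost surely, $V^{(T)}_{t+1}$ converges to $\mathrm{Opt}$ as $t\to\infty$, uniformly in $T\ge t$. In particular, if $\mathrm{Opt}=\{V^*\}$, then $\mathbb P(\lim_{T\to\infty}V^{(T)}_{T+1}=V^*)=1$; and if there are no inequality constraints ($e=0$) and the QCBO problem has a unique minimizer $x^*$, then this holds with $V^*=\binom{1}{x^*}\binom{1}{x^*}^\top$.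 Likewise, for a single infinite run with $m_t=\lceil c\log t\rceil+1$ samples in iteration $t$, the iterates $V_t$ converge almost surely to $\mathrm{Opt}$ as $t\to\infty$, so that $\mathbb P(\lim_{t\to\infty}V_t=V^*)=1$ in the same two cases. 2. *Rates.* For all $T\ge1$, $\mathbb E\,|\mathrm{Gap}_T|\le C/\sqrt T$ and $\mathbb E\,[\mathrm{Infeas}_T]\le C/\sqrt T$. 3. *Time to solution.* Call the run with $T$ iterations successful if every iteration selects an optimal QUBO solution and the final iterate satisfies $|\mathrm{Gap}_T|\le C/\sqrt T$ and $\mathrm{Infeas}_T\le C/\sqrt T$. Its success probability $q_T$ is at least $1-1/T$. Let one oracle call take time $\tau\ge 0$, so that the run takes time $\tau\,T\,m^{(T)}$, and for $p_R<1$ let $\mathrm{TTS}$ be $\tau\,T\,m^{(T)}$ times the least number $R\ge1$ of independent repetitions with $1-(1-q_T)^R\ge p_R$. Then for every fixed $p_R<1$ and every fixed degree $k$ there is a constant $K$, depending only on $p_0,p_R,k$, with $$\mathrm{TTS}\le K\,\tau\,T\log n\qquad\text{whenever } n\ge2,\ 1\le T\le n^k.$$ -/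

import Mathlib

open MeasureTheory ProbabilityTheory Filter Topology

noncomputable section

/-! ## Quadratic constrained binary optimization and its completely positive form -/

/-- The `0/1` real vector of a bit string. -/
def bitVec {ν : Type*} (w : ν → Bool) : ν → ℝ := fun i => if w i then 1 else 0

/-- Data of the problem: minimize `xᵀ Q x` over `x ∈ {0,1}ⁿ` subject to `A x = b` and
`xᵀ R_k x ≤ r_k` for all `k`. (Since `x_i ^ 2 = x_i`, a diagonal `R_k` is a linear inequality.) -/
structure QCBO (n d e : ℕ) where
  Q : Matrix (Fin n) (Fin n) ℝ
  A : Matrix (Fin d) (Fin n) ℝ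
  b : Fin d → ℝ
  R : Fin e → Matrix (Fin n) (Fin n) ℝ
  r : Fin e → ℝ

namespace QCBO
variable {n d e : ℕ}

def objective (P : QCBO n d e) (x : Fin n → Bool) : ℝ :=
  bitVec x ⬝ᵥ P.Q.mulVec (bitVec x)

def IsFeasible (P : QCBO n d e) (x : Fin n → Bool) : Prop :=
  P.A.mulVec (bitVec x) = P.b ∧ ∀ k, bitVec x ⬝ᵥ (P.R k).mulVec (bitVec x) ≤ P.r k

def IsMinimizer (P : QCBO n d e) (x : Fin n → Bool) : Prop :=
  P.IsFeasible x ∧ ∀ y, P.IsFeasible y → P.objective x ≤ P.objective y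

end QCBO

/-- `w wᵀ` for a bit string `w`. -/
def rankOne {ν : Type*} (w : ν → Bool) : Matrix ν ν ℝ :=
  Matrix.vecMulVec (bitVec w) (bitVec w)

/-- `Δ^p`, the convex hull of the matrices `w wᵀ` with `w ∈ {0,1}^p`. -/
def binaryHull (ν : Type*) : Set (Matrix ν ν ℝ) :=
  convexHull ℝ (Set.range (rankOne (ν := ν)))

/-- Data of the matrix program: minimize `Tr (C V)` over `V ∈ Δ^p` subject to
`Tr (A_i V) = a_i` (that is, `L V = v`) and `Tr (B_k V) ≤ b_k` (that is, `L' V ≤ v'`). -/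
structure CopositiveProgram (ν ι κ : Type*) where
  C : Matrix ν ν ℝ
  A : ι → Matrix ν ν ℝ
  a : ι → ℝ
  B : κ → Matrix ν ν ℝ
  b : κ → ℝ

namespace CopositiveProgram
variable {ν ι κ : Type*} [Fintype ν] [Fintype ι] [Fintype κ]

def objective (M : CopositiveProgram ν ι κ) (V : Matrix ν ν ℝ) : ℝ := (M.C * V).trace

/-- The equality residual `L V - v`. -/
def eqRes (M : CopositiveProgram ν ι κ) (V : Matrix ν ν ℝ) (i : ι) : ℝ :=
  (M.A i * V).trace - M.a i

/-- The inequality residual `L' V - v'`. -/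
def ineqRes (M : CopositiveProgram ν ι κ) (V : Matrix ν ν ℝ) (k : κ) : ℝ :=
  (M.B k * V).trace - M.b k

def feasibleSet (M : CopositiveProgram ν ι κ) : Set (Matrix ν ν ℝ) :=
  {V | V ∈ binaryHull ν ∧ (∀ i, M.eqRes V i = 0) ∧ ∀ k, M.ineqRes V k ≤ 0}

def optimalSet (M : CopositiveProgram ν ι κ) : Set (Matrix ν ν ℝ) :=
  {V | V ∈ M.feasibleSet ∧ ∀ W ∈ M.feasibleSet, M.objective V ≤ M.objective W}

def optimalValue (M : CopositiveProgram ν ι κ) : ℝ := sInf (M.objective '' M.feasibleSet)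

/-- Signed objective gap `Tr (C V) - Tr (C V⋆)`. -/
def objectiveGap (M : CopositiveProgram ν ι κ) (V : Matrix ν ν ℝ) : ℝ :=
  M.objective V - M.optimalValue

/-- Euclidean norm of the constraint violation. -/
def infeasibility (M : CopositiveProgram ν ι κ) (V : Matrix ν ν ℝ) : ℝ :=
  √(∑ i, M.eqRes V i ^ 2 + ∑ k, max (M.ineqRes V k) 0 ^ 2)

end CopositiveProgram

/-- The symmetric block matrix `[s, uᵀ; u, X]`; the coordinate `none` is the homogenizing one. -/
def bordered {n : ℕ} (s : ℝ) (u : Fin n → ℝ) (X : Matrix (Fin n) (Fin n) ℝ) :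
    Matrix (Option (Fin n)) (Option (Fin n)) ℝ :=
  Matrix.of fun i j =>
    match i, j with
    | none, none => s
    | none, some j => u j
    | some i, none => u i
    | some i, some j => X i j

/-- `(1, x) (1, x)ᵀ`. -/
def liftPoint {n : ℕ} (x : Fin n → Bool) : Matrix (Option (Fin n)) (Option (Fin n)) ℝ :=
  bordered 1 (bitVec x) (rankOne x)

/-- The completely positive reformulation in `V = [s, xᵀ; x, X]`: the objective is `Tr (Q X)`,
the equality constraints are `s = 1`, `X_jj = x_j`, `(A x)_i = b_i`, `(A X Aᵀ)_ii = b_i ^ 2`,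
and the inequality constraints are `Tr (R_k X) ≤ r_k`. -/
def QCBO.toProgram {n d e : ℕ} (P : QCBO n d e) :
    CopositiveProgram (Option (Fin n)) (Unit ⊕ Fin n ⊕ Fin d ⊕ Fin d) (Fin e) where
  C := bordered 0 0 P.Q
  A := Sum.elim (fun _ => bordered 1 0 0)
    (Sum.elim (fun j => bordered 0 (Pi.single j (-1 / 2)) (Matrix.single j j 1))
      (Sum.elim (fun i => bordered 0 (fun j => P.A i j / 2) 0)
        (fun i => bordered 0 0 (Matrix.vecMulVec (P.A i) (P.A i)))))
  a := Sum.elim (fun _ => 1) (Sum.elim (fun _ => 0) (Sum.elim P.b (fun i => P.b i ^ 2)))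
  B := fun k => bordered 0 0 (P.R k)
  b := P.r

/-! ## The QUBO subproblem -/

section Qubo
variable {ν : Type*} [Fintype ν]

/-- The QUBO energy `wᵀ G w`. -/
def quboEnergy (G : Matrix ν ν ℝ) (w : ν → Bool) : ℝ := bitVec w ⬝ᵥ G.mulVec (bitVec w)

def IsQuboMin (G : Matrix ν ν ℝ) (w : ν → Bool) : Prop :=
  ∀ w', quboEnergy G w ≤ quboEnergy G w'

/-- The error in the objective of an answer `w` to the QUBO problem with matrix `G`. -/
def quboError (G : Matrix ν ν ℝ) (w : ν → Bool) : ℝ :=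
  quboEnergy G w - ⨅ w', quboEnergy G w'

/-- The best of the `l + 1` samples `x 0, …, x l`, the first one in case of a tie. -/
def bestSample (G : Matrix ν ν ℝ) (x : ℕ → ν → Bool) : ℕ → ν → Bool
  | 0 => x 0
  | l + 1 => if quboEnergy G (x (l + 1)) < quboEnergy G (bestSample G x l) then x (l + 1)
      else bestSample G x l

end Qubo

/-! ## The Q-FW (quantum conditional gradient) iteration -/

/-- Primal matrix `V`, multipliers `z` of the equalities and `z'` of the inequalities. -/
structure QFWState (ν ι κ : Type*) where
  V : Matrix ν ν ℝ
  z : ι → ℝ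
  z' : κ → ℝ

/-- Scaling factor `δ`, initial penalty `α₀`, and the initial point `(V₁, z₁, z₁')`. -/
structure QFWParams (ν ι κ : Type*) where
  δ : ℝ
  α₀ : ℝ
  init : QFWState ν ι κ

namespace QFWParams
variable {ν ι κ : Type*}

/-- The step size `γ_t = 2 / (δ (t + 1))`. -/
def stepSize (par : QFWParams ν ι κ) (t : ℕ) : ℝ := 2 / (par.δ * (t + 1))

/-- The penalty parameter `α_t = α₀ √(δ t + 1)`. -/
def penalty (par : QFWParams ν ι κ) (t : ℕ) : ℝ := par.α₀ * √(par.δ * t + 1)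

end QFWParams

namespace CopositiveProgram
variable {ν ι κ : Type*} [Fintype ν] [Fintype ι] [Fintype κ]

/-- The inequality error `max (L' V - v') (-z' / α)`, which is the gradient in `z'` of the augmented
Lagrangian of the inequality constraints,
`∑ k, (max (z'_k + α (L' V - v')_k) 0 ^ 2 - z'_k ^ 2) / (2 α)`. -/
def ineqErr (M : CopositiveProgram ν ι κ) (α : ℝ) (V : Matrix ν ν ℝ) (z' : κ → ℝ) (k : κ) : ℝ :=
  max (M.ineqRes V k) (-z' k / α)

/-- The gradient in `V` of the augmented Lagrangian with penalty `α_t`; it is the QUBO matrix of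
iteration `t`. -/
def gradMatrix (M : CopositiveProgram ν ι κ) (par : QFWParams ν ι κ) (t : ℕ)
    (s : QFWState ν ι κ) : Matrix ν ν ℝ :=
  M.C + ∑ i, (s.z i + par.penalty t * M.eqRes s.V i) • M.A i
    + ∑ k, (s.z' k + par.penalty t * M.ineqErr (par.penalty t) s.V s.z' k) • M.B k

/-- Iteration `t` with update direction `w wᵀ`: a conditional gradient step in `V`, followed by a
gradient ascent step in the multipliers. -/
def qfwStep (M : CopositiveProgram ν ι κ) (par : QFWParams ν ι κ) (t : ℕ)
    (s : QFWState ν ι κ) (w : ν → Bool) : QFWState ν ι κ :=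
  let V' := (1 - par.stepSize t) • s.V + par.stepSize t • rankOne w
  { V := V'
    z := fun i => s.z i + par.stepSize t * M.eqRes V' i
    z' := fun k => s.z' k + par.stepSize t * M.ineqErr (par.penalty t) V' s.z' k }

/-- The state after `t` iterations, whose primal part is `V_{t+1}`, when iteration `s` (`s ≥ 1`)
uses the best of the `l s + 1` oracle answers `x s 0, …, x s (l s)`. -/
def qfwState (M : CopositiveProgram ν ι κ) (par : QFWParams ν ι κ) (l : ℕ → ℕ)
    (x : ℕ → ℕ → ν → Bool) : ℕ → QFWState ν ι κ
  | 0 => par.init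
  | t + 1 =>
      M.qfwStep par (t + 1) (qfwState M par l x t)
        (bestSample (M.gradMatrix par (t + 1) (qfwState M par l x t)) (x (t + 1)) (l (t + 1)))

/-- The QUBO matrix submitted to the oracle in iteration `t ≥ 1`. -/
def qfwQubo (M : CopositiveProgram ν ι κ) (par : QFWParams ν ι κ) (l : ℕ → ℕ)
    (x : ℕ → ℕ → ν → Bool) (t : ℕ) : Matrix ν ν ℝ :=
  M.gradMatrix par t (M.qfwState par l x (t - 1))

/-- The bit string selected in iteration `t ≥ 1`. -/
def qfwChoice (M : CopositiveProgram ν ι κ) (par : QFWParams ν ι κ) (l : ℕ → ℕ)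
    (x : ℕ → ℕ → ν → Bool) (t : ℕ) : ν → Bool :=
  bestSample (M.qfwQubo par l x t) (x t) (l t)

end CopositiveProgram

/-! ## The random oracle -/

/-- A random oracle: the law of its answer to a QUBO matrix, possibly depending on the iteration. -/
abbrev RandomOracle (ν : Type*) := ℕ → Matrix ν ν ℝ → PMF (ν → Bool)

section RandomRun
variable {ν ι κ Ω : Type*} [Fintype ν] [Fintype ι] [Fintype κ] [MeasurableSpace Ω]

/-- The oracle returns an optimal QUBO solution with probability at least `p₀`. -/
def RandomOracle.SuccessProb (O : RandomOracle ν) (p₀ : ℝ) : Prop :=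
  ∀ t, 1 ≤ t → ∀ G, ENNReal.ofReal p₀ ≤ (O t G).toOuterMeasure {w | IsQuboMin G w}

/-- `X s k` (`1 ≤ s ≤ N`, `k ≤ l s`) are the oracle answers in a run of `N` iterations with
`l s + 1` oracle calls in iteration `s`: given the answers of the earlier iterations, those of
iteration `s` are independent with the law that the oracle assigns to the current QUBO matrix. -/
def IsQFWRun (M : CopositiveProgram ν ι κ) (par : QFWParams ν ι κ) (O : RandomOracle ν)
    (Pr : Measure Ω) (l : ℕ → ℕ) (N : ℕ) (X : ℕ → ℕ → Ω → ν → Bool) : Prop :=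
  (∀ s ∈ Finset.Icc 1 N, ∀ k ≤ l s, Measurable (X s k)) ∧
  ∀ t ≤ N, ∀ x : ℕ → ℕ → ν → Bool,
    Pr {ω | ∀ s ∈ Finset.Icc 1 t, ∀ k ≤ l s, X s k ω = x s k} =
      ∏ s ∈ Finset.Icc 1 t, ∏ k ∈ Finset.range (l s + 1), O s (M.qfwQubo par l x s) (x s k)

/-- In iterations `1, …, N`, the error in the objective of a single oracle call has mean at most `μ`
and variance at most `σ`. -/
def BoundedOracleError (M : CopositiveProgram ν ι κ) (par : QFWParams ν ι κ)
    (Pr : Measure Ω) (l : ℕ → ℕ) (N : ℕ) (X : ℕ → ℕ → Ω → ν → Bool) (μ σ : ℝ) : Prop :=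
  ∀ t ∈ Finset.Icc 1 N, ∀ k ≤ l t,
    ∫ ω, quboError (M.qfwQubo par l (fun s j => X s j ω) t) (X t k ω) ∂Pr ≤ μ ∧
    variance (fun ω => quboError (M.qfwQubo par l (fun s j => X s j ω) t) (X t k ω)) Pr ≤ σ

/-- The run of `T` iterations succeeds to accuracy `ε`: every iteration selects an optimal QUBO
solution, and the final iterate has objective gap and infeasibility at most `ε`. -/
def successEvent (M : CopositiveProgram ν ι κ) (par : QFWParams ν ι κ) (l : ℕ → ℕ) (T : ℕ)
    (X : ℕ → ℕ → Ω → ν → Bool) (ε : ℝ) : Set Ω :=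
  {ω | (∀ t ∈ Finset.Icc 1 T, IsQuboMin (M.qfwQubo par l (fun s j => X s j ω) t)
          (M.qfwChoice par l (fun s j => X s j ω) t)) ∧
    |M.objectiveGap (M.qfwState par l (fun s j => X s j ω) T).V| ≤ ε ∧
    M.infeasibility (M.qfwState par l (fun s j => X s j ω) T).V ≤ ε}

end RandomRun

/-- `⌈c log t⌉` with `c = 2 / (-log (1 - p₀))` (and `c = 0` if `p₀ = 1`), so that
`⌈c log t⌉ + 1` samples are drawn. -/
def extraSamples (p₀ : ℝ) (t : ℕ) : ℕ := ⌈2 / (-Real.log (1 - p₀)) * Real.log t⌉₊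

/-- Time of a run of `T` iterations with `l t + 1` oracle calls in iteration `t`, at time `τ` per
call. -/
def runTime (τ : ℝ) (l : ℕ → ℕ) (T : ℕ) : ℝ := ∑ t ∈ Finset.Icc 1 T, ((l t : ℝ) + 1) * τ

/-- Time to solution: the least total time of `R ≥ 1` independent repetitions of a run of duration
`time` and success probability `q` such that at least one of them succeeds with probability at
least `pR` (infinite if there is no such `R`). -/
def timeToSolution (time q pR : ℝ) : ENNReal :=
  ⨅ (R : ℕ) (_ : 1 ≤ R ∧ pR ≤ 1 - (1 - q) ^ R), ENNReal.ofReal (R * time)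

end

/-! The argument separates a deterministic statement from a probabilistic one. Deterministically, a
run in which all but at most `J` iterations select an exact QUBO solution has gap and infeasibility
O(1/√t), uniformly over all such runs (`exists_trajectory_rate`); by compactness it then approaches
the optimal set uniformly (`exists_optimal_near`, `exists_time_near_optimal`). Probabilistically,
the sample size controls `J`.

The augmented Lagrangian gap satisfies e' ≤ (1 - γ) e + γ err + O(t^(-3/2)) (`energy_succ_le`): the
penalty yields in each conditional gradient step a negative multiple of the squared residual, which
pays for the ascent in the multipliers and the growth of the penalty. If the QUBO problem is solved
exactly, then err ≤ 0, since a linear functional attains its minimum over Δ^p at a vertex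
(`toALRun_err_nonpos`). Otherwise γ err is still O(1/√t), so a failure only raises the constant in e
= O(1/√t) (`exists_energy_bound`). From below the Lagrangian is controlled by optimal multipliers y,
which need no constraint qualification because Δ^p is a polytope (`farkas_finset`,
`exists_multipliers`). The two bounds give |residual|² = O((1 + |z - y|²)/t). Inserted into the
multiplier update, this makes 1 + |z - y|² grow by factors 1 + O(t^(-3/2)), whose product converges.
So the multipliers stay bounded and both rates follow (`exists_rate`).

Given the past, all samples of an iteration fail with probability at most (1 - p₀)/T²
(`measure_inter_allFail_le`). The union bound (1 - p₀)/T suffices for the expectations, as gap and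
infeasibility are uniformly bounded, and for the success probability. It is not summable in T, and
the joint law of the runs is arbitrary. But two failures in one run have probability at most T² ·
T^(-4), which is summable: by Borel-Cantelli almost all runs have at most one failure, which the
deterministic part tolerates. In the infinite run single failures are already summable.

Without inequality constraints, the linear and quadratic equalities force every bit string in the
support of an optimal matrix to be feasible and optimal, so that a unique minimizer gives a single
optimal matrix (`optimalSet_eq_singleton`). -/

/-! ## Linear programming duality -/

/-- **Farkas' lemma** for finitely many linear functionals. -/
theorem farkas_finset {X I : Type*} [AddCommGroup X] [Module ℝ X] [DecidableEq I] (s : Finset I) :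
    ∀ (φ : I → X →ₗ[ℝ] ℝ) (b : X →ₗ[ℝ] ℝ), (∀ x, (∀ i ∈ s, φ i x ≤ 0) → b x ≤ 0) →
      ∃ c : I → ℝ, (∀ i, 0 ≤ c i) ∧ ∀ x, b x = ∑ i ∈ s, c i * φ i x := by
  induction s using Finset.induction_on with
  | empty =>
    intro φ b h
    refine ⟨0, fun _ => le_rfl, fun x => ?_⟩
    have h1 := h x (by simp)
    have h2 := h (-x) (by simp)
    simp only [map_neg] at h2
    simp only [Finset.sum_empty]
    linarith
  | insert j s hj ih =>
    intro φ b h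
    -- If `φ j` is dispensable, it gets coefficient zero. Otherwise a point `x₁` showing that it is
    -- needed has `φ j x₁ > 0`, and projecting along `x₁` onto the kernel of `φ j` removes this
    -- functional.
    by_cases hs : ∀ x, (∀ i ∈ s, φ i x ≤ 0) → b x ≤ 0
    · obtain ⟨c, hc, hb⟩ := ih φ b hs
      refine ⟨fun i => if i = j then 0 else c i, fun i => ?_, fun x => ?_⟩
      · dsimp only
        split_ifs
        exacts [le_rfl, hc i]
      · rw [hb x, Finset.sum_insert hj]
        simp only [if_true, zero_mul, zero_add]
        refine Finset.sum_congr rfl fun i hi => ?_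
        rw [if_neg (ne_of_mem_of_not_mem hi hj)]
    · push Not at hs
      obtain ⟨x₁, hx₁, hbx₁⟩ := hs
      have hφ : 0 < φ j x₁ := by
        by_contra hcon
        exact absurd (h x₁ fun i hi => (Finset.mem_insert.1 hi).elim
          (fun e => e ▸ not_lt.1 hcon) (hx₁ i)) (not_le.2 hbx₁)
      set x₀ := (φ j x₁)⁻¹ • x₁ with hx₀
      have h1 : φ j x₀ = 1 := by simp [hx₀, hφ.ne']
      have h2 : ∀ i ∈ s, φ i x₀ ≤ 0 := fun i hi => by
        rw [hx₀, map_smul, smul_eq_mul]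
        exact mul_nonpos_of_nonneg_of_nonpos (inv_nonneg.2 hφ.le) (hx₁ i hi)
      have h3 : 0 < b x₀ := by
        rw [hx₀, map_smul, smul_eq_mul]
        positivity
      obtain ⟨c, hc, hb⟩ := ih (fun i => φ i - φ i x₀ • φ j) (b - b x₀ • φ j) (fun x hx => by
        have h4 := h (x - φ j x • x₀) fun i hi => by
          rcases Finset.mem_insert.1 hi with rfl | hi
          · simp [h1]
          · have := hx i hi
            simp only [LinearMap.sub_apply, LinearMap.smul_apply, smul_eq_mul] at this
            simp only [map_sub, map_smul, smul_eq_mul]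
            linarith
        simp only [map_sub, map_smul, smul_eq_mul] at h4
        simp only [LinearMap.sub_apply, LinearMap.smul_apply, smul_eq_mul]
        linarith)
      -- The coefficient of `φ j` is forced by evaluation at `x₀`; it is nonnegative because `b x₀ >
      -- 0` and the other functionals are nonpositive there.
      refine ⟨fun i => if i = j then b x₀ - ∑ i ∈ s, c i * φ i x₀ else c i, fun i => ?_,
        fun x => ?_⟩
      · dsimp only
        split_ifs
        · have : ∑ i ∈ s, c i * φ i x₀ ≤ 0 :=
            Finset.sum_nonpos fun i hi => mul_nonpos_of_nonneg_of_nonpos (hc i) (h2 i hi)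
          linarith
        · exact hc i
      · have h4 := hb x
        simp only [LinearMap.sub_apply, LinearMap.smul_apply, smul_eq_mul] at h4
        rw [Finset.sum_insert hj]
        have h5 : ∑ i ∈ s, (if i = j then b x₀ - ∑ i ∈ s, c i * φ i x₀ else c i) * φ i x
            = ∑ i ∈ s, c i * φ i x := Finset.sum_congr rfl fun i hi => by
          rw [if_neg (ne_of_mem_of_not_mem hi hj)]
        have h6 : ∑ i ∈ s, c i * (φ i x - φ i x₀ * φ j x)
            = ∑ i ∈ s, c i * φ i x - (∑ i ∈ s, c i * φ i x₀) * φ j x := by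
          rw [Finset.sum_mul, ← Finset.sum_sub_distrib]
          exact Finset.sum_congr rfl fun i _ => by ring
        simp only [if_true, h5]
        linarith

/-! ## The convex hull of the binary rank one matrices -/

section Hull
variable {ν : Type*}

theorem rankOne_apply (w : ν → Bool) (i j : ν) : rankOne w i j = bitVec w i * bitVec w j := rfl

theorem bitVec_mul_self (w : ν → Bool) (i : ν) : bitVec w i * bitVec w i = bitVec w i := by
  unfold bitVec; split_ifs <;> simp

theorem abs_rankOne_le (w : ν → Bool) (i j : ν) : |rankOne w i j| ≤ 1 := by
  rw [rankOne_apply]; unfold bitVec; split_ifs <;> simp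

theorem rankOne_mem_binaryHull (w : ν → Bool) : rankOne w ∈ binaryHull ν :=
  subset_convexHull ℝ _ ⟨w, rfl⟩

theorem convex_binaryHull : Convex ℝ (binaryHull ν) := convex_convexHull ℝ _

theorem sum_smul_rankOne_mem_binaryHull [Fintype (ν → Bool)] {c : (ν → Bool) → ℝ}
    (hc : ∀ w, 0 ≤ c w) (hc1 : ∑ w, c w = 1) : ∑ w, c w • rankOne w ∈ binaryHull ν :=
  convex_binaryHull.sum_mem (fun w _ => hc w) hc1 fun w _ => rankOne_mem_binaryHull w

variable [Fintype ν]

theorem isCompact_binaryHull : IsCompact (binaryHull ν) :=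
  (Set.finite_range _).isCompact_convexHull ℝ

theorem trace_mul_rankOne (G : Matrix ν ν ℝ) (w : ν → Bool) :
    (G * rankOne w).trace = quboEnergy G w := by
  simp only [Matrix.trace, Matrix.diag_apply, Matrix.mul_apply, rankOne_apply, quboEnergy,
    dotProduct, Matrix.mulVec, Finset.mul_sum]
  exact Finset.sum_congr rfl fun i _ => Finset.sum_congr rfl fun j _ => by ring

/-- An element of the hull as a convex combination over all bit strings. -/
theorem exists_weights_of_mem_binaryHull [Fintype (ν → Bool)] {V : Matrix ν ν ℝ}
    (hV : V ∈ binaryHull ν) :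
    ∃ c : (ν → Bool) → ℝ, (∀ w, 0 ≤ c w) ∧ ∑ w, c w = 1 ∧ V = ∑ w, c w • rankOne w := by
  rw [binaryHull, convexHull_range_eq_exists_affineCombination] at hV
  obtain ⟨s, c, hc, hc1, rfl⟩ := hV
  classical
  refine ⟨fun w => if w ∈ s then c w else 0, fun w => ?_, ?_, ?_⟩
  · dsimp only
    split_ifs with hw
    exacts [hc w hw, le_rfl]
  · rw [← hc1, Finset.sum_ite_mem, Finset.univ_inter]
  · rw [Finset.affineCombination_eq_linear_combination _ _ _ hc1]
    simp [ite_smul, Finset.sum_ite_mem]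

end Hull

/-! ## The matrix program -/

theorem tendsto_matrix_iff {ν β : Type*} {l : Filter β} {V : β → Matrix ν ν ℝ}
    {W : Matrix ν ν ℝ} :
    Tendsto V l (𝓝 W) ↔ ∀ i j, Tendsto (fun a => V a i j) l (𝓝 (W i j)) := by
  rw [show Tendsto V l (𝓝 W) ↔ ∀ i, Tendsto (fun a => V a i) l (𝓝 (W i)) from tendsto_pi_nhds]
  exact forall_congr' fun i => tendsto_pi_nhds

namespace CopositiveProgram
variable {ν ι κ : Type*} [Fintype ν]

theorem objective_sum (M : CopositiveProgram ν ι κ) {S : Type*} [Fintype S] (c : S → ℝ)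
    (W : S → Matrix ν ν ℝ) : M.objective (∑ w, c w • W w) = ∑ w, c w * M.objective (W w) := by
  simp [objective, Matrix.mul_sum, Matrix.trace_sum]

theorem eqRes_sum (M : CopositiveProgram ν ι κ) {S : Type*} [Fintype S] {c : S → ℝ}
    (hc : ∑ w, c w = 1) (W : S → Matrix ν ν ℝ) (i : ι) :
    M.eqRes (∑ w, c w • W w) i = ∑ w, c w * M.eqRes (W w) i := by
  simp only [eqRes, Matrix.mul_sum, Matrix.trace_sum, Matrix.mul_smul, Matrix.trace_smul,
    smul_eq_mul, mul_sub, Finset.sum_sub_distrib, ← Finset.sum_mul, hc, one_mul]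

theorem ineqRes_sum (M : CopositiveProgram ν ι κ) {S : Type*} [Fintype S] {c : S → ℝ}
    (hc : ∑ w, c w = 1) (W : S → Matrix ν ν ℝ) (k : κ) :
    M.ineqRes (∑ w, c w • W w) k = ∑ w, c w * M.ineqRes (W w) k := by
  simp only [ineqRes, Matrix.mul_sum, Matrix.trace_sum, Matrix.mul_smul, Matrix.trace_smul,
    smul_eq_mul, mul_sub, Finset.sum_sub_distrib, ← Finset.sum_mul, hc, one_mul]

theorem objective_combo (M : CopositiveProgram ν ι κ) (a : ℝ) (V W : Matrix ν ν ℝ) :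
    M.objective ((1 - a) • V + a • W) = (1 - a) * M.objective V + a * M.objective W := by
  simp [objective, Matrix.mul_add]

theorem eqRes_combo (M : CopositiveProgram ν ι κ) (a : ℝ) (V W : Matrix ν ν ℝ) (i : ι) :
    M.eqRes ((1 - a) • V + a • W) i = (1 - a) * M.eqRes V i + a * M.eqRes W i := by
  simp only [eqRes, Matrix.mul_add, Matrix.mul_smul, Matrix.trace_add, Matrix.trace_smul,
    smul_eq_mul]
  ring

theorem ineqRes_combo (M : CopositiveProgram ν ι κ) (a : ℝ) (V W : Matrix ν ν ℝ) (k : κ) :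
    M.ineqRes ((1 - a) • V + a • W) k = (1 - a) * M.ineqRes V k + a * M.ineqRes W k := by
  simp only [ineqRes, Matrix.mul_add, Matrix.mul_smul, Matrix.trace_add, Matrix.trace_smul,
    smul_eq_mul]
  ring

theorem continuous_objective (M : CopositiveProgram ν ι κ) : Continuous M.objective := by
  unfold objective; fun_prop

theorem continuous_eqRes (M : CopositiveProgram ν ι κ) (i : ι) :
    Continuous fun V => M.eqRes V i := by
  unfold eqRes; fun_prop

theorem continuous_ineqRes (M : CopositiveProgram ν ι κ) (k : κ) :
    Continuous fun V => M.ineqRes V k := by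
  unfold ineqRes; fun_prop

theorem isCompact_feasibleSet (M : CopositiveProgram ν ι κ) : IsCompact M.feasibleSet := by
  refine isCompact_binaryHull.of_isClosed_subset ?_ fun V hV => hV.1
  have h : M.feasibleSet = binaryHull ν ∩
      ((⋂ i, {V | M.eqRes V i = 0}) ∩ ⋂ k, {V | M.ineqRes V k ≤ 0}) := by
    ext V
    simp only [feasibleSet, Set.mem_ofPred_eq, Set.mem_inter_iff, Set.mem_iInter]
  rw [h]
  refine isCompact_binaryHull.isClosed.inter (IsClosed.inter ?_ ?_)
  · exact isClosed_iInter fun i => isClosed_eq (M.continuous_eqRes i) continuous_const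
  · exact isClosed_iInter fun k => isClosed_le (M.continuous_ineqRes k) continuous_const

theorem optimalSet_nonempty {M : CopositiveProgram ν ι κ} (h : M.feasibleSet.Nonempty) :
    M.optimalSet.Nonempty := by
  obtain ⟨V, hV, hmin⟩ := M.isCompact_feasibleSet.exists_isMinOn h
    M.continuous_objective.continuousOn
  exact ⟨V, hV, fun W hW => hmin hW⟩

theorem objective_eq_optimalValue {M : CopositiveProgram ν ι κ} {V : Matrix ν ν ℝ}
    (hV : V ∈ M.optimalSet) : M.objective V = M.optimalValue :=
  have h : IsLeast (M.objective '' M.feasibleSet) (M.objective V) :=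
    ⟨⟨V, hV.1, rfl⟩, fun _ ⟨W, hW, e⟩ => e ▸ hV.2 W hW⟩
  h.csInf_eq.symm

theorem optimalValue_le {M : CopositiveProgram ν ι κ} {V : Matrix ν ν ℝ}
    (hV : V ∈ M.feasibleSet) : M.optimalValue ≤ M.objective V := by
  obtain ⟨W, hW⟩ := optimalSet_nonempty ⟨V, hV⟩
  rw [← objective_eq_optimalValue hW]
  exact hW.2 V hV

theorem mem_optimalSet_of_objective_le {M : CopositiveProgram ν ι κ} {V : Matrix ν ν ℝ}
    (hV : V ∈ M.feasibleSet) (h : M.objective V ≤ M.optimalValue) : V ∈ M.optimalSet :=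
  ⟨hV, fun _ hW => h.trans (optimalValue_le hW)⟩

variable [Fintype ι] [Fintype κ]

/-- Strong duality: optimal multipliers of the matrix program. -/
theorem exists_multipliers (M : CopositiveProgram ν ι κ) :
    ∃ (y : ι → ℝ) (y' : κ → ℝ), (∀ k, 0 ≤ y' k) ∧ ∀ w : ν → Bool,
      0 ≤ M.objectiveGap (rankOne w) + ∑ i, y i * M.eqRes (rankOne w) i
        + ∑ k, y' k * M.ineqRes (rankOne w) k := by
  classical
  let S := ν → Bool
  let lin : (S → ℝ) → (S → ℝ) →ₗ[ℝ] ℝ := fun g => ∑ w, g w • LinearMap.proj w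
  have lin_apply : ∀ g c, lin g c = ∑ w, c w * g w := fun g c => by
    simp [lin, mul_comm]
  -- The unknowns are unnormalized weights on the bit strings. Gap and residuals already contain
  -- their constants, so every condition is homogeneous in the weights; an equality is split into
  -- two inequalities.
  let φ : (S ⊕ ι) ⊕ (ι ⊕ κ) → (S → ℝ) →ₗ[ℝ] ℝ := Sum.elim
    (Sum.elim (fun w => -LinearMap.proj w) fun i => lin fun w => M.eqRes (rankOne w) i)
    (Sum.elim (fun i => -lin fun w => M.eqRes (rankOne w) i)
      fun k => lin fun w => M.ineqRes (rankOne w) k)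
  obtain ⟨c, hc, hb⟩ := farkas_finset Finset.univ φ (-lin fun w => M.objectiveGap (rankOne w)) (by
    intro x hx
    have hx0 : ∀ w, 0 ≤ x w := fun w => by
      simpa [φ] using hx (Sum.inl (Sum.inl w)) (Finset.mem_univ _)
    have hx1 : ∀ i, ∑ w, x w * M.eqRes (rankOne w) i = 0 := fun i => by
      have h1 := hx (Sum.inl (Sum.inr i)) (Finset.mem_univ _)
      have h2 := hx (Sum.inr (Sum.inl i)) (Finset.mem_univ _)
      simp only [φ, Sum.elim_inl, Sum.elim_inr, LinearMap.neg_apply, lin_apply] at h1 h2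
      linarith
    have hx2 : ∀ k, ∑ w, x w * M.ineqRes (rankOne w) k ≤ 0 := fun k => by
      have h1 := hx (Sum.inr (Sum.inr k)) (Finset.mem_univ _)
      simpa only [φ, Sum.elim_inl, Sum.elim_inr, lin_apply] using h1
    rw [LinearMap.neg_apply, lin_apply, neg_nonpos]
    rcases (Finset.sum_nonneg fun w (_ : w ∈ Finset.univ) => hx0 w).eq_or_lt with h0 | h0
    · have : ∀ w, x w = 0 := fun w =>
        (Finset.sum_eq_zero_iff_of_nonneg fun w _ => hx0 w).1 h0.symm w (Finset.mem_univ _)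
      simp [this]
    · set s := ∑ w, x w
      have hs1 : ∑ w, s⁻¹ * x w = 1 := by rw [← Finset.mul_sum, inv_mul_cancel₀ h0.ne']
      have hscale : ∀ g : S → ℝ, ∑ w, s⁻¹ * x w * g w = s⁻¹ * ∑ w, x w * g w := fun g => by
        rw [Finset.mul_sum]; exact Finset.sum_congr rfl fun w _ => by ring
      have hfeas : ∑ w, (s⁻¹ * x w) • rankOne w ∈ M.feasibleSet :=
        ⟨sum_smul_rankOne_mem_binaryHull (fun w => mul_nonneg (inv_nonneg.2 h0.le) (hx0 w)) hs1,
          fun i => by rw [M.eqRes_sum hs1, hscale, hx1, mul_zero],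
          fun k => by
            rw [M.ineqRes_sum hs1, hscale]
            exact mul_nonpos_of_nonneg_of_nonpos (inv_nonneg.2 h0.le) (hx2 k)⟩
      have h1 := optimalValue_le hfeas
      rw [M.objective_sum, hscale] at h1
      have h2 : ∑ w, x w * M.objectiveGap (rankOne w)
          = ∑ w, x w * M.objective (rankOne w) - s * M.optimalValue := by
        simp only [objectiveGap, mul_sub, Finset.sum_sub_distrib, ← Finset.sum_mul, s]
      rw [h2, sub_nonneg]
      rwa [← div_eq_inv_mul, le_div_iff₀ h0, mul_comm] at h1)
  refine ⟨fun i => c (Sum.inl (Sum.inr i)) - c (Sum.inr (Sum.inl i)),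
    fun k => c (Sum.inr (Sum.inr k)), fun k => hc _, fun w => ?_⟩
  -- Evaluation at the unit mass on `w`; the coefficients of the sign constraints contribute a term
  -- of known sign, which is dropped.
  have h1 := hb (Pi.single w 1)
  have h2 : ∀ g : S → ℝ, lin g (Pi.single w 1) = g w := fun g => by
    rw [lin_apply, Finset.sum_eq_single w] <;> simp +contextual
  simp only [Fintype.sum_sum_type, φ, Sum.elim_inl, Sum.elim_inr, LinearMap.neg_apply, h2,
    LinearMap.proj_apply] at h1
  have h3 : ∑ v, c (Sum.inl (Sum.inl v)) * -((Pi.single w 1 : S → ℝ) v) ≤ 0 :=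
    Finset.sum_nonpos fun v _ => mul_nonpos_of_nonneg_of_nonpos (hc _) (by
      by_cases hv : v = w
      · subst hv; simp
      · simp [hv])
  simp only [sub_mul, Finset.sum_sub_distrib]
  simp only [mul_neg, Finset.sum_neg_distrib] at h1 h3
  linarith

theorem infeasibility_eq_zero_iff (M : CopositiveProgram ν ι κ) {V : Matrix ν ν ℝ} :
    M.infeasibility V = 0 ↔ (∀ i, M.eqRes V i = 0) ∧ ∀ k, M.ineqRes V k ≤ 0 := by
  have h1 : 0 ≤ ∑ i, M.eqRes V i ^ 2 := Finset.sum_nonneg fun _ _ => sq_nonneg _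
  have h2 : 0 ≤ ∑ k, max (M.ineqRes V k) 0 ^ 2 := Finset.sum_nonneg fun _ _ => sq_nonneg _
  rw [infeasibility, Real.sqrt_eq_zero (add_nonneg h1 h2), add_eq_zero_iff_of_nonneg h1 h2,
    Finset.sum_eq_zero_iff_of_nonneg fun _ _ => sq_nonneg _,
    Finset.sum_eq_zero_iff_of_nonneg fun _ _ => sq_nonneg _]
  simp

theorem continuous_infeasibility (M : CopositiveProgram ν ι κ) : Continuous M.infeasibility := by
  unfold infeasibility
  have h1 := M.continuous_eqRes
  have h2 := M.continuous_ineqRes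
  fun_prop

/-- A point of small gap and infeasibility that is close to the hull is close to an optimal point. -/
theorem exists_optimal_near (M : CopositiveProgram ν ι κ) {ε : ℝ}
    (hε : 0 < ε) : ∃ η > 0, ∀ V : Matrix ν ν ℝ, |M.objectiveGap V| ≤ η → M.infeasibility V ≤ η →
      (∃ H ∈ binaryHull ν, ∀ i j, |V i j - H i j| ≤ η) →
      ∃ W ∈ M.optimalSet, ∀ i j, |V i j - W i j| < ε := by
  -- Counterexamples with tolerance `1 / (n + 1)` have a subsequence that converges to a hull point
  -- of zero gap and zero infeasibility, that is, to an optimal point.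
  by_contra! hcon
  have hpos : ∀ n : ℕ, (0 : ℝ) < 1 / ((n : ℝ) + 1) := fun n => by positivity
  choose V hgap hinf hH hfar using fun n : ℕ => hcon _ (hpos n)
  choose H hH hVH using hH
  have : FirstCountableTopology (Matrix ν ν ℝ) :=
    inferInstanceAs (FirstCountableTopology (ν → ν → ℝ))
  obtain ⟨W, hW, φ, hφ, hlim⟩ := isCompact_binaryHull.tendsto_subseq hH
  have hsmall : Tendsto (fun n : ℕ => 1 / ((φ n : ℝ) + 1)) atTop (𝓝 0) :=
    tendsto_one_div_add_atTop_nhds_zero_nat.comp hφ.tendsto_atTop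
  have hVlim : Tendsto (fun n => V (φ n)) atTop (𝓝 W) := by
    rw [tendsto_matrix_iff]
    intro i j
    have h1 : Tendsto (fun n => H (φ n) i j) atTop (𝓝 (W i j)) := tendsto_matrix_iff.1 hlim i j
    have h2 : Tendsto (fun n => V (φ n) i j - H (φ n) i j) atTop (𝓝 0) :=
      squeeze_zero_norm (fun n => by simpa using hVH (φ n) i j) hsmall
    simpa using h2.add h1
  have hgap0 : M.objectiveGap W = 0 := by
    have h1 : Tendsto (fun n => M.objectiveGap (V (φ n))) atTop (𝓝 (M.objectiveGap W)) :=
      ((M.continuous_objective.sub continuous_const).tendsto W).comp hVlim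
    exact tendsto_nhds_unique h1 (squeeze_zero_norm (fun n => hgap (φ n)) hsmall)
  have hinf0 : M.infeasibility W = 0 :=
    tendsto_nhds_unique ((M.continuous_infeasibility.tendsto W).comp hVlim)
      (squeeze_zero (fun n => Real.sqrt_nonneg _) (fun n => hinf (φ n)) hsmall)
  have hopt : W ∈ M.optimalSet :=
    mem_optimalSet_of_objective_le ⟨hW, M.infeasibility_eq_zero_iff.1 hinf0⟩ (sub_eq_zero.1 hgap0).le
  choose i j hij using fun n => hfar n W hopt
  have hev : ∀ᶠ n in atTop, ∀ i j, |V (φ n) i j - W i j| < ε := by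
    simp only [eventually_all]
    intro i j
    have h1 : Tendsto (fun n => V (φ n) i j) atTop (𝓝 (W i j)) :=
      tendsto_matrix_iff.1 hVlim i j
    simpa [Real.dist_eq] using (Metric.tendsto_nhds.1 h1) ε hε
  obtain ⟨n, hn⟩ := hev.exists
  exact absurd (hn _ _) (not_lt.2 (hij (φ n)))

end CopositiveProgram

/-! ## The augmented Lagrangian of a single constraint -/

/-- The residual entering the augmented Lagrangian: `u` for an equality constraint, and
`max u (-z / a)` for an inequality constraint (`b = true`) with multiplier `z` and penalty `a`. -/
noncomputable def alResidual (b : Bool) (u z a : ℝ) : ℝ := if b then max u (-z / a) else u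

section Residual
variable {b : Bool} {u z a : ℝ}

theorem le_alResidual : u ≤ alResidual b u z a := by
  unfold alResidual; split_ifs
  exacts [le_max_left _ _, le_rfl]

theorem alResidual_false : alResidual false u z a = u := rfl

theorem alResidual_true : alResidual true u z a = max u (-z / a) := rfl

/-- With a slack variable an inequality becomes an equality whose residual is any `k ≥ u`. Over
these `k` the parabola with vertex `-z / a` is minimized by truncation. Descent and the change of
multipliers both rest on this variational form. -/
theorem alResidual_minimizes (ha : 0 < a) {k : ℝ} (hk : u ≤ k) (hb : b = false → k = u) :
    z * alResidual b u z a + a / 2 * alResidual b u z a ^ 2 ≤ z * k + a / 2 * k ^ 2 := by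
  cases b with
  | false => rw [hb rfl, alResidual_false]
  | true =>
    rw [alResidual_true]
    rcases le_total u (-z / a) with h | h
    · rw [max_eq_right h]
      have hz : z = -(a * (-z / a)) := by field_simp
      generalize -z / a = q at hz
      subst hz
      nlinarith [mul_nonneg ha.le (sq_nonneg (k - q))]
    · rw [max_eq_left h]
      rw [div_le_iff₀ ha] at h
      nlinarith [mul_nonneg (sub_nonneg.2 hk) (by linarith : 0 ≤ z + u * a),
        mul_nonneg ha.le (sq_nonneg (k - u))]

/-- Where the truncation is active, the factor `z + a * alResidual b u z a` vanishes. -/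
theorem alResidual_complementary (ha : 0 < a) :
    (z + a * alResidual b u z a) * u = (z + a * alResidual b u z a) * alResidual b u z a := by
  cases b with
  | false => rfl
  | true =>
    rw [alResidual_true]
    rcases le_total u (-z / a) with h | h
    · rw [max_eq_right h]
      have : z + a * (-z / a) = 0 := by field_simp; ring
      rw [this, zero_mul, zero_mul]
    · rw [max_eq_left h]

theorem alResidual_dual_nonneg (ha : 0 < a) : 0 ≤ z + a * alResidual true u z a := by
  have h : -z / a ≤ alResidual true u z a := le_max_right _ _
  rw [div_le_iff₀ ha] at h
  linarith

/-- Shifting the minimizing residual at `u` by `u' - u` gives an admissible competitor at `u'`.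
Truncation thus does not worsen the smoothness constant `a`. -/
theorem alResidual_descent (ha : 0 < a) (u' : ℝ) :
    z * alResidual b u' z a + a / 2 * alResidual b u' z a ^ 2 ≤
      z * alResidual b u z a + a / 2 * alResidual b u z a ^ 2
        + (z + a * alResidual b u z a) * (u' - u) + a / 2 * (u' - u) ^ 2 := by
  have h := alResidual_minimizes (b := b) (z := z) ha
    (show u' ≤ alResidual b u z a + (u' - u) by
      linarith [le_alResidual (b := b) (u := u) (z := z) (a := a)])
    (fun hb => by subst hb; rw [alResidual_false]; ring)
  linarith

theorem abs_alResidual_le (ha : 0 < a) : |alResidual b u z a| ≤ |u| + |z| / a := by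
  have h0 : 0 ≤ |z| / a := by positivity
  cases b with
  | false => rw [alResidual_false]; linarith
  | true =>
    rw [alResidual_true]
    refine (abs_max_le_max_abs_abs).trans (max_le (by linarith) ?_)
    rw [abs_div, abs_neg, abs_of_pos ha]
    linarith [abs_nonneg u]

theorem abs_alResidual_sub_le (z' a' : ℝ) :
    |alResidual b u z a - alResidual b u z' a'| ≤ |z / a - z' / a'| := by
  cases b with
  | false => simp [alResidual_false]
  | true =>
    rw [alResidual_true, alResidual_true]
    refine (abs_max_sub_max_le_max _ _ _ _).trans (max_le (by simp) ?_)
    rw [neg_div, neg_div, neg_sub_neg, abs_sub_comm]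

/-- Under active truncation the update multiplies `z` by `1 - γ / a`, a contraction because `γ ≤ a`;
otherwise it adds `γ * u`. -/
theorem abs_dual_update_le {γ : ℝ} (ha : 0 < a) (hγ : 0 ≤ γ) (hγa : γ ≤ a) :
    |z + γ * alResidual b u z a| ≤ |z| + γ * |u| := by
  have h1 : |z + γ * u| ≤ |z| + γ * |u| := by
    refine (abs_add_le _ _).trans ?_
    rw [abs_mul, abs_of_nonneg hγ]
  cases b with
  | false => exact h1
  | true =>
    rw [alResidual_true]
    rcases le_total u (-z / a) with h | h
    · rw [max_eq_right h]
      have h2 : z + γ * (-z / a) = (1 - γ / a) * z := by field_simp; ring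
      have h3 : γ / a ≤ 1 := (div_le_one ha).2 hγa
      have h4 : 0 ≤ γ / a := by positivity
      rw [h2, abs_mul, abs_of_nonneg (by linarith)]
      nlinarith [abs_nonneg z, abs_nonneg u, mul_nonneg hγ (abs_nonneg u)]
    · rw [max_eq_left h]
      exact h1

end Residual

/-! ## Conditional gradient augmented Lagrangian runs -/

/-- Growth conditions on step sizes and penalties. -/
structure StepBounds (γ α : ℕ → ℝ) (L : ℝ) (t₁ : ℕ) : Prop where
  one_le : 1 ≤ L
  pos : 1 ≤ t₁
  step_ge : ∀ t : ℕ, 1 ≤ t → 2 / ((t : ℝ) + 1) ≤ γ t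
  step_le : ∀ t : ℕ, 1 ≤ t → γ t ≤ L / t
  penalty_le : ∀ t : ℕ, 1 ≤ t → α t ≤ L * √t
  le_penalty : ∀ t : ℕ, 1 ≤ t → √t ≤ L * α t
  penalty_mono : ∀ t, α t ≤ α (t + 1)
  penalty_diff : ∀ t : ℕ, 1 ≤ t → α (t + 1) - α t ≤ L / √t
  step_le_one : ∀ t, t₁ ≤ t → γ t ≤ 1
  step_le_penalty : ∀ t, t₁ ≤ t → γ t ≤ α t
  dominated : ∀ t, t₁ ≤ t → 4 * (γ t + (α (t + 1) - α t) / 2) ≤ γ (t + 1) * α (t + 1)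

/-- The scalar quantities of a run: objective gaps `f` and constraint values `u` of the iterates,
`fh` and `uh` of the update directions, and the multipliers `z`. -/
structure ALRun (K : Type*) (γ α : ℕ → ℝ) where
  ty : K → Bool
  f : ℕ → ℝ
  fh : ℕ → ℝ
  u : ℕ → K → ℝ
  uh : ℕ → K → ℝ
  z : ℕ → K → ℝ
  f_succ : ∀ t, f (t + 1) = (1 - γ (t + 1)) * f t + γ (t + 1) * fh (t + 1)
  u_succ : ∀ t i, u (t + 1) i = (1 - γ (t + 1)) * u t i + γ (t + 1) * uh (t + 1) i
  z_succ : ∀ t i, z (t + 1) i = z t i +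
    γ (t + 1) * alResidual (ty i) (u (t + 1) i) (z t i) (α (t + 1))

namespace ALRun
variable {K : Type*} [Fintype K] {γ α : ℕ → ℝ} (R : ALRun K γ α)

/-- Residual of iterate `t` with the multiplier of iterate `t`. -/
noncomputable def res (t : ℕ) (i : K) : ℝ := alResidual (R.ty i) (R.u t i) (R.z t i) (α (t + 1))

/-- Residual of iterate `t + 1` with the multiplier of iterate `t`. -/
noncomputable def resNext (t : ℕ) (i : K) : ℝ :=
  alResidual (R.ty i) (R.u (t + 1) i) (R.z t i) (α (t + 1))

/-- Augmented Lagrangian gap of iterate `t + 1` with the multiplier of iterate `t`. -/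
noncomputable def energy (t : ℕ) : ℝ :=
  R.f (t + 1) + ∑ i, (R.z t i * R.resNext t i + α (t + 1) / 2 * R.resNext t i ^ 2)

/-- Excess of the linearized subproblem of iteration `t + 1` over its value at a solution. -/
noncomputable def err (t : ℕ) : ℝ :=
  R.fh (t + 1) + ∑ i, (R.z t i + α (t + 1) * R.res t i) * R.uh (t + 1) i

/-- Smoothness along the step `γ (uh - u)`. By complementarity the linear term at `u` is `z * res +
α * res ^ 2`, one augmented Lagrangian term plus `α / 2 * res ^ 2`; this surplus is the source of
the negative quadratic term. -/
theorem energy_le_of_step {t : ℕ} (ha : 0 < α (t + 1)) :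
    R.energy t ≤ (1 - γ (t + 1)) * (R.f t +
        ∑ i, (R.z t i * R.res t i + α (t + 1) / 2 * R.res t i ^ 2))
      - γ (t + 1) * α (t + 1) / 2 * ∑ i, R.res t i ^ 2 + γ (t + 1) * R.err t
      + γ (t + 1) ^ 2 * α (t + 1) / 2 * ∑ i, (R.uh (t + 1) i - R.u t i) ^ 2 := by
  set g := γ (t + 1)
  set a := α (t + 1)
  have h1 : ∀ i, R.z t i * R.resNext t i + a / 2 * R.resNext t i ^ 2 ≤
      (1 - g) * (R.z t i * R.res t i + a / 2 * R.res t i ^ 2) - g * a / 2 * R.res t i ^ 2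
      + g * ((R.z t i + a * R.res t i) * R.uh (t + 1) i)
      + g ^ 2 * a / 2 * (R.uh (t + 1) i - R.u t i) ^ 2 := fun i => by
    have h2 := alResidual_descent (b := R.ty i) (u := R.u t i) (z := R.z t i) ha (R.u (t + 1) i)
    have h3 := alResidual_complementary (b := R.ty i) (u := R.u t i) (z := R.z t i) ha
    change R.z t i * R.resNext t i + a / 2 * R.resNext t i ^ 2 ≤
      R.z t i * R.res t i + a / 2 * R.res t i ^ 2 + (R.z t i + a * R.res t i) * _ + _ at h2
    change (R.z t i + a * R.res t i) * _ = (R.z t i + a * R.res t i) * R.res t i at h3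
    have h4 : R.u (t + 1) i - R.u t i = g * (R.uh (t + 1) i - R.u t i) := by
      rw [R.u_succ t i]; ring
    rw [h4] at h2
    have h5 : (R.z t i + a * R.res t i) * (g * (R.uh (t + 1) i - R.u t i))
      = g * ((R.z t i + a * R.res t i) * R.uh (t + 1) i)
        - g * ((R.z t i + a * R.res t i) * R.res t i) := by
      rw [← h3]; ring
    rw [h5] at h2
    refine h2.trans (le_of_eq ?_)
    ring
  have h2 := Finset.sum_le_sum fun i (_ : i ∈ Finset.univ) => h1 i
  simp only [Finset.sum_add_distrib, Finset.sum_sub_distrib, ← Finset.mul_sum] at h2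
  simp only [energy, err, R.f_succ t, Finset.sum_add_distrib, ← Finset.mul_sum]
  refine (add_le_add_right h2 _).trans (le_of_eq ?_)
  ring

/-- `resNext t` is an admissible competitor for the residual belonging to the new multiplier and
penalty. The multiplier moves by `γ * resNext`, which costs `γ * resNext ^ 2`; the rest is the
growth of the penalty. -/
theorem lagrangian_le_energy {t : ℕ} (ha' : 0 < α (t + 2)) :
    R.f (t + 1) + ∑ i, (R.z (t + 1) i * R.res (t + 1) i + α (t + 2) / 2 * R.res (t + 1) i ^ 2) ≤
      R.energy t + (γ (t + 1) + (α (t + 2) - α (t + 1)) / 2) * ∑ i, R.resNext t i ^ 2 := by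
  rw [energy, add_assoc, Finset.mul_sum, ← Finset.sum_add_distrib]
  refine add_le_add_right (Finset.sum_le_sum fun i _ => ?_) _
  have h := alResidual_minimizes (b := R.ty i) (z := R.z (t + 1) i) ha'
    (le_alResidual (b := R.ty i) (u := R.u (t + 1) i) (z := R.z t i) (a := α (t + 1)))
    (fun hb => by rw [hb]; rfl)
  refine (show _ ≤ R.z (t + 1) i * R.resNext t i + α (t + 2) / 2 * R.resNext t i ^ 2
    from h).trans (le_of_eq ?_)
  have hz : R.z (t + 1) i = R.z t i + γ (t + 1) * R.resNext t i := R.z_succ t i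
  rw [hz]
  ring

end ALRun

/-! ### Elementary square root estimates and positivity of steps and penalties -/

theorem sqrt_succ_le_two_mul {t : ℕ} (ht : 1 ≤ t) : √((t + 1 : ℕ) : ℝ) ≤ 2 * √(t : ℝ) := by
  have h : (1 : ℝ) ≤ t := by exact_mod_cast ht
  rw [Real.sqrt_le_iff]
  refine ⟨by positivity, ?_⟩
  rw [mul_pow, Real.sq_sqrt (by positivity)]
  push_cast
  linarith

/-- Used to telescope increments of order `1 / t` of the multipliers into a multiple of `√t`. -/
theorem one_div_le_sqrt_succ_sub (t : ℕ) :
    1 / (2 * ((t : ℝ) + 1)) ≤ √((t + 1 : ℕ) : ℝ) - √(t : ℝ) := by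
  have hx : 0 ≤ √(t : ℝ) := Real.sqrt_nonneg _
  have hx2 : √(t : ℝ) ^ 2 = t := Real.sq_sqrt (by positivity)
  have hy2 : √((t + 1 : ℕ) : ℝ) ^ 2 = t + 1 := by rw [Real.sq_sqrt (by positivity)]; push_cast; ring
  have hy : 1 ≤ √((t + 1 : ℕ) : ℝ) := by
    rw [Real.one_le_sqrt]; push_cast; linarith [(Nat.cast_nonneg t : (0 : ℝ) ≤ t)]
  have hxy : √(t : ℝ) ≤ √((t + 1 : ℕ) : ℝ) := Real.sqrt_le_sqrt (by push_cast; linarith)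
  set x := √(t : ℝ)
  set y := √((t + 1 : ℕ) : ℝ)
  rw [← hy2, div_le_iff₀ (by positivity)]
  nlinarith [mul_nonneg (sub_nonneg.2 hxy) (by nlinarith : 0 ≤ 2 * y ^ 2 - y - x)]

namespace StepBounds
variable {γ α : ℕ → ℝ} {L : ℝ} {t₁ : ℕ}

theorem step_pos (h : StepBounds γ α L t₁) {t : ℕ} (ht : 1 ≤ t) : 0 < γ t :=
  lt_of_lt_of_le (by positivity) (h.step_ge t ht)

theorem penalty_pos (h : StepBounds γ α L t₁) {t : ℕ} (ht : 1 ≤ t) : 0 < α t := by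
  have h1 := h.le_penalty t ht
  have h2 : 0 < √(t : ℝ) := Real.sqrt_pos.2 (by exact_mod_cast ht)
  have h3 := h.one_le
  by_contra hcon
  nlinarith

end StepBounds

/-! ### A priori bounds and the energy recursion -/

namespace ALRun
variable {K : Type*} {γ α : ℕ → ℝ} {R : ALRun K γ α} {L : ℝ} {t₁ : ℕ} {B Z : ℝ}

/-- The bounds on a run from which constants are computed. -/
structure Bounded (R : ALRun K γ α) (t₁ : ℕ) (B Z : ℝ) : Prop where
  u_le : ∀ i, |R.u t₁ i| ≤ B
  uh_le : ∀ t i, |R.uh t i| ≤ B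
  fh_le : ∀ t, |R.fh t| ≤ B
  z_le : ∀ i, |R.z t₁ i| ≤ Z

theorem Bounded.abs_u_le (hs : StepBounds γ α L t₁) (hR : R.Bounded t₁ B Z) {t : ℕ}
    (ht : t₁ ≤ t) (i : K) : |R.u t i| ≤ B := by
  induction t, ht using Nat.le_induction with
  | base => exact hR.u_le i
  | succ t ht ih =>
    have h1 := hs.step_le_one (t + 1) (by omega)
    have h2 := (hs.step_pos (t := t + 1) (by omega)).le
    rw [R.u_succ t i]
    refine (abs_add_le _ _).trans ?_
    rw [abs_mul, abs_mul, abs_of_nonneg h2, abs_of_nonneg (sub_nonneg.2 h1)]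
    nlinarith [hR.uh_le (t + 1) i]

/-- A crude bound: the increments are O(1/t). Order `√t` is enough, since it matches the penalty and
keeps the ratio of multiplier and penalty, hence the residuals, bounded. -/
theorem Bounded.abs_z_le (hs : StepBounds γ α L t₁) (hR : R.Bounded t₁ B Z) {Y : ℝ}
    (hB : 0 ≤ B) (hZY : Z ≤ Y) (hBY : 2 * L * B ≤ Y) {t : ℕ} (ht : t₁ ≤ t) (i : K) :
    |R.z t i| ≤ Y * √(t : ℝ) := by
  have hL := hs.one_le
  have hY : 0 ≤ Y := le_trans (by positivity) hBY
  induction t, ht using Nat.le_induction with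
  | base =>
    have h1 : 1 ≤ √(t₁ : ℝ) := Real.one_le_sqrt.2 (by exact_mod_cast hs.pos)
    nlinarith [hR.z_le i]
  | succ t ht ih =>
    rw [R.z_succ]
    refine (abs_dual_update_le (hs.penalty_pos (by omega)) (hs.step_pos (by omega)).le
      (hs.step_le_penalty _ (by omega))).trans ?_
    have h1 := hs.step_le (t + 1) (by omega)
    have h2 := one_div_le_sqrt_succ_sub t
    have h3 := hR.abs_u_le hs (t := t + 1) (by omega) i
    have h4 : γ (t + 1) * |R.u (t + 1) i| ≤ L / ((t + 1 : ℕ) : ℝ) * B :=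
      mul_le_mul h1 h3 (abs_nonneg _) (by positivity)
    have h5 : L / ((t + 1 : ℕ) : ℝ) * B = 2 * L * B * (1 / (2 * ((t : ℝ) + 1))) := by
      push_cast; field_simp
    have h6 : 2 * L * B * (1 / (2 * ((t : ℝ) + 1))) ≤ Y * (√((t + 1 : ℕ) : ℝ) - √(t : ℝ)) :=
      mul_le_mul hBY h2 (by positivity) hY
    linarith

theorem Bounded.abs_resNext_le (hs : StepBounds γ α L t₁) (hR : R.Bounded t₁ B Z) {Y : ℝ}
    (hB : 0 ≤ B) (hZY : Z ≤ Y) (hBY : 2 * L * B ≤ Y) {t : ℕ} (ht : t₁ ≤ t) (i : K) :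
    |R.resNext t i| ≤ B + L * Y := by
  have hL := hs.one_le
  have hY : 0 ≤ Y := le_trans (by positivity) hBY
  have ha := hs.penalty_pos (t := t + 1) (by omega)
  refine (abs_alResidual_le ha).trans (add_le_add (hR.abs_u_le hs (by omega) i) ?_)
  rw [div_le_iff₀ ha]
  refine (hR.abs_z_le hs hB hZY hBY ht i).trans ?_
  have h1 := hs.le_penalty (t + 1) (by omega)
  have h2 : √(t : ℝ) ≤ √((t + 1 : ℕ) : ℝ) := Real.sqrt_le_sqrt (by push_cast; linarith)
  nlinarith [mul_le_mul_of_nonneg_left (h2.trans h1) hY]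

theorem Bounded.abs_res_le (hs : StepBounds γ α L t₁) (hR : R.Bounded t₁ B Z) {Y : ℝ}
    (hB : 0 ≤ B) (hZY : Z ≤ Y) (hBY : 2 * L * B ≤ Y) {t : ℕ} (ht : t₁ ≤ t) (i : K) :
    |R.res t i| ≤ B + L * Y := by
  have hL := hs.one_le
  have hY : 0 ≤ Y := le_trans (by positivity) hBY
  have ha := hs.penalty_pos (t := t + 1) (by omega)
  refine (abs_alResidual_le ha).trans (add_le_add (hR.abs_u_le hs ht i) ?_)
  rw [div_le_iff₀ ha]
  refine (hR.abs_z_le hs hB hZY hBY ht i).trans ?_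
  have h1 := hs.le_penalty (t + 1) (by omega)
  have h2 : √(t : ℝ) ≤ √((t + 1 : ℕ) : ℝ) := Real.sqrt_le_sqrt (by push_cast; linarith)
  nlinarith [mul_le_mul_of_nonneg_left (h2.trans h1) hY]

variable [Fintype K]

/-- The damage done by an arbitrary direction: multipliers and penalty are O(√t), so is the excess
in the subproblem, and the step O(1/t) reduces it to O(1/√t). -/
theorem Bounded.err_le (hs : StepBounds γ α L t₁) (hR : R.Bounded t₁ B Z) {Y : ℝ}
    (hB : 0 ≤ B) (hZY : Z ≤ Y) (hBY : 2 * L * B ≤ Y) {t : ℕ} (ht : t₁ ≤ t) :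
    γ (t + 1) * R.err t ≤ L * (B + Fintype.card K * ((Y + L * (B + L * Y)) * B)) /
      √((t + 1 : ℕ) : ℝ) := by
  have hL := hs.one_le
  have hY : 0 ≤ Y := le_trans (by positivity) hBY
  have hγ := hs.step_le (t + 1) (by omega)
  have hγ0 := (hs.step_pos (t := t + 1) (by omega)).le
  have ha := hs.penalty_pos (t := t + 1) (by omega)
  have ha1 := hs.penalty_le (t + 1) (by omega)
  have h2 : √(t : ℝ) ≤ √((t + 1 : ℕ) : ℝ) := Real.sqrt_le_sqrt (by push_cast; linarith)
  have hn : √((t + 1 : ℕ) : ℝ) ^ 2 = ((t + 1 : ℕ) : ℝ) := Real.sq_sqrt (by positivity)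
  have h1 : 1 ≤ √((t + 1 : ℕ) : ℝ) := Real.one_le_sqrt.2 (by
    push_cast; linarith [(Nat.cast_nonneg t : (0 : ℝ) ≤ t)])
  set r := √((t + 1 : ℕ) : ℝ)
  have hi : ∀ i, (R.z t i + α (t + 1) * R.res t i) * R.uh (t + 1) i ≤
      (Y + L * (B + L * Y)) * B * r := fun i => by
    have h3 := (hR.abs_z_le hs hB hZY hBY ht i).trans (mul_le_mul_of_nonneg_left h2 hY)
    have h4 := hR.abs_res_le hs hB hZY hBY ht i
    have h5 : |R.z t i + α (t + 1) * R.res t i| ≤ Y * r + L * r * (B + L * Y) := by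
      refine (abs_add_le _ _).trans (add_le_add h3 ?_)
      rw [abs_mul, abs_of_pos ha]
      exact mul_le_mul ha1 h4 (abs_nonneg _) (by positivity)
    refine (le_abs_self _).trans ?_
    rw [abs_mul]
    refine (mul_le_mul h5 (hR.uh_le (t + 1) i) (abs_nonneg _) (by positivity)).trans (le_of_eq ?_)
    ring
  have he : R.err t ≤ (B + Fintype.card K * ((Y + L * (B + L * Y)) * B)) * r := by
    have h3 := Finset.sum_le_sum fun i (_ : i ∈ Finset.univ) => hi i
    rw [Finset.sum_const, Finset.card_univ, nsmul_eq_mul] at h3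
    have h4 := (le_abs_self _).trans (hR.fh_le (t + 1))
    rw [err]
    nlinarith
  refine (mul_le_mul_of_nonneg_left he hγ0).trans ?_
  have hC : 0 ≤ B + Fintype.card K * ((Y + L * (B + L * Y)) * B) := by positivity
  refine (mul_le_mul_of_nonneg_right hγ (by positivity)).trans (le_of_eq ?_)
  rw [← hn]
  field_simp

set_option maxHeartbeats 400000 in
/-- Recursion for the augmented Lagrangian gap. -/
theorem Bounded.energy_succ_le (hs : StepBounds γ α L t₁) (hR : R.Bounded t₁ B Z) {Y : ℝ}
    (hB : 0 ≤ B) (hZY : Z ≤ Y) (hBY : 2 * L * B ≤ Y) {t : ℕ} (ht : t₁ ≤ t) :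
    R.energy (t + 1) ≤ (1 - γ (t + 2)) * R.energy t + γ (t + 2) * R.err (t + 1)
      + 4 * Fintype.card K * (L * (Y * L ^ 3 + L ^ 2 * (B + L * Y)) ^ 2 + L ^ 3 * B ^ 2)
        / (((t + 1 : ℕ) : ℝ) * √((t + 1 : ℕ) : ℝ)) := by
  have hL := hs.one_le
  have hY : 0 ≤ Y := le_trans (by positivity) hBY
  have hγ0 := hs.step_pos (t := t + 1) (by omega)
  have hγ1 := hs.step_pos (t := t + 2) (by omega)
  have hγ0' := hs.step_le (t + 1) (by omega)
  have hγ1' := hs.step_le (t + 2) (by omega)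
  have hγ1'' := hs.step_le_one (t + 2) (by omega)
  have ha0 := hs.penalty_pos (t := t + 1) (by omega)
  have ha1 := hs.penalty_pos (t := t + 2) (by omega)
  have ha0' := hs.le_penalty (t + 1) (by omega)
  have ha1' := hs.penalty_le (t + 2) (by omega)
  have hd0 : α (t + 1) ≤ α (t + 2) := hs.penalty_mono (t + 1)
  have hd1 : α (t + 2) - α (t + 1) ≤ _ := hs.penalty_diff (t + 1) (by omega)
  have hdom : 4 * (γ (t + 1) + (α (t + 2) - α (t + 1)) / 2) ≤ γ (t + 2) * α (t + 2) :=
    hs.dominated (t + 1) (by omega)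
  have hsq : √((t + 2 : ℕ) : ℝ) ≤ 2 * √((t + 1 : ℕ) : ℝ) := sqrt_succ_le_two_mul (by omega)
  have h2 : √(t : ℝ) ≤ √((t + 1 : ℕ) : ℝ) := Real.sqrt_le_sqrt (by push_cast; linarith)
  have hn : √((t + 1 : ℕ) : ℝ) ^ 2 = ((t + 1 : ℕ) : ℝ) := Real.sq_sqrt (by positivity)
  have h1 : 1 ≤ √((t + 1 : ℕ) : ℝ) := Real.one_le_sqrt.2 (by
    push_cast; linarith [(Nat.cast_nonneg t : (0 : ℝ) ≤ t)])
  have hγ1n : γ (t + 2) ≤ L / ((t + 1 : ℕ) : ℝ) := hγ1'.trans (by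
    gcongr; omega)
  have hstep : R.energy (t + 1) ≤ _ := R.energy_le_of_step (t := t + 1) ha1
  have hlag := R.lagrangian_le_energy (t := t) ha1
  set r := √((t + 1 : ℕ) : ℝ)
  rw [← hn] at hγ0' hγ1n ⊢
  set c := γ (t + 1) + (α (t + 2) - α (t + 1)) / 2 with hc
  have hc0 : 0 ≤ c := by linarith
  have hr0 : 0 < r := by linarith
  have hLr : L / r ^ 2 ≤ L / r := by
    rw [sq]
    exact div_le_div_of_nonneg_left (by linarith) hr0 (le_mul_of_one_le_left hr0.le h1)
  have hr2 : 1 ≤ r ^ 2 := one_le_pow₀ h1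
  have hc1 : c ≤ 2 * (L / r) := by linarith [div_pos (zero_lt_one.trans_le hL) hr0]
  set D := Y * L ^ 3 + L ^ 2 * (B + L * Y) with hD
  have hD0 : 0 ≤ D := by positivity
  -- Both residuals belong to iterate `t + 1`. They differ only through the ratio of multiplier and
  -- penalty, which moves by O(1/t).
  have hΔ : ∀ i, |R.resNext t i - R.res (t + 1) i| ≤ D / r ^ 2 := fun i => by
    refine (abs_alResidual_sub_le _ _).trans ?_
    have hz : R.z (t + 1) i = R.z t i + γ (t + 1) * R.resNext t i := R.z_succ t i
    have h3 := (hR.abs_z_le hs hB hZY hBY ht i).trans (mul_le_mul_of_nonneg_left h2 hY)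
    have h4 := hR.abs_resNext_le hs hB hZY hBY ht i
    have h5 : R.z t i / α (t + 1) - R.z (t + 1) i / α (t + 2) =
        R.z t i * (α (t + 2) - α (t + 1)) * (1 / α (t + 1)) * (1 / α (t + 2))
          - γ (t + 1) * R.resNext t i * (1 / α (t + 2)) := by
      rw [hz]; field_simp; ring
    have h6 : 1 / α (t + 1) ≤ L / r := by
      rw [div_le_div_iff₀ ha0 hr0]; linarith
    have h7 : 1 / α (t + 2) ≤ L / r := (one_div_le_one_div_of_le ha0 hd0).trans h6
    change |R.z t i / α (t + 1) - R.z (t + 1) i / α (t + 2)| ≤ _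
    rw [h5]
    refine (abs_sub _ _).trans ?_
    rw [abs_mul, abs_mul, abs_mul, abs_mul, abs_mul, abs_of_nonneg (sub_nonneg.2 hd0),
      abs_of_pos (one_div_pos.2 ha0), abs_of_pos (one_div_pos.2 ha1), abs_of_pos hγ0]
    have h8 : |R.z t i| * (α (t + 2) - α (t + 1)) * (1 / α (t + 1)) * (1 / α (t + 2)) ≤
        Y * r * (L / r) * (L / r) * (L / r) :=
      mul_le_mul (mul_le_mul (mul_le_mul h3 hd1 (sub_nonneg.2 hd0) (by positivity)) h6
        (by positivity) (by positivity)) h7 (by positivity) (by positivity)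
    have h9 : γ (t + 1) * |R.resNext t i| * (1 / α (t + 2)) ≤ L / r ^ 2 * (B + L * Y) * (L / r) :=
      mul_le_mul (mul_le_mul hγ0' h4 (abs_nonneg _) (by positivity)) h7 (by positivity)
        (by positivity)
    have h10 : Y * r * (L / r) * (L / r) * (L / r) = Y * L ^ 3 / r ^ 2 := by field_simp
    have h11 : L / r ^ 2 * (B + L * Y) * (L / r) ≤ L ^ 2 * (B + L * Y) / r ^ 2 := by
      have : L / r ^ 2 * (B + L * Y) * (L / r) = L ^ 2 * (B + L * Y) / r ^ 2 * (1 / r) := by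
        field_simp
      rw [this]
      exact mul_le_of_le_one_right (by positivity) ((div_le_one hr0).2 h1)
    rw [hD, add_div]
    linarith
  have hsum : ∑ i, R.resNext t i ^ 2 ≤
      2 * ∑ i, R.res (t + 1) i ^ 2 + Fintype.card K * (2 * (D / r ^ 2) ^ 2) := by
    rw [Finset.mul_sum, ← nsmul_eq_mul, ← Finset.card_univ, ← Finset.sum_const,
      ← Finset.sum_add_distrib]
    refine Finset.sum_le_sum fun i _ => ?_
    have h3 := sq_le_sq' (neg_le_of_abs_le (hΔ i)) (le_of_abs_le (hΔ i))
    linarith [sq_nonneg (R.resNext t i - 2 * R.res (t + 1) i)]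
  have hdiff : ∑ i, (R.uh (t + 2) i - R.u (t + 1) i) ^ 2 ≤ Fintype.card K * (4 * B ^ 2) := by
    rw [← nsmul_eq_mul, ← Finset.card_univ, ← Finset.sum_const]
    refine Finset.sum_le_sum fun i _ => ?_
    have h3 := abs_le.1 (hR.uh_le (t + 2) i)
    have h4 := abs_le.1 (hR.abs_u_le hs (t := t + 1) (by omega) i)
    have h5 : (R.uh (t + 2) i - R.u (t + 1) i) ^ 2 ≤ (2 * B) ^ 2 :=
      sq_le_sq' (by linarith) (by linarith)
    linarith
  have hH : 0 ≤ ∑ i, R.res (t + 1) i ^ 2 := Finset.sum_nonneg fun _ _ => sq_nonneg _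
  have hN : 0 ≤ ∑ i, R.resNext t i ^ 2 := Finset.sum_nonneg fun _ _ => sq_nonneg _
  change R.energy (t + 1) ≤ (1 - γ (t + 2)) * (R.f (t + 1) + _)
    - γ (t + 2) * α (t + 2) / 2 * _ + γ (t + 2) * R.err (t + 1)
    + γ (t + 2) ^ 2 * α (t + 2) / 2 * ∑ i, (R.uh (t + 2) i - R.u (t + 1) i) ^ 2 at hstep
  have e1 := mul_le_mul_of_nonneg_left hlag (sub_nonneg.2 hγ1'')
  have e2 : (1 - γ (t + 2)) * (c * ∑ i, R.resNext t i ^ 2) ≤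
      2 * c * ∑ i, R.res (t + 1) i ^ 2 + 2 * (L / r) * (Fintype.card K * (2 * (D / r ^ 2) ^ 2)) := by
    calc _ ≤ c * ∑ i, R.resNext t i ^ 2 :=
          mul_le_of_le_one_left (mul_nonneg hc0 hN) (by linarith)
      _ ≤ c * (2 * ∑ i, R.res (t + 1) i ^ 2 + Fintype.card K * (2 * (D / r ^ 2) ^ 2)) :=
          mul_le_mul_of_nonneg_left hsum hc0
      _ ≤ _ := by
          have := mul_le_mul_of_nonneg_right hc1
            (by positivity : 0 ≤ (Fintype.card K : ℝ) * (2 * (D / r ^ 2) ^ 2))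
          linarith
  -- Here `4 * c ≤ γ * α` lets the negative term of the conditional gradient step absorb the cost of
  -- updating multiplier and penalty.
  have e3 : 2 * c * ∑ i, R.res (t + 1) i ^ 2 ≤
      γ (t + 2) * α (t + 2) / 2 * ∑ i, R.res (t + 1) i ^ 2 :=
    mul_le_mul_of_nonneg_right (by linarith) hH
  -- The curvature term, of order γ² α = O(t^(-3/2)).
  have e4 : γ (t + 2) ^ 2 * α (t + 2) / 2 * ∑ i, (R.uh (t + 2) i - R.u (t + 1) i) ^ 2 ≤
      (L / r ^ 2) ^ 2 * (L * (2 * r)) / 2 * (Fintype.card K * (4 * B ^ 2)) := by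
    refine mul_le_mul ?_ hdiff (Finset.sum_nonneg fun _ _ => sq_nonneg _) (by positivity)
    have : α (t + 2) ≤ L * (2 * r) := ha1'.trans (mul_le_mul_of_nonneg_left hsq (by linarith))
    gcongr
  have e5 : 2 * (L / r) * (Fintype.card K * (2 * (D / r ^ 2) ^ 2)) ≤
      4 * Fintype.card K * (L * D ^ 2) / (r ^ 2 * r) := by
    have : 2 * (L / r) * (Fintype.card K * (2 * (D / r ^ 2) ^ 2)) =
        4 * Fintype.card K * (L * D ^ 2) / (r ^ 2 * r) * (1 / r ^ 2) := by field_simp; ring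
    rw [this]
    exact mul_le_of_le_one_right (by positivity) ((div_le_one (pow_pos hr0 2)).2 hr2)
  have e6 : (L / r ^ 2) ^ 2 * (L * (2 * r)) / 2 * (Fintype.card K * (4 * B ^ 2)) =
      4 * Fintype.card K * (L ^ 3 * B ^ 2) / (r ^ 2 * r) := by field_simp
  have e7 : 4 * (Fintype.card K : ℝ) * (L * D ^ 2 + L ^ 3 * B ^ 2) / (r ^ 2 * r) =
      4 * Fintype.card K * (L * D ^ 2) / (r ^ 2 * r)
        + 4 * Fintype.card K * (L ^ 3 * B ^ 2) / (r ^ 2 * r) := by ring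
  rw [e7]
  linarith

end ALRun

/-! ### Inequalities for solving the recursions -/

theorem one_div_mul_sqrt_le {t : ℕ} (ht : 1 ≤ t) :
    1 / (((t + 1 : ℕ) : ℝ) * √((t + 1 : ℕ) : ℝ)) ≤ 2 * (1 / √(t : ℝ) - 1 / √((t + 1 : ℕ) : ℝ)) := by
  have hx2 : √(t : ℝ) ^ 2 = t := Real.sq_sqrt (by positivity)
  have hy2 : √((t + 1 : ℕ) : ℝ) ^ 2 = ((t + 1 : ℕ) : ℝ) := Real.sq_sqrt (by positivity)
  have hx : 0 < √(t : ℝ) := Real.sqrt_pos.2 (by exact_mod_cast ht)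
  have hxy : √(t : ℝ) ≤ √((t + 1 : ℕ) : ℝ) := Real.sqrt_le_sqrt (by push_cast; linarith)
  have hd : √((t + 1 : ℕ) : ℝ) ^ 2 - √(t : ℝ) ^ 2 = 1 := by rw [hx2, hy2]; push_cast; ring
  set x := √(t : ℝ)
  set y := √((t + 1 : ℕ) : ℝ)
  rw [← hy2]
  have hy : 0 < y := hx.trans_le hxy
  have h1 : 2 * (1 / x - 1 / y) = 2 * (y - x) / (x * y) := by field_simp
  rw [h1, div_le_div_iff₀ (by positivity) (by positivity), one_mul]
  have h2 : 1 ≤ 2 * (y - x) * y := by nlinarith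
  have h3 : 0 ≤ y - x := by linarith
  nlinarith [mul_nonneg (mul_nonneg hx.le hy.le) (by linarith : 0 ≤ 2 * (y - x) * y - 1),
    mul_nonneg (mul_nonneg h3 h3) hy.le, mul_nonneg h3 (mul_nonneg hy.le hy.le)]

/-- One step of the recursion `e' ≤ (1 - γ) e + P n ^ (-3 / 2)` preserves `e ≤ M / √n`. -/
theorem recursion_step {n : ℕ} (hn : 1 ≤ n) {g M P : ℝ} (hP : 0 ≤ P) (hM : 3 * P ≤ M)
    (hg : 2 / (((n + 1 : ℕ) : ℝ) + 1) ≤ g) :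
    (1 - g) * (M / √(n : ℝ)) + P / ((n : ℝ) * √(n : ℝ)) ≤ M / √((n + 1 : ℕ) : ℝ) := by
  have hn' : (1 : ℝ) ≤ n := by exact_mod_cast hn
  have hx2 : √(n : ℝ) ^ 2 = n := Real.sq_sqrt (by positivity)
  have hy2 : √((n + 1 : ℕ) : ℝ) ^ 2 = n + 1 := by rw [Real.sq_sqrt (by positivity)]; push_cast; ring
  have hx : 0 < √(n : ℝ) := Real.sqrt_pos.2 (by linarith)
  have hy : 0 < √((n + 1 : ℕ) : ℝ) := Real.sqrt_pos.2 (by positivity)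
  push_cast at hg
  set x := √(n : ℝ)
  set y := √((n + 1 : ℕ) : ℝ)
  have hM0 : 0 ≤ M := by linarith
  have h1 : 1 - g ≤ n / ((n : ℝ) + 2) := by
    have : (n : ℝ) / (n + 2) = 1 - 2 / ((n : ℝ) + 1 + 1) := by field_simp; ring
    linarith
  have h2 : (1 - g) * (M / x) ≤ n / ((n : ℝ) + 2) * (M / x) :=
    mul_le_mul_of_nonneg_right h1 (by positivity)
  -- Here `3 * P ≤ M` enters, through `n + 2 ≤ 3 * n`. The two terms then add up to `M * (n + 1) /
  -- ((n + 2) * √n)`.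
  have h3 : P / (n * x) ≤ M / ((n + 2) * x) := by
    rw [div_le_div_iff₀ (by positivity) (by positivity)]
    have : P * (n + 2) ≤ M * n := by nlinarith
    nlinarith
  have h4 : n / ((n : ℝ) + 2) * (M / x) + M / ((n + 2) * x) = M * ((n + 1) / ((n + 2) * x)) := by
    field_simp
  have h5 : ((n : ℝ) + 1) * y ≤ (n + 2) * x := by
    refine le_of_sq_le_sq ?_ (by positivity)
    rw [mul_pow, mul_pow, hx2, hy2]
    nlinarith
  have h6 : ((n : ℝ) + 1) / ((n + 2) * x) ≤ 1 / y := by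
    rw [div_le_div_iff₀ (by positivity) hy]; linarith
  have h7 : M * (((n : ℝ) + 1) / ((n + 2) * x)) ≤ M * (1 / y) := mul_le_mul_of_nonneg_left h6 hM0
  rw [mul_one_div] at h7
  linarith

/-- Young's inequality, weighted to balance a bounded `x` against an `h` of size `1 / r`. -/
theorem abs_sum_mul_le {K : Type*} [Fintype K] {r S : ℝ} (hr : 0 < r) (x h : K → ℝ)
    (hh : ∑ i, h i ^ 2 ≤ S / r ^ 2) : |∑ i, x i * h i| ≤ (∑ i, x i ^ 2 + S) / (2 * r) := by
  refine (Finset.abs_sum_le_sum_abs _ _).trans ?_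
  have h1 : ∀ i, |x i * h i| ≤ 1 / (2 * r) * x i ^ 2 + r / 2 * h i ^ 2 := by
    intro i
    have h2 : 0 ≤ r / 2 * (1 / r * |x i| - |h i|) ^ 2 := by positivity
    have h3 : r / 2 * (1 / r * |x i| - |h i|) ^ 2 =
        1 / (2 * r) * |x i| ^ 2 - |x i| * |h i| + r / 2 * |h i| ^ 2 := by
      field_simp
      ring
    rw [h3, sq_abs, sq_abs] at h2
    rw [abs_mul]
    linarith
  refine (Finset.sum_le_sum fun i _ => h1 i).trans ?_
  rw [Finset.sum_add_distrib, ← Finset.mul_sum, ← Finset.mul_sum]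
  have h2 := mul_le_mul_of_nonneg_left hh (by positivity : 0 ≤ r / 2)
  have h3 : r / 2 * (S / r ^ 2) = S / (2 * r) := by field_simp
  rw [add_div]
  have h4 : 1 / (2 * r) * ∑ i, x i ^ 2 = (∑ i, x i ^ 2) / (2 * r) := by ring
  linarith

/-! ### Energy decay, boundedness of the multipliers, and the rate -/

namespace ALRun
variable {K : Type*} [Fintype K] {γ α : ℕ → ℝ} {R : ALRun K γ α} {L : ℝ} {t₁ : ℕ} {B Z : ℝ}

open Classical in
/-- The number of iterations up to `t + 1` that do not solve the linearized subproblem. -/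
noncomputable def badCount (R : ALRun K γ α) (t : ℕ) : ℕ :=
  ((Finset.range (t + 1)).filter fun s => 0 < R.err s).card

theorem badCount_mono (R : ALRun K γ α) {s t : ℕ} (h : s ≤ t) : R.badCount s ≤ R.badCount t := by
  classical
  exact Finset.card_le_card (Finset.filter_subset_filter _ (Finset.range_subset_range.2 (by omega)))

theorem badCount_succ (R : ALRun K γ α) (t : ℕ) [Decidable (0 < R.err (t + 1))] :
    R.badCount (t + 1) = R.badCount t + if 0 < R.err (t + 1) then 1 else 0 := by
  classical
  rw [badCount, Finset.range_add_one, Finset.filter_insert, badCount]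
  split_ifs
  · rw [Finset.card_insert_of_notMem (by simp)]
  · rfl

/-- The recursion preserves `M / √t` for every large `M`, and a failed iteration adds at most `D /
√t`, which amounts to replacing `M` by `M + D`. So failures enter only through their number. -/
theorem exists_energy_bound (hs : StepBounds γ α L t₁) (B Z E : ℝ) (hB : 0 ≤ B) :
    ∃ M₀ D : ℝ, 0 ≤ M₀ ∧ 0 ≤ D ∧ ∀ R : ALRun K γ α, R.Bounded t₁ B Z → R.energy t₁ ≤ E →
      ∀ t, t₁ ≤ t → R.energy t ≤ (M₀ + D * R.badCount t) / √((t + 1 : ℕ) : ℝ) := by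
  have hL := hs.one_le
  set Y := max Z (2 * L * B) with hY
  have hZY : Z ≤ Y := le_max_left _ _
  have hBY : 2 * L * B ≤ Y := le_max_right _ _
  have hY0 : 0 ≤ Y := le_trans (by positivity) hBY
  set P := 4 * Fintype.card K * (L * (Y * L ^ 3 + L ^ 2 * (B + L * Y)) ^ 2 + L ^ 3 * B ^ 2) with hP
  set D := L * (B + Fintype.card K * ((Y + L * (B + L * Y)) * B)) with hD
  have hP0 : 0 ≤ P := by positivity
  have hD0 : 0 ≤ D := by positivity
  refine ⟨max (3 * P) (E * √((t₁ + 1 : ℕ) : ℝ)), D, (by positivity : 0 ≤ 3 * P).trans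
    (le_max_left _ _), hD0, fun R hR hE t ht => ?_⟩
  set M₀ := max (3 * P) (E * √((t₁ + 1 : ℕ) : ℝ))
  have hM₀ : 3 * P ≤ M₀ := le_max_left _ _
  classical
  induction t, ht using Nat.le_induction with
  | base =>
    have h1 : 0 < √((t₁ + 1 : ℕ) : ℝ) := Real.sqrt_pos.2 (by positivity)
    rw [le_div_iff₀ h1]
    have h2 : E * √((t₁ + 1 : ℕ) : ℝ) ≤ M₀ := le_max_right _ _
    have h3 : 0 ≤ D * R.badCount t₁ := by positivity
    nlinarith
  | succ t ht ih =>
    have h1 := hR.energy_succ_le hs hB hZY hBY ht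
    have h2 : 3 * P ≤ M₀ + D * R.badCount t := by
      have : 0 ≤ D * R.badCount t := by positivity
      linarith
    have h3 := recursion_step (n := t + 1) (by omega) hP0 h2 (hs.step_ge (t + 2) (by omega))
    have h4 := hs.step_le_one (t + 2) (by omega)
    have h5 := mul_le_mul_of_nonneg_left ih (sub_nonneg.2 h4)
    have h6 : γ (t + 2) * R.err (t + 1) ≤
        D * ((if 0 < R.err (t + 1) then 1 else 0 : ℕ) : ℝ) / √((t + 1 + 1 : ℕ) : ℝ) := by
      split_ifs with h
      · rw [Nat.cast_one, mul_one]
        exact hR.err_le hs hB hZY hBY (by omega)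
      · rw [Nat.cast_zero, mul_zero, zero_div]
        exact mul_nonpos_of_nonneg_of_nonpos (hs.step_pos (by omega)).le (not_lt.1 h)
    rw [R.badCount_succ t, Nat.cast_add, mul_add, ← add_assoc, add_div]
    linarith

/-- With `y` fixed the Lagrangian is averaged along the run with nonnegative values at the
directions. Only the initial deficit `ρ` survives, damped by factors `1 - γ ≤ t / (t + 1)`; it
allows for early steps with `γ > 1`, which may leave the hull. -/
theorem dual_lower_bound (hs : StepBounds γ α L t₁) (R : ALRun K γ α) {y : K → ℝ} {ρ : ℝ}
    (hρ : 0 ≤ ρ) (hh : ∀ t, 0 ≤ R.fh t + ∑ i, y i * R.uh t i)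
    (h₁ : -ρ ≤ R.f t₁ + ∑ i, y i * R.u t₁ i) {t : ℕ} (ht : t₁ ≤ t) :
    -(ρ * t₁ / t) ≤ R.f t + ∑ i, y i * R.u t i := by
  have hp := hs.pos
  induction t, ht using Nat.le_induction with
  | base =>
    have : (t₁ : ℝ) ≠ 0 := by positivity
    rwa [mul_div_assoc, div_self this, mul_one]
  | succ t ht ih =>
    have h1 : R.f (t + 1) + ∑ i, y i * R.u (t + 1) i = (1 - γ (t + 1)) *
        (R.f t + ∑ i, y i * R.u t i) + γ (t + 1) * (R.fh (t + 1) + ∑ i, y i * R.uh (t + 1) i) := by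
      have : ∀ i, y i * R.u (t + 1) i =
          (1 - γ (t + 1)) * (y i * R.u t i) + γ (t + 1) * (y i * R.uh (t + 1) i) := fun i => by
        rw [R.u_succ]; ring
      simp only [R.f_succ, this, Finset.sum_add_distrib, ← Finset.mul_sum]
      ring
    have h2 := mul_nonneg (hs.step_pos (t := t + 1) (by omega)).le (hh (t + 1))
    have h3 := mul_le_mul_of_nonneg_left ih (sub_nonneg.2 (hs.step_le_one (t + 1) (by omega)))
    have ht0 : (0 : ℝ) < t := by exact_mod_cast (by omega : 0 < t)
    have h4 := hs.step_ge (t + 1) (by omega)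
    have h5 : (1 - γ (t + 1)) * (ρ * t₁ / t) ≤ ρ * t₁ / ((t + 1 : ℕ) : ℝ) := by
      have h6 : 1 - γ (t + 1) ≤ t / ((t + 1 : ℕ) : ℝ) := by
        have : (t : ℝ) / ((t + 1 : ℕ) : ℝ) = 1 - 1 / ((t + 1 : ℕ) : ℝ) := by
          push_cast; field_simp; ring
        have h7 : 1 / ((t + 1 : ℕ) : ℝ) ≤ 2 / (((t + 1 : ℕ) : ℝ) + 1) := by
          rw [div_le_div_iff₀ (by positivity) (by positivity)]; push_cast; linarith
        linarith
      refine (mul_le_mul_of_nonneg_right h6 (by positivity)).trans (le_of_eq ?_)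
      field_simp
    linarith

/-- `1` plus the squared distance of the multipliers to `y`. -/
def dualDist (R : ALRun K γ α) (y : K → ℝ) (t : ℕ) : ℝ := 1 + ∑ i, (R.z t i - y i) ^ 2

/-- Subtracting the lower bound at `y` from the energy bound leaves `∑ ((z - y) * resNext + α / 2 *
resNext ^ 2) ≤ 2 * M / √(t + 1)`. Completing the square trades the cross term for `|z - y|² / α`,
and division by `α` gives the order `1 / t`. -/
theorem sum_sq_resNext_le (hs : StepBounds γ α L t₁) {y : K → ℝ}
    (hy : ∀ i, R.ty i = true → 0 ≤ y i) {M : ℝ} (hM : 0 ≤ M) {t : ℕ}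
    (hE : R.energy t ≤ M / √((t + 1 : ℕ) : ℝ))
    (hφ : -(M / √((t + 1 : ℕ) : ℝ)) ≤ R.f (t + 1) + ∑ i, y i * R.u (t + 1) i) :
    -(M / √((t + 1 : ℕ) : ℝ)) ≤ R.f (t + 1) + ∑ i, y i * R.resNext t i ∧
    ∑ i, R.resNext t i ^ 2 ≤ (8 * M * L + 4 * L ^ 2) * R.dualDist y t / ((t + 1 : ℕ) : ℝ) := by
  have hL := hs.one_le
  -- Truncation only raises the residuals of inequalities, where `y` is nonnegative.
  have hyu : ∑ i, y i * R.u (t + 1) i ≤ ∑ i, y i * R.resNext t i :=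
    Finset.sum_le_sum fun i _ => by
      rcases hb : R.ty i with _ | _
      · rw [resNext, hb, alResidual_false]
      · exact mul_le_mul_of_nonneg_left le_alResidual (hy i hb)
  have hlow : -(M / √((t + 1 : ℕ) : ℝ)) ≤ R.f (t + 1) + ∑ i, y i * R.resNext t i := by linarith
  refine ⟨hlow, ?_⟩
  have ha := hs.penalty_pos (t := t + 1) (by omega)
  have ha' := hs.le_penalty (t + 1) (by omega)
  have hn : √((t + 1 : ℕ) : ℝ) ^ 2 = ((t + 1 : ℕ) : ℝ) := Real.sq_sqrt (by positivity)
  have hr : 0 < √((t + 1 : ℕ) : ℝ) := Real.sqrt_pos.2 (by positivity)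
  rw [energy] at hE
  rw [← hn]
  set r := √((t + 1 : ℕ) : ℝ)
  set a := α (t + 1)
  have h1 : ∑ i, (R.z t i * R.resNext t i + a / 2 * R.resNext t i ^ 2)
      - ∑ i, y i * R.resNext t i ≤ 2 * M / r := by
    have : 2 * M / r = M / r + M / r := by ring
    linarith
  rw [← Finset.sum_sub_distrib] at h1
  have h2 : ∑ i, (a / 4 * R.resNext t i ^ 2 - 1 / a * (R.z t i - y i) ^ 2) ≤ 2 * M / r := by
    refine (Finset.sum_le_sum fun i _ => ?_).trans h1
    have h3 : 0 ≤ a * (R.resNext t i / 2 + 1 / a * (R.z t i - y i)) ^ 2 := by positivity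
    have h4 : a * (R.resNext t i / 2 + 1 / a * (R.z t i - y i)) ^ 2 = a / 4 * R.resNext t i ^ 2
      + R.resNext t i * (R.z t i - y i) + 1 / a * (R.z t i - y i) ^ 2 := by field_simp; ring
    nlinarith
  rw [Finset.sum_sub_distrib, ← Finset.mul_sum, ← Finset.mul_sum] at h2
  have hd : 1 + ∑ i, (R.z t i - y i) ^ 2 = R.dualDist y t := rfl
  have hd0 : 0 ≤ ∑ i, (R.z t i - y i) ^ 2 := Finset.sum_nonneg fun _ _ => sq_nonneg _
  have hinv : 1 / a ≤ L / r := by rw [div_le_div_iff₀ ha hr]; linarith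
  have h3 : a * ∑ i, R.resNext t i ^ 2 ≤ (8 * M + 4 * L) / r * R.dualDist y t := by
    have h4 := mul_le_mul_of_nonneg_right hinv hd0
    have h5 : 0 ≤ 8 * M / r * ∑ i, (R.z t i - y i) ^ 2 := by positivity
    have h6 : 0 ≤ 4 * L / r := by positivity
    rw [← hd]
    have h7 : (8 * M + 4 * L) / r * (1 + ∑ i, (R.z t i - y i) ^ 2) = 4 * (2 * M / r)
      + 4 * (L / r * ∑ i, (R.z t i - y i) ^ 2) + 8 * M / r * ∑ i, (R.z t i - y i) ^ 2
      + 4 * L / r := by ring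
    rw [h7]
    linarith
  have hd1 : 0 ≤ R.dualDist y t := by rw [← hd]; linarith
  calc ∑ i, R.resNext t i ^ 2 = 1 / a * (a * ∑ i, R.resNext t i ^ 2) := by field_simp
    _ ≤ L / r * ((8 * M + 4 * L) / r * R.dualDist y t) :=
        mul_le_mul hinv h3 (mul_nonneg ha.le (Finset.sum_nonneg fun _ _ => sq_nonneg _))
          (by positivity)
    _ = _ := by field_simp

/-- Young's inequality with weight of order √t splits the cross term `2 γ (z - y) resNext` into two
parts of order γ/√t relative to `dualDist`. As γ = O(1/t), the relative growth is O(t^(-3/2)). -/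
theorem dualDist_succ_le (hs : StepBounds γ α L t₁) {y : K → ℝ} {G : ℝ} {t : ℕ}
    (hG : 0 ≤ G)
    (h : ∑ i, R.resNext t i ^ 2 ≤ G * R.dualDist y t / ((t + 1 : ℕ) : ℝ)) :
    R.dualDist y (t + 1) ≤ R.dualDist y t *
      (1 + (L * (1 + G) + L ^ 2 * G) * (1 / (((t + 1 : ℕ) : ℝ) * √((t + 1 : ℕ) : ℝ)))) := by
  have hL := hs.one_le
  have hγ := hs.step_le (t + 1) (by omega)
  have hγ0 := hs.step_pos (t := t + 1) (by omega)
  have hn : √((t + 1 : ℕ) : ℝ) ^ 2 = ((t + 1 : ℕ) : ℝ) := Real.sq_sqrt (by positivity)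
  have h1 : 1 ≤ √((t + 1 : ℕ) : ℝ) := Real.one_le_sqrt.2 (by
    push_cast; linarith [(Nat.cast_nonneg t : (0 : ℝ) ≤ t)])
  set r := √((t + 1 : ℕ) : ℝ)
  rw [← hn] at h hγ ⊢
  have hr : 0 < r := by linarith
  set S := ∑ i, R.resNext t i ^ 2
  set D := ∑ i, (R.z t i - y i) ^ 2 with hD
  have hS : 0 ≤ S := Finset.sum_nonneg fun _ _ => sq_nonneg _
  have hD0 : 0 ≤ D := Finset.sum_nonneg fun _ _ => sq_nonneg _
  have hQ : R.dualDist y t = 1 + D := rfl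
  have h2 : ∑ i, (R.z (t + 1) i - y i) ^ 2 ≤
      D + γ (t + 1) * (1 / r * D + r * S) + γ (t + 1) ^ 2 * S := by
    simp only [hD, S, Finset.mul_sum, ← Finset.sum_add_distrib]
    refine Finset.sum_le_sum fun i _ => ?_
    have hz : R.z (t + 1) i = R.z t i + γ (t + 1) * R.resNext t i := R.z_succ t i
    have h3 : 0 ≤ γ (t + 1) * (r * (1 / r * (R.z t i - y i) - R.resNext t i) ^ 2) := by positivity
    have h4 : r * (1 / r * (R.z t i - y i) - R.resNext t i) ^ 2 = 1 / r * (R.z t i - y i) ^ 2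
      - 2 * ((R.z t i - y i) * R.resNext t i) + r * R.resNext t i ^ 2 := by field_simp; ring
    rw [h4] at h3
    rw [hz]
    nlinarith
  have hQ0 : 0 ≤ R.dualDist y t := by rw [hQ]; linarith
  have h3 : 1 / r * D + r * S ≤ (1 + G) * R.dualDist y t / r := by
    have h5 : r * S ≤ r * (G * R.dualDist y t / r ^ 2) := mul_le_mul_of_nonneg_left h hr.le
    have h6 : r * (G * R.dualDist y t / r ^ 2) = G * R.dualDist y t / r := by field_simp
    have h7 : 1 / r * D ≤ 1 / r * R.dualDist y t :=
      mul_le_mul_of_nonneg_left (by linarith) (by positivity)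
    have h8 : (1 + G) * R.dualDist y t / r = 1 / r * R.dualDist y t + G * R.dualDist y t / r := by
      ring
    linarith
  have h4 : γ (t + 1) * (1 / r * D + r * S) ≤ L / r ^ 2 * ((1 + G) * R.dualDist y t / r) :=
    mul_le_mul hγ h3 (by positivity) (by positivity)
  have h5 : γ (t + 1) ^ 2 * S ≤ (L / r ^ 2) ^ 2 * (G * R.dualDist y t / r ^ 2) :=
    mul_le_mul (pow_le_pow_left₀ hγ0.le hγ 2) h hS (by positivity)
  have h6 : (L / r ^ 2) ^ 2 * (G * R.dualDist y t / r ^ 2) ≤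
      L ^ 2 * G * R.dualDist y t * (1 / (r ^ 2 * r)) := by
    have : (L / r ^ 2) ^ 2 * (G * R.dualDist y t / r ^ 2) =
        L ^ 2 * G * R.dualDist y t * (1 / (r ^ 2 * r)) * (1 / r ^ 3) := by field_simp
    rw [this]
    exact mul_le_of_le_one_right (by positivity) ((div_le_one (by positivity)).2 (one_le_pow₀ h1))
  have h7 : L / r ^ 2 * ((1 + G) * R.dualDist y t / r) =
      L * (1 + G) * R.dualDist y t * (1 / (r ^ 2 * r)) := by field_simp
  have h8 : R.dualDist y (t + 1) = 1 + ∑ i, (R.z (t + 1) i - y i) ^ 2 := rfl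
  rw [h8]
  nlinarith

/-- Runs with boundedly many failed iterations converge at rate `1 / √t`. -/
theorem exists_rate (hs : StepBounds γ α L t₁) (B Z E ρ : ℝ) (hB : 0 ≤ B) (hρ : 0 ≤ ρ)
    (y : K → ℝ) (J : ℕ) :
    ∃ C : ℝ, ∀ R : ALRun K γ α, R.Bounded t₁ B Z → R.energy t₁ ≤ E →
      (∀ i, R.ty i = true → 0 ≤ y i) → (∀ t, 0 ≤ R.fh t + ∑ i, y i * R.uh t i) →
      -ρ ≤ R.f t₁ + ∑ i, y i * R.u t₁ i → ∀ t, t₁ ≤ t → R.badCount t ≤ J →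
      |R.f (t + 1)| ≤ C / √((t + 1 : ℕ) : ℝ) ∧
      ∑ i, R.resNext t i ^ 2 ≤ C / ((t + 1 : ℕ) : ℝ) := by
  obtain ⟨M₀, D, hM₀, hD, hen⟩ := exists_energy_bound (K := K) hs B Z E hB
  have hL := hs.one_le
  -- A single constant for the energy bound from above and the duality bound from below.
  set M := M₀ + D * J + ρ * t₁ with hM
  have hM0 : 0 ≤ M := by positivity
  set G := 8 * M * L + 4 * L ^ 2 with hG
  have hG0 : 0 ≤ G := by positivity
  set H := L * (1 + G) + L ^ 2 * G with hH
  have hH0 : 0 ≤ H := by positivity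
  set Q₁ := 1 + ∑ i, (Z + |y i|) ^ 2 with hQ₁
  have hQ₁0 : 0 ≤ Q₁ := add_nonneg zero_le_one (Finset.sum_nonneg fun _ _ => sq_nonneg _)
  set Q := Q₁ * Real.exp (2 * H) with hQ
  have hQ0 : 0 ≤ Q := by positivity
  set T := ∑ i, y i ^ 2 with hT
  have hT0 : 0 ≤ T := Finset.sum_nonneg fun _ _ => sq_nonneg _
  refine ⟨M + G * Q + 2 * Q + 2 * T, fun R hR hE hy hh h₁ t ht hJ => ?_⟩
  have key : ∀ s, t₁ ≤ s → s ≤ t → R.energy s ≤ M / √((s + 1 : ℕ) : ℝ) ∧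
      -(M / √((s + 1 : ℕ) : ℝ)) ≤ R.f (s + 1) + ∑ i, y i * R.resNext s i ∧
      ∑ i, R.resNext s i ^ 2 ≤ G * R.dualDist y s / ((s + 1 : ℕ) : ℝ) := by
    intro s hs1 hst
    have h1 : R.energy s ≤ M / √((s + 1 : ℕ) : ℝ) := by
      refine (hen R hR hE s hs1).trans ?_
      have h2 : (R.badCount s : ℝ) ≤ J := by exact_mod_cast (R.badCount_mono hst).trans hJ
      have h3 : D * R.badCount s ≤ D * J := mul_le_mul_of_nonneg_left h2 hD
      have h4 : 0 ≤ ρ * t₁ := by positivity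
      gcongr
      linarith
    have h2 : -(M / √((s + 1 : ℕ) : ℝ)) ≤ R.f (s + 1) + ∑ i, y i * R.u (s + 1) i := by
      refine le_trans (neg_le_neg ?_) (dual_lower_bound hs R hρ hh h₁ (t := s + 1) (by omega))
      have h3 : ρ * t₁ ≤ M := by
        have : 0 ≤ D * J := by positivity
        linarith
      have h4 : √((s + 1 : ℕ) : ℝ) ≤ ((s + 1 : ℕ) : ℝ) := by
        rw [Real.sqrt_le_left (by positivity)]
        have : (1 : ℝ) ≤ ((s + 1 : ℕ) : ℝ) := by exact_mod_cast (by omega : 1 ≤ s + 1)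
        nlinarith
      have h5 : 0 < √((s + 1 : ℕ) : ℝ) := Real.sqrt_pos.2 (by positivity)
      exact (div_le_div_of_nonneg_right h3 (by positivity)).trans
        (div_le_div_of_nonneg_left hM0 h5 h4)
    exact ⟨h1, sum_sq_resNext_le hs hy hM0 h1 h2⟩
  -- Discrete Grönwall: each growth factor is at most an exponential whose exponent telescopes by
  -- `one_div_mul_sqrt_le`, so the total factor is at most `exp (2 * H)`.
  have hdist : ∀ s, t₁ ≤ s → s ≤ t → R.dualDist y s ≤
      Q₁ * Real.exp (2 * H * (1 / √(t₁ : ℝ) - 1 / √(s : ℝ))) := by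
    intro s hs1
    induction s, hs1 using Nat.le_induction with
    | base =>
      intro _
      rw [sub_self, mul_zero, Real.exp_zero, mul_one]
      refine add_le_add_right (Finset.sum_le_sum fun i _ => ?_) _
      rw [sq_le_sq, abs_of_nonneg (a := Z + |y i|)
        (add_nonneg ((abs_nonneg _).trans (hR.z_le i)) (abs_nonneg _))]
      exact (abs_sub _ _).trans (add_le_add_left (hR.z_le i) _)
    | succ s hs1 ih =>
      intro hst
      refine (dualDist_succ_le hs hG0 (key s hs1 (by omega)).2.2).trans ?_
      have h1 := hs.pos
      have h2 := one_div_mul_sqrt_le (t := s) (by omega)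
      have h3 : 1 + H * (1 / (((s + 1 : ℕ) : ℝ) * √((s + 1 : ℕ) : ℝ))) ≤
          Real.exp (2 * H * (1 / √(s : ℝ) - 1 / √((s + 1 : ℕ) : ℝ))) := by
        have h4 := Real.add_one_le_exp (2 * H * (1 / √(s : ℝ) - 1 / √((s + 1 : ℕ) : ℝ)))
        have h5 := mul_le_mul_of_nonneg_left h2 hH0
        linarith
      refine (mul_le_mul (ih (by omega)) h3 (by positivity) (by positivity)).trans (le_of_eq ?_)
      rw [mul_assoc, ← Real.exp_add]
      congr 2
      ring
  have hdt : R.dualDist y t ≤ Q := by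
    refine (hdist t ht le_rfl).trans (mul_le_mul_of_nonneg_left (Real.exp_le_exp.2 ?_) hQ₁0)
    have h1 : 1 / √(t₁ : ℝ) ≤ 1 := by
      rw [div_le_one (Real.sqrt_pos.2 (by exact_mod_cast hs.pos))]
      exact Real.one_le_sqrt.2 (by exact_mod_cast hs.pos)
    have h2 : 0 ≤ 1 / √(t : ℝ) := by positivity
    have h3 : 1 / √(t₁ : ℝ) - 1 / √(t : ℝ) ≤ 1 := by linarith
    nlinarith
  obtain ⟨k1, k2, k3⟩ := key t ht le_rfl
  have k4 : ∑ i, R.resNext t i ^ 2 ≤ G * Q / ((t + 1 : ℕ) : ℝ) := k3.trans (by gcongr)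
  have hn : √((t + 1 : ℕ) : ℝ) ^ 2 = ((t + 1 : ℕ) : ℝ) := Real.sq_sqrt (by positivity)
  have hr : 0 < √((t + 1 : ℕ) : ℝ) := Real.sqrt_pos.2 (by positivity)
  have ha := hs.penalty_pos (t := t + 1) (by omega)
  refine ⟨?_, k4.trans (by gcongr; linarith)⟩
  rw [energy] at k1
  rw [← hn] at k4
  set r := √((t + 1 : ℕ) : ℝ)
  -- The energy bounds `f` from above up to a cross term with `z`, duality bounds it from below up
  -- to one with `y`. Both vectors are bounded, so both cross terms are O(1/√t).
  have young := fun x : K → ℝ => abs_sum_mul_le hr x (R.resNext t) k4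
  have hz : ∑ i, R.z t i ^ 2 ≤ 2 * Q + 2 * T := by
    have h1 : ∑ i, (R.z t i - y i) ^ 2 ≤ Q := by
      have : R.dualDist y t = 1 + ∑ i, (R.z t i - y i) ^ 2 := rfl
      linarith
    have h2 : ∑ i, R.z t i ^ 2 ≤ ∑ i, (2 * (R.z t i - y i) ^ 2 + 2 * y i ^ 2) :=
      Finset.sum_le_sum fun i _ => by nlinarith [sq_nonneg (R.z t i - 2 * y i)]
    rw [Finset.sum_add_distrib, ← Finset.mul_sum, ← Finset.mul_sum] at h2
    linarith
  have y1 := abs_le.1 (young (R.z t))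
  have y2 := abs_le.1 (young y)
  have hpos : 0 ≤ ∑ i, α (t + 1) / 2 * R.resNext t i ^ 2 :=
    Finset.sum_nonneg fun _ _ => by positivity
  rw [Finset.sum_add_distrib] at k1
  have hdiv : ∀ A W : ℝ, A ≤ 2 * W → A / (2 * r) ≤ W / r := fun A W h => by
    rw [div_le_div_iff₀ (by positivity) hr]
    have := mul_le_mul_of_nonneg_right h hr.le
    linarith
  have hGQ : 0 ≤ G * Q := by positivity
  have c1 : (∑ i, R.z t i ^ 2 + G * Q) / (2 * r) ≤ (2 * Q + 2 * T + G * Q) / r :=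
    hdiv _ _ (by linarith)
  have c2 : (∑ i, y i ^ 2 + G * Q) / (2 * r) ≤ (2 * Q + 2 * T + G * Q) / r :=
    hdiv _ _ (by linarith)
  have c3 : (M + G * Q + 2 * Q + 2 * T) / r = M / r + (2 * Q + 2 * T + G * Q) / r := by ring
  rw [c3, abs_le]
  constructor <;> linarith

end ALRun

/-! ## Step sizes and penalties of the Q-FW iteration -/

theorem QFWParams.exists_stepBounds {ν ι κ : Type*} (par : QFWParams ν ι κ) (hδ : 0 < par.δ)
    (hδ' : par.δ ≤ 1) (hα : 0 < par.α₀) :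
    ∃ (L : ℝ) (t₁ : ℕ), StepBounds par.stepSize par.penalty L t₁ := by
  -- The second condition makes the steps at most one; the third yields `γ * √(δ t + 1) ≤ α₀ / 12`,
  -- the smallness used for the last two growth conditions.
  have hlarge : ∃ t₁ : ℕ, 1 ≤ t₁ ∧ 2 / par.δ ≤ t₁ ∧ (24 / (par.δ * par.α₀)) ^ 2 ≤ t₁ := by
    obtain ⟨a, ha⟩ := exists_nat_ge (2 / par.δ)
    obtain ⟨b, hb⟩ := exists_nat_ge ((24 / (par.δ * par.α₀)) ^ 2)
    refine ⟨a + b + 1, by omega, ?_, ?_⟩ <;> push_cast <;>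
      linarith [(Nat.cast_nonneg a : (0 : ℝ) ≤ a), (Nat.cast_nonneg b : (0 : ℝ) ≤ b)]
  obtain ⟨t₁, ht₁, hta, htb⟩ := hlarge
  have hx : ∀ t : ℕ, 0 < √(par.δ * t + 1) := fun t => Real.sqrt_pos.2 (by positivity)
  have hx1 : ∀ t : ℕ, 1 ≤ √(par.δ * t + 1) := fun t =>
    Real.one_le_sqrt.2 (le_add_of_nonneg_left (by positivity))
  have hx2 : ∀ t : ℕ, √(par.δ * t + 1) ^ 2 = par.δ * t + 1 := fun t =>
    Real.sq_sqrt (by positivity)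
  have hmono : ∀ t : ℕ, √(par.δ * t + 1) ≤ √(par.δ * (t + 1 : ℕ) + 1) := fun t =>
    Real.sqrt_le_sqrt (by push_cast; nlinarith)
  have hdiff : ∀ t : ℕ, √(par.δ * (t + 1 : ℕ) + 1) - √(par.δ * t + 1) ≤
      par.δ / (2 * √(par.δ * t + 1)) := fun t => by
    have h1 := hx t
    have h2 := hx2 t
    have h3 : √(par.δ * (t + 1 : ℕ) + 1) ^ 2 = par.δ * t + par.δ + 1 := by
      rw [hx2 (t + 1)]; push_cast; ring
    have h4 := hmono t
    rw [le_div_iff₀ (by positivity)]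
    nlinarith
  have hγx : ∀ t : ℕ, t₁ ≤ t → par.stepSize t * √(par.δ * t + 1) ≤ par.α₀ / 12 := fun t ht => by
    have h1 : √(par.δ * t + 1) ≤ √((t : ℝ) + 1) := Real.sqrt_le_sqrt (by
      have : (0 : ℝ) ≤ t := by positivity
      nlinarith)
    have h2 : 24 / (par.δ * par.α₀) ≤ √((t : ℝ) + 1) := by
      refine Real.le_sqrt_of_sq_le (htb.trans ?_)
      have : (t₁ : ℝ) ≤ t := by exact_mod_cast ht
      linarith
    have h3 : √((t : ℝ) + 1) ^ 2 = t + 1 := Real.sq_sqrt (by positivity)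
    have h4 : 0 < √((t : ℝ) + 1) := Real.sqrt_pos.2 (by positivity)
    rw [QFWParams.stepSize, ← h3]
    have h5 : 2 / (par.δ * √((t : ℝ) + 1) ^ 2) * √(par.δ * t + 1) ≤
        2 / (par.δ * √((t : ℝ) + 1) ^ 2) * √((t : ℝ) + 1) :=
      mul_le_mul_of_nonneg_left h1 (by positivity)
    refine h5.trans ?_
    rw [div_le_iff₀ (by positivity)] at h2
    rw [div_mul_eq_mul_div, div_le_div_iff₀ (by positivity) (by positivity)]
    nlinarith
  have hγ0 : ∀ t : ℕ, 0 < par.stepSize t := fun t => by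
    rw [QFWParams.stepSize]; positivity
  refine ⟨2 / par.δ + 2 * par.α₀ + 1 / (par.α₀ * par.δ) + 1, t₁,
    ⟨?_, ht₁, ?_, ?_, ?_, ?_, ?_, ?_, ?_, ?_, ?_⟩⟩
  · have : 0 ≤ 2 / par.δ + 2 * par.α₀ + 1 / (par.α₀ * par.δ) := by positivity
    linarith
  · intro t _
    rw [QFWParams.stepSize]
    refine div_le_div_of_nonneg_left (by norm_num) (by positivity) ?_
    exact mul_le_of_le_one_left (by positivity) hδ'
  · intro t ht
    have ht' : (0 : ℝ) < t := by exact_mod_cast ht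
    have h1 : par.stepSize t ≤ 2 / par.δ / t := by
      rw [QFWParams.stepSize, div_div]
      refine div_le_div_of_nonneg_left (by norm_num) (by positivity) ?_
      nlinarith
    refine h1.trans (div_le_div_of_nonneg_right ?_ ht'.le)
    have : 0 ≤ 2 * par.α₀ + 1 / (par.α₀ * par.δ) + 1 := by positivity
    linarith
  · intro t ht
    have ht' : (1 : ℝ) ≤ t := by exact_mod_cast ht
    have h1 : √(par.δ * t + 1) ≤ 2 * √(t : ℝ) := by
      rw [Real.sqrt_le_iff]
      refine ⟨by positivity, ?_⟩
      rw [mul_pow, Real.sq_sqrt (by positivity)]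
      nlinarith
    rw [QFWParams.penalty]
    have h2 : 0 ≤ (2 / par.δ + 1 / (par.α₀ * par.δ) + 1) * √(t : ℝ) := by positivity
    nlinarith
  · intro t ht
    have h1 : √(t : ℝ) ≤ 1 / par.δ * √(par.δ * t + 1) := by
      rw [Real.sqrt_le_iff]
      refine ⟨by positivity, ?_⟩
      rw [mul_pow, hx2, div_pow, one_pow, div_mul_eq_mul_div, one_mul, le_div_iff₀ (by positivity)]
      have : (0 : ℝ) ≤ t := by positivity
      nlinarith [mul_nonneg this hδ.le]
    rw [QFWParams.penalty]
    have h2 : 1 / (par.α₀ * par.δ) * (par.α₀ * √(par.δ * t + 1)) =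
        1 / par.δ * √(par.δ * t + 1) := by
      field_simp
    have h3 : 0 ≤ (2 / par.δ + 2 * par.α₀ + 1) * (par.α₀ * √(par.δ * t + 1)) := by positivity
    nlinarith
  · intro t
    exact mul_le_mul_of_nonneg_left (hmono t) hα.le
  · intro t ht
    have ht' : (0 : ℝ) < √(t : ℝ) := Real.sqrt_pos.2 (by exact_mod_cast ht)
    have h1 : par.δ * √(t : ℝ) ≤ √(par.δ * t + 1) := by
      refine Real.le_sqrt_of_sq_le ?_
      rw [mul_pow, Real.sq_sqrt (by positivity)]
      have : (0 : ℝ) ≤ t := by positivity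
      nlinarith [mul_nonneg this hδ.le]
    have h2 : par.δ / (2 * √(par.δ * t + 1)) ≤ 1 / √(t : ℝ) := by
      rw [div_le_div_iff₀ (mul_pos two_pos (hx t)) ht']
      linarith [hx t]
    have h3 : par.penalty (t + 1) - par.penalty t ≤ par.α₀ * (1 / √(t : ℝ)) := by
      rw [QFWParams.penalty, QFWParams.penalty, ← mul_sub]
      exact mul_le_mul_of_nonneg_left ((hdiff t).trans h2) hα.le
    refine h3.trans ?_
    rw [mul_one_div]
    refine div_le_div_of_nonneg_right ?_ ht'.le
    have : 0 ≤ 2 / par.δ + par.α₀ + 1 / (par.α₀ * par.δ) + 1 := by positivity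
    linarith
  · intro t ht
    rw [QFWParams.stepSize, div_le_one (by positivity)]
    rw [div_le_iff₀ hδ] at hta
    have : (t₁ : ℝ) ≤ t := by exact_mod_cast ht
    nlinarith
  · intro t ht
    have h1 := hγx t ht
    have h2 := hx1 t
    have h3 := hγ0 t
    have h4 : par.stepSize t ≤ par.stepSize t * √(par.δ * t + 1) := le_mul_of_one_le_right h3.le h2
    have h5 : par.α₀ ≤ par.α₀ * √(par.δ * t + 1) := le_mul_of_one_le_right hα.le h2
    rw [QFWParams.penalty]
    linarith
  · intro t ht
    have h1 := hγx t ht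
    have h2 := hx t
    have h3 := hx (t + 1)
    have h4 := hx2 t
    have h5 := hx2 (t + 1)
    have h6 := hdiff t
    have h7 := hx1 t
    -- The left side of the domination condition is at most `4 (1/12 + 1/4) = 4/3` times `α₀ / √(δ t
    -- + 1)`, the right side at least `2 α₀ / √(δ (t + 1) + 1)`, and the ratio of the two roots is
    -- at most `3/2`.
    have e1 : par.penalty (t + 1) - par.penalty t ≤ par.α₀ * (1 / (2 * √(par.δ * t + 1))) := by
      rw [QFWParams.penalty, QFWParams.penalty, ← mul_sub]
      refine mul_le_mul_of_nonneg_left (h6.trans ?_) hα.le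
      exact div_le_div_of_nonneg_right hδ' (by positivity)
    have e2 : par.stepSize t ≤ par.α₀ / 12 * (1 / √(par.δ * t + 1)) := by
      rw [mul_one_div, le_div_iff₀ h2]; exact h1
    have e3 : par.α₀ * (2 / √(par.δ * (t + 1 : ℕ) + 1)) ≤
        par.stepSize (t + 1) * par.penalty (t + 1) := by
      rw [QFWParams.penalty, QFWParams.stepSize]
      have : par.α₀ * (2 / √(par.δ * (t + 1 : ℕ) + 1)) =
          2 / √(par.δ * (t + 1 : ℕ) + 1) ^ 2 * (par.α₀ * √(par.δ * (t + 1 : ℕ) + 1)) := by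
        field_simp
      rw [this]
      refine mul_le_mul_of_nonneg_right ?_ (by positivity)
      refine div_le_div_of_nonneg_left (by norm_num) (by positivity) ?_
      rw [h5]
      linarith
    have e4 : 4 / 3 * (1 / √(par.δ * t + 1)) ≤ 2 / √(par.δ * (t + 1 : ℕ) + 1) := by
      have h8 : √(par.δ * (t + 1 : ℕ) + 1) ≤ 3 / 2 * √(par.δ * t + 1) := by
        refine le_of_sq_le_sq ?_ (by positivity)
        rw [mul_pow, h4, h5]
        push_cast
        have : 0 ≤ par.δ * (t : ℝ) := by positivity
        nlinarith
      rw [mul_one_div, div_le_div_iff₀ h2 h3]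
      linarith
    have e5 := mul_le_mul_of_nonneg_left e4 hα.le
    have e6 : par.α₀ * (1 / (2 * √(par.δ * t + 1))) = par.α₀ * (1 / √(par.δ * t + 1)) / 2 := by
      field_simp
    rw [e6] at e1
    linarith

/-! ## Trajectories -/

/-- A solution of the QUBO problem is a minimizer over the hull. -/
theorem quboEnergy_le_of_mem_binaryHull {ν : Type*} [Fintype ν] {G : Matrix ν ν ℝ}
    {w : ν → Bool} (hw : IsQuboMin G w)
    {V : Matrix ν ν ℝ} (hV : V ∈ binaryHull ν) : quboEnergy G w ≤ (G * V).trace := by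
  classical
  obtain ⟨c, hc, hc1, rfl⟩ := exists_weights_of_mem_binaryHull hV
  have h1 : (G * ∑ w, c w • rankOne w).trace = ∑ w, c w * quboEnergy G w := by
    simp [Matrix.mul_sum, Matrix.trace_sum, trace_mul_rankOne]
  rw [h1, ← one_mul (quboEnergy G w), ← hc1, Finset.sum_mul]
  exact Finset.sum_le_sum fun v _ => mul_le_mul_of_nonneg_left (hw v) (hc v)

/-- A quantity that depends on finitely many directions is bounded. -/
theorem exists_bound_of_finite_dependence {ν : Type*} [Finite ν] (n : ℕ) (Φ : (ℕ → ν → Bool) → ℝ)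
    (h : ∀ w w' : ℕ → ν → Bool, (∀ s ≤ n, w s = w' s) → Φ w = Φ w') : ∃ B, ∀ w, Φ w ≤ B := by
  let ext : (Fin (n + 1) → ν → Bool) → ℕ → ν → Bool := fun r s =>
    if hs : s < n + 1 then r ⟨s, hs⟩ else fun _ => false
  obtain ⟨B, hB⟩ := (Set.finite_range fun r => Φ (ext r)).bddAbove
  refine ⟨B, fun w => ?_⟩
  rw [h w (ext fun s => w s) fun s hs => by
    simp only [ext]; rw [dif_pos (Nat.lt_succ_of_le hs)]]
  exact hB ⟨fun s => w s, rfl⟩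

theorem exists_finite_sup {S : Type*} [Finite S] {β : Type*} (Φ : S → β → ℝ)
    (h : ∀ i, ∃ B, ∀ x, Φ i x ≤ B) : ∃ B, 0 ≤ B ∧ ∀ i x, Φ i x ≤ B := by
  choose B hB using h
  obtain ⟨C, hC⟩ := (Set.finite_range B).bddAbove
  exact ⟨max C 0, le_max_right _ _, fun i x =>
    (hB i x).trans ((hC ⟨i, rfl⟩).trans (le_max_left _ _))⟩

namespace CopositiveProgram
variable {ν ι κ : Type*} [Fintype ν]

/-- The states reached when iteration `t` uses the direction `w t`. -/
noncomputable def trajectory (M : CopositiveProgram ν ι κ) (par : QFWParams ν ι κ)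
    (w : ℕ → ν → Bool) : ℕ → QFWState ν ι κ
  | 0 => par.init
  | t + 1 => M.qfwStep par (t + 1) (trajectory M par w t) (w (t + 1))

theorem qfwState_eq_trajectory [Fintype ι] [Fintype κ]
    (M : CopositiveProgram ν ι κ) (par : QFWParams ν ι κ) (l : ℕ → ℕ)
    (x : ℕ → ℕ → ν → Bool) (t : ℕ) :
    M.qfwState par l x t = M.trajectory par (M.qfwChoice par l x) t := by
  induction t with
  | zero => rfl
  | succ t ih => rw [trajectory, ← ih]; rfl

variable (M : CopositiveProgram ν ι κ) (par : QFWParams ν ι κ)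

theorem trajectory_congr {w w' : ℕ → ν → Bool} {t : ℕ} (h : ∀ s ≤ t, w s = w' s) :
    M.trajectory par w t = M.trajectory par w' t := by
  induction t with
  | zero => rfl
  | succ t ih => rw [trajectory, trajectory, ih fun s hs => h s (by omega), h (t + 1) le_rfl]

/-- The constraint values of both kinds. -/
def residual (V : Matrix ν ν ℝ) : ι ⊕ κ → ℝ := Sum.elim (M.eqRes V) (M.ineqRes V)

theorem residual_combo (a : ℝ) (V W : Matrix ν ν ℝ) (i : ι ⊕ κ) :
    M.residual ((1 - a) • V + a • W) i = (1 - a) * M.residual V i + a * M.residual W i := by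
  rcases i with i | i
  exacts [M.eqRes_combo a V W i, M.ineqRes_combo a V W i]

theorem objectiveGap_combo (a : ℝ) (V W : Matrix ν ν ℝ) :
    M.objectiveGap ((1 - a) • V + a • W) = (1 - a) * M.objectiveGap V + a * M.objectiveGap W := by
  simp only [objectiveGap, M.objective_combo]
  ring

/-- The scalar run of a trajectory. -/
noncomputable def toALRun (w : ℕ → ν → Bool) : ALRun (ι ⊕ κ) par.stepSize par.penalty where
  ty := Sum.elim (fun _ => false) (fun _ => true)
  f t := M.objectiveGap (M.trajectory par w t).V
  fh t := M.objectiveGap (rankOne (w t))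
  u t := M.residual (M.trajectory par w t).V
  uh t := M.residual (rankOne (w t))
  z t := Sum.elim (M.trajectory par w t).z (M.trajectory par w t).z'
  f_succ t := M.objectiveGap_combo _ _ _
  u_succ t i := M.residual_combo _ _ _ i
  z_succ t i := by
    rcases i with i | i <;> rfl

variable [Fintype ι] [Fintype κ]

theorem infeasibility_sq (V : Matrix ν ν ℝ) : M.infeasibility V ^ 2 =
    ∑ i, M.eqRes V i ^ 2 + ∑ k, max (M.ineqRes V k) 0 ^ 2 :=
  Real.sq_sqrt (add_nonneg (Finset.sum_nonneg fun _ _ => sq_nonneg _)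
    (Finset.sum_nonneg fun _ _ => sq_nonneg _))

theorem infeasibility_nonneg (V : Matrix ν ν ℝ) : 0 ≤ M.infeasibility V := Real.sqrt_nonneg _

theorem infeasibility_sq_le_resNext (w : ℕ → ν → Bool) (t : ℕ) :
    M.infeasibility (M.trajectory par w (t + 1)).V ^ 2 ≤
      ∑ i, (M.toALRun par w).resNext t i ^ 2 := by
  rw [infeasibility_sq, Fintype.sum_sum_type]
  refine add_le_add (le_of_eq rfl) (Finset.sum_le_sum fun k _ => ?_)
  have h : M.ineqRes (M.trajectory par w (t + 1)).V k ≤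
    (M.toALRun par w).resNext t (Sum.inr k) := le_alResidual
  rw [sq_le_sq, abs_of_nonneg (le_max_right _ _)]
  exact max_le (h.trans (le_abs_self _)) (abs_nonneg _)

theorem trace_gradMatrix_mul (t : ℕ) (s : QFWState ν ι κ) (V : Matrix ν ν ℝ) :
    (M.gradMatrix par t s * V).trace = M.objective V
      + ∑ i, (s.z i + par.penalty t * M.eqRes s.V i) * (M.eqRes V i + M.a i)
      + ∑ k, (s.z' k + par.penalty t * M.ineqErr (par.penalty t) s.V s.z' k) *
        (M.ineqRes V k + M.b k) := by
  simp [gradMatrix, Matrix.add_mul, Matrix.sum_mul, Matrix.trace_sum, objective, eqRes, ineqRes]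

variable {M par}

/-- Comparison of the QUBO minimizer with an optimal matrix: there the equality residuals vanish,
and the nonnegative gradient coefficients of the inequalities meet nonpositive residuals. -/
theorem toALRun_err_nonpos (hM : M.feasibleSet.Nonempty) {w : ℕ → ν → Bool} {t : ℕ}
    (ha : 0 < par.penalty (t + 1))
    (hw : IsQuboMin (M.gradMatrix par (t + 1) (M.trajectory par w t)) (w (t + 1))) :
    (M.toALRun par w).err t ≤ 0 := by
  obtain ⟨V, hV⟩ := optimalSet_nonempty hM
  have h1 := quboEnergy_le_of_mem_binaryHull hw hV.1.1
  rw [← trace_mul_rankOne, trace_gradMatrix_mul, trace_gradMatrix_mul,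
    objective_eq_optimalValue hV] at h1
  simp only [mul_add, Finset.sum_add_distrib] at h1
  have h2 : ∀ i, M.eqRes V i = 0 := hV.1.2.1
  have h3 : ∀ k, ((M.trajectory par w t).z' k + par.penalty (t + 1) *
      M.ineqErr (par.penalty (t + 1)) (M.trajectory par w t).V (M.trajectory par w t).z' k) *
        M.ineqRes V k ≤ 0 := fun k =>
    mul_nonpos_of_nonneg_of_nonpos (alResidual_dual_nonneg ha) (hV.1.2.2 k)
  have h4 := Finset.sum_nonpos fun k (_ : k ∈ Finset.univ) => h3 k
  simp only [h2, mul_zero, Finset.sum_const_zero] at h1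
  rw [ALRun.err, Fintype.sum_sum_type]
  change M.objective (rankOne (w (t + 1))) - M.optimalValue +
    (∑ i, ((M.trajectory par w t).z i + par.penalty (t + 1) * M.eqRes (M.trajectory par w t).V i) *
      M.eqRes (rankOne (w (t + 1))) i +
    ∑ k, ((M.trajectory par w t).z' k + par.penalty (t + 1) *
      M.ineqErr (par.penalty (t + 1)) (M.trajectory par w t).V (M.trajectory par w t).z' k) *
        M.ineqRes (rankOne (w (t + 1))) k) ≤ 0
  linarith

open Classical in
/-- The number of iterations `1, …, t` whose direction is not a QUBO solution. -/
noncomputable def failCount (M : CopositiveProgram ν ι κ) (par : QFWParams ν ι κ)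
    (w : ℕ → ν → Bool) (t : ℕ) : ℕ :=
  ((Finset.Icc 1 t).filter fun s =>
    ¬ IsQuboMin (M.gradMatrix par s (M.trajectory par w (s - 1))) (w s)).card

theorem badCount_le_failCount (hM : M.feasibleSet.Nonempty)
    (ha : ∀ t, 0 < par.penalty (t + 1)) (w : ℕ → ν → Bool) (t : ℕ) :
    (M.toALRun par w).badCount t ≤ M.failCount par w (t + 1) := by
  classical
  -- `err s` belongs to iteration `s + 1`.
  refine Finset.card_le_card_of_injOn (· + 1) (fun s hs => ?_) fun _ _ _ _ h => by simpa using h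
  simp only [Finset.coe_filter, Finset.mem_range, Set.mem_ofPred_eq, Finset.mem_Icc] at hs ⊢
  refine ⟨⟨by omega, by omega⟩, fun hmin => ?_⟩
  exact absurd hs.2 (not_lt.2 (toALRun_err_nonpos hM (ha s) hmin))

end CopositiveProgram

theorem ALRun.Bounded.abs_f_le {K : Type*} {γ α : ℕ → ℝ} {L : ℝ} {t₁ : ℕ} {R : ALRun K γ α}
    {B Z : ℝ} (hs : StepBounds γ α L t₁) (hR : R.Bounded t₁ B Z) (hf : |R.f t₁| ≤ B) {t : ℕ}
    (ht : t₁ ≤ t) : |R.f t| ≤ B := by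
  induction t, ht using Nat.le_induction with
  | base => exact hf
  | succ t ht ih =>
    have h1 := hs.step_le_one (t + 1) (by omega)
    have h2 := (hs.step_pos (t := t + 1) (by omega)).le
    rw [R.f_succ t]
    refine (abs_add_le _ _).trans ?_
    rw [abs_mul, abs_mul, abs_of_nonneg h2, abs_of_nonneg (sub_nonneg.2 h1)]
    nlinarith [hR.fh_le (t + 1)]

/-! ### Bounds and rates uniform over all trajectories -/

namespace CopositiveProgram
variable {ν ι κ : Type*} [Fintype ν] {M : CopositiveProgram ν ι κ} {par : QFWParams ν ι κ}

section
variable [Finite ι] [Finite κ]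

/-- The state after `t₁` iterations depends on finitely many bit strings, hence takes finitely many
values. -/
theorem exists_toALRun_bounded (M : CopositiveProgram ν ι κ) (par : QFWParams ν ι κ) (t₁ : ℕ) :
    ∃ B Z : ℝ, 0 ≤ B ∧ 0 ≤ Z ∧ ∀ w, (M.toALRun par w).Bounded t₁ B Z ∧
      |(M.toALRun par w).f t₁| ≤ B := by
  obtain ⟨B₁, hB₁, h₁⟩ := exists_finite_sup (fun i w => |(M.toALRun par w).u t₁ i|) fun i =>
    exists_bound_of_finite_dependence t₁ _ fun w w' h => by
      simp only [toALRun, M.trajectory_congr par h]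
  obtain ⟨B₂, hB₂, h₂⟩ := exists_finite_sup
    (fun (i : ι ⊕ κ) (v : ν → Bool) => |M.residual (rankOne v) i|) fun i => by
      obtain ⟨B, hB⟩ := (Set.finite_range fun v : ν → Bool => |M.residual (rankOne v) i|).bddAbove
      exact ⟨B, fun v => hB ⟨v, rfl⟩⟩
  obtain ⟨B₃, hB₃⟩ := (Set.finite_range fun v : ν → Bool => |M.objectiveGap (rankOne v)|).bddAbove
  obtain ⟨B₄, h₄⟩ := exists_bound_of_finite_dependence t₁
    (fun w => |(M.toALRun par w).f t₁|) fun w w' h => by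
      simp only [toALRun, M.trajectory_congr par h]
  obtain ⟨Z, hZ, h₅⟩ := exists_finite_sup (fun i w => |(M.toALRun par w).z t₁ i|) fun i =>
    exists_bound_of_finite_dependence t₁ _ fun w w' h => by
      simp only [toALRun, M.trajectory_congr par h]
  refine ⟨B₁ + B₂ + max B₃ 0 + max B₄ 0, Z, by positivity, hZ, fun w => ⟨⟨fun i => ?_, fun t i => ?_,
    fun t => ?_, fun i => h₅ i w⟩, ?_⟩⟩
  · have := h₁ i w
    linarith [le_max_right B₃ 0, le_max_right B₄ 0]
  · have : |(M.toALRun par w).uh t i| ≤ B₂ := h₂ i (w t)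
    linarith [le_max_right B₃ 0, le_max_right B₄ 0]
  · have : |(M.toALRun par w).fh t| ≤ B₃ := hB₃ ⟨w t, rfl⟩
    linarith [le_max_left B₃ 0, le_max_right B₄ 0]
  · have := h₄ w
    linarith [le_max_right B₃ 0, le_max_left B₄ 0]

end

/-- Iterates approach the hull. -/
theorem exists_hull_rate {L : ℝ} {t₁ : ℕ} (hs : StepBounds par.stepSize par.penalty L t₁) :
    ∃ C, 0 ≤ C ∧ ∀ (w : ℕ → ν → Bool) (t : ℕ), t₁ ≤ t →
      ∃ H ∈ binaryHull ν, ∀ i j, |(M.trajectory par w t).V i j - H i j| ≤ C / t := by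
  obtain ⟨B, hB, h₁⟩ := exists_finite_sup (fun (p : ν × ν) (w : ℕ → ν → Bool) =>
    |(M.trajectory par w t₁).V p.1 p.2|) fun p =>
    exists_bound_of_finite_dependence t₁ _ fun w w' h => by
      simp only [M.trajectory_congr par h]
  refine ⟨(B + 1) * t₁, by positivity, fun w t ht => ?_⟩
  have hp := hs.pos
  induction t, ht using Nat.le_induction with
  | base =>
    -- Any hull point serves here: the factor `t₁` in the constant cancels the denominator.
    refine ⟨rankOne (w 0), rankOne_mem_binaryHull _, fun i j => ?_⟩
    have : (t₁ : ℝ) ≠ 0 := by positivity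
    rw [mul_div_assoc, div_self this, mul_one]
    exact (abs_sub _ _).trans (add_le_add (h₁ (i, j) w) (abs_rankOne_le _ _ _))
  | succ t ht ih =>
    obtain ⟨H, hH, hd⟩ := ih
    have h1 := hs.step_le_one (t + 1) (by omega)
    have h2 := (hs.step_pos (t := t + 1) (by omega)).le
    have ht0 : (0 : ℝ) < t := by exact_mod_cast (by omega : 0 < t)
    refine ⟨(1 - par.stepSize (t + 1)) • H + par.stepSize (t + 1) • rankOne (w (t + 1)),
      convex_binaryHull hH (rankOne_mem_binaryHull _) (sub_nonneg.2 h1) h2 (by ring),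
      fun i j => ?_⟩
    have h3 : (M.trajectory par w (t + 1)).V i j -
        ((1 - par.stepSize (t + 1)) • H + par.stepSize (t + 1) • rankOne (w (t + 1))) i j =
        (1 - par.stepSize (t + 1)) * ((M.trajectory par w t).V i j - H i j) := by
      simp only [trajectory, qfwStep, Matrix.add_apply, Matrix.smul_apply, smul_eq_mul]
      ring
    rw [h3, abs_mul, abs_of_nonneg (sub_nonneg.2 h1)]
    have h4 : 1 - par.stepSize (t + 1) ≤ t / ((t + 1 : ℕ) : ℝ) := by
      have h5 := hs.step_ge (t + 1) (by omega)
      have h6 : (t : ℝ) / ((t + 1 : ℕ) : ℝ) = 1 - 1 / ((t + 1 : ℕ) : ℝ) := by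
        push_cast; field_simp; ring
      have h7 : 1 / ((t + 1 : ℕ) : ℝ) ≤ 2 / (((t + 1 : ℕ) : ℝ) + 1) := by
        rw [div_le_div_iff₀ (by positivity) (by positivity)]; push_cast; linarith
      linarith
    refine (mul_le_mul h4 (hd i j) (abs_nonneg _) (by positivity)).trans (le_of_eq ?_)
    field_simp

variable [Fintype ι] [Fintype κ]

/-- Needed where no rate is available: in early iterations and on the failure event. Before `t₁`
there are finitely many values, afterwards convex combinations. -/
theorem exists_uniform_bound (M : CopositiveProgram ν ι κ) {par : QFWParams ν ι κ}
    (hδ : 0 < par.δ) (hδ' : par.δ ≤ 1) (hα : 0 < par.α₀) :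
    ∃ B, 0 ≤ B ∧ ∀ (w : ℕ → ν → Bool) (t : ℕ), |M.objectiveGap (M.trajectory par w t).V| ≤ B ∧
      M.infeasibility (M.trajectory par w t).V ≤ B := by
  obtain ⟨L, t₁, hs⟩ := par.exists_stepBounds hδ hδ' hα
  obtain ⟨B, Z, hB, -, hR⟩ := exists_toALRun_bounded M par t₁
  obtain ⟨B₁, hB₁, h₁⟩ := exists_finite_sup (fun (t : Fin t₁) (w : ℕ → ν → Bool) =>
    |M.objectiveGap (M.trajectory par w t).V|) fun t =>
    exists_bound_of_finite_dependence t _ fun w w' h => by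
      simp only [M.trajectory_congr par h]
  obtain ⟨B₂, hB₂, h₂⟩ := exists_finite_sup (fun (t : Fin t₁) (w : ℕ → ν → Bool) =>
    M.infeasibility (M.trajectory par w t).V) fun t =>
    exists_bound_of_finite_dependence t _ fun w w' h => by
      simp only [M.trajectory_congr par h]
  set S := (Fintype.card (ι ⊕ κ) : ℝ)
  refine ⟨B + B₁ + B₂ + S * B ^ 2 + 1, by positivity, fun w t => ?_⟩
  have hS : 0 ≤ S * B ^ 2 := by positivity
  rcases lt_or_ge t t₁ with ht | ht
  · have e1 := h₁ ⟨t, ht⟩ w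
    have e2 := h₂ ⟨t, ht⟩ w
    dsimp only at e1 e2
    constructor <;> linarith
  · obtain ⟨hRw, hf⟩ := hR w
    have e1 : |M.objectiveGap (M.trajectory par w t).V| ≤ B := hRw.abs_f_le hs hf ht
    refine ⟨by linarith, ?_⟩
    have e2 : ∀ i, |M.residual (M.trajectory par w t).V i| ≤ B := hRw.abs_u_le hs ht
    have e3 : M.infeasibility (M.trajectory par w t).V ^ 2 ≤ S * B ^ 2 := by
      rw [infeasibility_sq, ← nsmul_eq_mul, ← Finset.card_univ, ← Finset.sum_const,
        Fintype.sum_sum_type]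
      refine add_le_add (Finset.sum_le_sum fun i _ => ?_) (Finset.sum_le_sum fun k _ => ?_)
      · rw [sq_le_sq, abs_of_nonneg hB]
        exact e2 (Sum.inl i)
      · rw [sq_le_sq, abs_of_nonneg hB, abs_of_nonneg (le_max_right _ _)]
        exact max_le ((le_abs_self _).trans (e2 (Sum.inr k))) hB
    nlinarith [sq_nonneg (M.infeasibility (M.trajectory par w t).V - 1)]

/-- Trajectories with at most `J` failed iterations converge at rate `1 / √t`. -/
theorem exists_trajectory_rate (hM : M.feasibleSet.Nonempty) (hδ : 0 < par.δ) (hδ' : par.δ ≤ 1)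
    (hα : 0 < par.α₀) (J : ℕ) :
    ∃ C, 0 ≤ C ∧ ∀ (w : ℕ → ν → Bool) (t : ℕ), 1 ≤ t → M.failCount par w t ≤ J →
      |M.objectiveGap (M.trajectory par w t).V| ≤ C / √(t : ℝ) ∧
      M.infeasibility (M.trajectory par w t).V ≤ C / √(t : ℝ) := by
  obtain ⟨L, t₁, hs⟩ := par.exists_stepBounds hδ hδ' hα
  obtain ⟨B, Z, hB, -, hR⟩ := exists_toALRun_bounded M par t₁
  obtain ⟨B', hB', hunif⟩ := exists_uniform_bound M hδ hδ' hα
  obtain ⟨y, y', hy', hyw⟩ := M.exists_multipliers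
  obtain ⟨E, hE⟩ := exists_bound_of_finite_dependence (t₁ + 1)
    (fun w => (M.toALRun par w).energy t₁) fun w w' h => by
      have h1 := M.trajectory_congr par h
      have h2 := M.trajectory_congr par (t := t₁) fun s hs => h s (by omega)
      simp only [ALRun.energy, ALRun.resNext, toALRun, h1, h2]
  obtain ⟨ρ, hρ⟩ := exists_bound_of_finite_dependence t₁
    (fun w => -((M.toALRun par w).f t₁ + ∑ i, Sum.elim y y' i * (M.toALRun par w).u t₁ i))
    fun w w' h => by
      simp only [toALRun, M.trajectory_congr par h]
  obtain ⟨C, hC⟩ := ALRun.exists_rate hs B Z E (max ρ 0) hB (le_max_right _ _) (Sum.elim y y') J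
  -- `B' * √t₁` covers the times up to `t₁`. The `1` makes the square of the constant dominate `C`,
  -- as the residual estimate is one for squares.
  refine ⟨max C 0 + 1 + B' * √(t₁ : ℝ), by positivity, fun w t ht hJ => ?_⟩
  have ht0 : 0 < √(t : ℝ) := Real.sqrt_pos.2 (by exact_mod_cast ht)
  have hB0 : 0 ≤ B' * √(t₁ : ℝ) := by positivity
  rcases Nat.lt_or_ge t₁ t with htt | htt
  · obtain ⟨s, rfl⟩ := Nat.exists_eq_add_of_le' ht
    have ha : ∀ t, 0 < par.penalty (t + 1) := fun t => hs.penalty_pos (by omega)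
    obtain ⟨r1, r2⟩ := hC (M.toALRun par w) (hR w).1 (hE w) (fun i hi => by
        rcases i with i | k
        · exact absurd hi (by simp [toALRun])
        · exact hy' k)
      (fun s => by
        have h1 := hyw (w s)
        rw [Fintype.sum_sum_type, ← add_assoc]
        exact h1)
      (by have := hρ w; linarith [le_max_left ρ 0]) s (by omega)
      ((badCount_le_failCount hM ha w s).trans hJ)
    have h1 : C / √((s + 1 : ℕ) : ℝ) ≤ (max C 0 + 1 + B' * √(t₁ : ℝ)) / √((s + 1 : ℕ) : ℝ) := by
      gcongr
      linarith [le_max_left C 0]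
    refine ⟨r1.trans h1, ?_⟩
    have h2 := (M.infeasibility_sq_le_resNext par w s).trans r2
    refine le_of_sq_le_sq ?_ (by positivity)
    refine h2.trans ?_
    rw [div_pow, Real.sq_sqrt (by positivity)]
    gcongr
    have h3 := le_max_left C 0
    have h4 := le_max_right C 0
    nlinarith
  · have h1 : √(t : ℝ) ≤ √(t₁ : ℝ) := Real.sqrt_le_sqrt (by exact_mod_cast htt)
    have h2 : B' ≤ (max C 0 + 1 + B' * √(t₁ : ℝ)) / √(t : ℝ) := by
      rw [le_div_iff₀ ht0]
      have := mul_le_mul_of_nonneg_left h1 hB'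
      linarith [le_max_right C 0]
    exact ⟨(hunif w t).1.trans h2, (hunif w t).2.trans h2⟩

/-- For every `J` and `ε` there is a time after which all trajectories with at most `J` failed
iterations are `ε`-close to the optimal set. -/
theorem exists_time_near_optimal (hM : M.feasibleSet.Nonempty) (hδ : 0 < par.δ)
    (hδ' : par.δ ≤ 1) (hα : 0 < par.α₀) (J : ℕ) {ε : ℝ} (hε : 0 < ε) :
    ∃ t₀ : ℕ, ∀ (w : ℕ → ν → Bool) (t : ℕ), t₀ ≤ t → M.failCount par w t ≤ J →
      ∃ W ∈ M.optimalSet, ∀ i j, |(M.trajectory par w t).V i j - W i j| < ε := by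
  obtain ⟨L, t₁, hs⟩ := par.exists_stepBounds hδ hδ' hα
  obtain ⟨η, hη, hnear⟩ := M.exists_optimal_near hε
  obtain ⟨C, hC0, hC⟩ := exists_trajectory_rate (M := M) hM hδ hδ' hα J
  obtain ⟨D, hD0, hD⟩ := exists_hull_rate (M := M) hs
  have h1 : Tendsto (fun t : ℕ => C / √(t : ℝ)) atTop (𝓝 0) :=
    tendsto_const_nhds.div_atTop (Real.tendsto_sqrt_atTop.comp tendsto_natCast_atTop_atTop)
  have h2 : Tendsto (fun t : ℕ => D / (t : ℝ)) atTop (𝓝 0) :=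
    tendsto_const_nhds.div_atTop tendsto_natCast_atTop_atTop
  obtain ⟨t₀, ht₀⟩ := eventually_atTop.1 ((h1.eventually_le_const hη).and (h2.eventually_le_const hη))
  refine ⟨t₀ + t₁ + 1, fun w t ht hJ => ?_⟩
  obtain ⟨e1, e2⟩ := ht₀ t (by omega)
  obtain ⟨r1, r2⟩ := hC w t (by omega) hJ
  obtain ⟨H, hH, hd⟩ := hD w t (by omega)
  exact hnear _ (r1.trans e1) (r2.trans e1) ⟨H, hH, fun i j => (hd i j).trans e2⟩

end CopositiveProgram

/-! ## Dependence of a run on the oracle answers -/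

section Dependence
variable {ν ι κ : Type*} [Fintype ν]

theorem bestSample_congr (G : Matrix ν ν ℝ) {x x' : ℕ → ν → Bool} {l : ℕ}
    (h : ∀ k ≤ l, x k = x' k) : bestSample G x l = bestSample G x' l := by
  induction l with
  | zero => exact h 0 le_rfl
  | succ l ih => rw [bestSample, bestSample, ih fun k hk => h k (by omega), h (l + 1) le_rfl]

theorem quboEnergy_bestSample_le (G : Matrix ν ν ℝ) (x : ℕ → ν → Bool) {k l : ℕ} (hk : k ≤ l) :
    quboEnergy G (bestSample G x l) ≤ quboEnergy G (x k) := by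
  induction l with
  | zero => rw [Nat.le_zero.1 hk]; rfl
  | succ l ih =>
    rw [bestSample]
    rcases Nat.lt_or_ge k (l + 1) with h | h
    · have h1 := ih (by omega)
      split_ifs with h2
      exacts [h2.le.trans h1, h1]
    · obtain rfl : k = l + 1 := by omega
      split_ifs with h2
      exacts [le_rfl, not_lt.1 h2]

theorem isQuboMin_bestSample {G : Matrix ν ν ℝ} {x : ℕ → ν → Bool} {k l : ℕ} (hk : k ≤ l)
    (h : IsQuboMin G (x k)) : IsQuboMin G (bestSample G x l) :=
  fun w' => (quboEnergy_bestSample_le G x hk).trans (h w')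

variable [Fintype ι] [Fintype κ] (M : CopositiveProgram ν ι κ) (par : QFWParams ν ι κ)

/-- Two answer tables agree in the iterations `1, …, t`. -/
def AgreeUpTo {S : Type*} (l : ℕ → ℕ) (t : ℕ) (x x' : ℕ → ℕ → S) : Prop :=
  ∀ s ∈ Finset.Icc 1 t, ∀ k ≤ l s, x s k = x' s k

theorem AgreeUpTo.mono {S : Type*} {l : ℕ → ℕ} {s t : ℕ} {x x' : ℕ → ℕ → S}
    (h : AgreeUpTo l t x x') (hst : s ≤ t) : AgreeUpTo l s x x' := fun r hr =>
  h r (Finset.Icc_subset_Icc_right hst hr)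

theorem qfwState_congr {l : ℕ → ℕ} {t : ℕ} {x x' : ℕ → ℕ → ν → Bool} (h : AgreeUpTo l t x x') :
    M.qfwState par l x t = M.qfwState par l x' t := by
  induction t with
  | zero => rfl
  | succ t ih =>
    rw [CopositiveProgram.qfwState, CopositiveProgram.qfwState, ih (h.mono (by omega)),
      bestSample_congr _ (h (t + 1) (by simp))]

theorem qfwQubo_congr {l : ℕ → ℕ} {t : ℕ} {x x' : ℕ → ℕ → ν → Bool}
    (h : AgreeUpTo l (t - 1) x x') : M.qfwQubo par l x t = M.qfwQubo par l x' t := by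
  rw [CopositiveProgram.qfwQubo, CopositiveProgram.qfwQubo, qfwState_congr M par h]

/-- All oracle answers of iteration `s` fail to be optimal. -/
def AllFail (l : ℕ → ℕ) (s : ℕ) (x : ℕ → ℕ → ν → Bool) : Prop :=
  ∀ k ≤ l s, ¬ IsQuboMin (M.qfwQubo par l x s) (x s k)

variable {M par}

theorem allFail_congr {l : ℕ → ℕ} {s : ℕ} (hs : 1 ≤ s) {x x' : ℕ → ℕ → ν → Bool}
    (h : AgreeUpTo l s x x') : AllFail M par l s x ↔ AllFail M par l s x' := by
  rw [AllFail, AllFail, qfwQubo_congr M par (h.mono (by omega))]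
  exact forall₂_congr fun k hk => by rw [h s (by simp [hs]) k hk]

theorem allFail_of_not_isQuboMin {l : ℕ → ℕ} {s : ℕ} {x : ℕ → ℕ → ν → Bool}
    (h : ¬ IsQuboMin (M.qfwQubo par l x s) (M.qfwChoice par l x s)) : AllFail M par l s x :=
  fun _ hk hmin => h (isQuboMin_bestSample hk hmin)

end Dependence

/-! ## Failure probabilities -/

section Histories
variable {ν ι κ Ω : Type*}

/-- Indices of the oracle calls in the iterations `1, …, t`. -/
abbrev CallIndex (l : ℕ → ℕ) (t : ℕ) : Type :=
  ↥((Finset.Icc 1 t).sigma fun s => Finset.range (l s + 1))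

/-- The answer table of a history, filled up arbitrarily. -/
def historyTable {l : ℕ → ℕ} {t : ℕ} (h : CallIndex l t → ν → Bool) (s k : ℕ) : ν → Bool :=
  if hm : (⟨s, k⟩ : Σ _ : ℕ, ℕ) ∈ (Finset.Icc 1 t).sigma fun s => Finset.range (l s + 1) then
    h ⟨⟨s, k⟩, hm⟩ else fun _ => false

/-- The answers in the iterations `1, …, t`. -/
def history (l : ℕ → ℕ) (t : ℕ) (X : ℕ → ℕ → Ω → ν → Bool) (ω : Ω) :
    CallIndex l t → ν → Bool :=
  fun p => X p.1.1 p.1.2 ω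

theorem agreeUpTo_historyTable (l : ℕ → ℕ) (t : ℕ) (X : ℕ → ℕ → Ω → ν → Bool) (ω : Ω) :
    AgreeUpTo l t (fun s j => X s j ω) (historyTable (history l t X ω)) := by
  intro s hs k hk
  have hm : (⟨s, k⟩ : Σ _ : ℕ, ℕ) ∈ (Finset.Icc 1 t).sigma fun s => Finset.range (l s + 1) :=
    Finset.mem_sigma.2 ⟨hs, Finset.mem_range.2 (Nat.lt_succ_of_le hk)⟩
  rw [historyTable, dif_pos hm]
  rfl

theorem history_eq_iff {l : ℕ → ℕ} {t : ℕ} {X : ℕ → ℕ → Ω → ν → Bool} {ω : Ω}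
    {h : CallIndex l t → ν → Bool} :
    history l t X ω = h ↔ ∀ s ∈ Finset.Icc 1 t, ∀ k ≤ l s, X s k ω = historyTable h s k := by
  refine ⟨fun e => e ▸ agreeUpTo_historyTable l t X ω, fun e => funext fun ⟨⟨s, k⟩, hm⟩ => ?_⟩
  have hm' := Finset.mem_sigma.1 hm
  have := e s hm'.1 k (Nat.le_of_lt_succ (Finset.mem_range.1 hm'.2))
  rw [historyTable, dif_pos hm] at this
  exact this

end Histories

theorem RandomOracle.SuccessProb.sum_fail_le {ν : Type*} [Fintype ν] [Fintype (ν → Bool)]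
    {O : RandomOracle ν} {p₀ : ℝ} (hO : O.SuccessProb p₀) (hp₀ : 0 ≤ p₀) {t : ℕ} (ht : 1 ≤ t)
    (G : Matrix ν ν ℝ) (F : Finset (ν → Bool)) (hF : ∀ w ∈ F, ¬ IsQuboMin G w) :
    ∑ w ∈ F, O t G w ≤ ENNReal.ofReal (1 - p₀) := by
  classical
  have h1 := hO t ht G
  have h2 : (O t G).toOuterMeasure {w | IsQuboMin G w} ≤ ∑ w ∈ Fᶜ, O t G w := by
    rw [← PMF.toOuterMeasure_apply_finset]
    refine measure_mono fun w hw => ?_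
    simp only [Finset.coe_compl, Set.mem_compl_iff, Finset.mem_coe]
    exact fun hwF => hF w hwF hw
  have h3 : ∑ w ∈ F, O t G w + ∑ w ∈ Fᶜ, O t G w = 1 := by
    have h := (O t G).tsum_coe
    rwa [tsum_fintype, ← Finset.sum_add_sum_compl F] at h
  rw [ENNReal.ofReal_sub 1 hp₀, ENNReal.ofReal_one, ← h3]
  have h4 : ∑ w ∈ Fᶜ, O t G w ≠ ⊤ := by
    refine ne_top_of_le_ne_top ENNReal.one_ne_top ?_
    rw [← h3]
    exact le_add_self
  exact (ENNReal.add_sub_cancel_right h4).symm.le.trans (tsub_le_tsub_left (h1.trans h2) _)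

namespace IsQFWRun
variable {ν ι κ Ω : Type*} [Fintype ν] [Fintype ι] [Fintype κ] [MeasurableSpace Ω]
  {M : CopositiveProgram ν ι κ} {par : QFWParams ν ι κ} {O : RandomOracle ν} {Pr : Measure Ω}
  {l : ℕ → ℕ} {N : ℕ} {X : ℕ → ℕ → Ω → ν → Bool} {p₀ : ℝ}

theorem measurable_history (h : IsQFWRun M par O Pr l N X) {t : ℕ} (ht : t ≤ N) :
    Measurable (history l t X) := by
  refine measurable_pi_lambda _ fun ⟨⟨s, k⟩, hm⟩ => ?_
  have hm' := Finset.mem_sigma.1 hm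
  exact h.1 s (Finset.Icc_subset_Icc_right ht hm'.1) k
    (Nat.le_of_lt_succ (Finset.mem_range.1 hm'.2))

/-- Quantities determined by the history are measurable. -/
theorem measurable_of_agree (h : IsQFWRun M par O Pr l N X) {β : Type*} [MeasurableSpace β]
    {t : ℕ} (ht : t ≤ N) {Φ : (ℕ → ℕ → ν → Bool) → β}
    (hΦ : ∀ x x', AgreeUpTo l t x x' → Φ x = Φ x') : Measurable fun ω => Φ fun s j => X s j ω := by
  have h1 : (fun ω => Φ fun s j => X s j ω) = (fun g => Φ (historyTable g)) ∘ history l t X :=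
    funext fun ω => hΦ _ _ (agreeUpTo_historyTable l t X ω)
  rw [h1]
  exact Measurable.of_discrete.comp (h.measurable_history ht)

theorem measurableSet_of_agree (h : IsQFWRun M par O Pr l N X)
    {t : ℕ} (ht : t ≤ N) {A : (ℕ → ℕ → ν → Bool) → Prop}
    (hA : ∀ x x', AgreeUpTo l t x x' → (A x ↔ A x')) : MeasurableSet {ω | A fun s j => X s j ω} :=
  measurableSet_setOfPred.2 (h.measurable_of_agree ht fun x x' hx => propext (hA x x' hx))

/-- A cylinder of past answers fixes the QUBO matrix. Splitting by the new answers gives cells of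
product probability, and the sum of these products factors into single-call failure probabilities.
-/
theorem measure_history_inter_allFail_le (h : IsQFWRun M par O Pr l N X) (hO : O.SuccessProb p₀)
    (hp₀ : 0 ≤ p₀) {t : ℕ} (ht : t + 1 ≤ N) (x : ℕ → ℕ → ν → Bool) :
    Pr ({ω | ∀ s ∈ Finset.Icc 1 t, ∀ k ≤ l s, X s k ω = x s k} ∩
        {ω | AllFail M par l (t + 1) fun s j => X s j ω}) ≤
      Pr {ω | ∀ s ∈ Finset.Icc 1 t, ∀ k ≤ l s, X s k ω = x s k} *
        ENNReal.ofReal (1 - p₀) ^ (l (t + 1) + 1) := by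
  classical
  set m := l (t + 1) + 1 with hm
  set G := M.qfwQubo par l x (t + 1) with hG
  let F : Finset (ν → Bool) := Finset.univ.filter fun w => ¬ IsQuboMin G w
  let tab : (Fin m → ν → Bool) → ℕ → ℕ → ν → Bool := fun y s k =>
    if s = t + 1 then (if hk : k < m then y ⟨k, hk⟩ else fun _ => false) else x s k
  have htab : ∀ y, AgreeUpTo l t x (tab y) := fun y s hs k _ => by
    have : s ≠ t + 1 := by have := (Finset.mem_Icc.1 hs).2; omega
    simp [tab, this]
  have hsub : {ω | ∀ s ∈ Finset.Icc 1 t, ∀ k ≤ l s, X s k ω = x s k} ∩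
      {ω | AllFail M par l (t + 1) fun s j => X s j ω} ⊆
      ⋃ y ∈ Fintype.piFinset fun _ : Fin m => F,
        {ω | ∀ s ∈ Finset.Icc 1 (t + 1), ∀ k ≤ l s, X s k ω = tab y s k} := by
    rintro ω ⟨hx, hf⟩
    have hx' : AgreeUpTo l t (fun s j => X s j ω) x := hx
    simp only [Set.mem_iUnion]
    refine ⟨fun k => X (t + 1) k ω, Fintype.mem_piFinset.2 fun k => ?_, fun s hs k hk => ?_⟩
    · simp only [F, Finset.mem_filter, Finset.mem_univ, true_and, hG]
      rw [← qfwQubo_congr M par (t := t + 1) hx']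
      exact hf k (Nat.le_of_lt_succ k.2)
    · by_cases hst : s = t + 1
      · subst hst
        have : k < m := Nat.lt_succ_of_le hk
        simp [tab, this]
      · simp only [tab, if_neg hst]
        exact hx s (Finset.mem_Icc.2 ⟨(Finset.mem_Icc.1 hs).1, by
          have := (Finset.mem_Icc.1 hs).2; omega⟩) k hk
  have hcell : ∀ y, Pr {ω | ∀ s ∈ Finset.Icc 1 (t + 1), ∀ k ≤ l s, X s k ω = tab y s k} =
      Pr {ω | ∀ s ∈ Finset.Icc 1 t, ∀ k ≤ l s, X s k ω = x s k} * ∏ k, O (t + 1) G (y k) := by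
    intro y
    rw [h.2 (t + 1) ht, h.2 t (by omega), ← Finset.insert_Icc_right_eq_Icc_add_one (by omega),
      Finset.prod_insert (by simp), mul_comm]
    congr 1
    · refine Finset.prod_congr rfl fun s hs => Finset.prod_congr rfl fun k hk => ?_
      have hs' := (Finset.mem_Icc.1 hs).2
      rw [← qfwQubo_congr M par ((htab y).mono (by omega : s - 1 ≤ t)),
        ← htab y s hs k (Nat.le_of_lt_succ (Finset.mem_range.1 hk))]
    · rw [← hm, Finset.prod_range]
      refine Finset.prod_congr rfl fun k _ => ?_
      rw [← qfwQubo_congr M par (t := t + 1) (htab y), ← hG]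
      simp [tab]
  refine (measure_mono hsub).trans ((measure_biUnion_finset_le _ _).trans ?_)
  simp only [hcell]
  rw [← Finset.mul_sum, ← Finset.prod_univ_sum (fun _ : Fin m => F) fun _ w => O (t + 1) G w,
    Finset.prod_const, Finset.card_univ, Fintype.card_fin]
  gcongr
  exact hO.sum_fail_le hp₀ (by omega) G F fun w hw => (Finset.mem_filter.1 hw).2

/-- Given the past, all answers of an iteration fail with probability at most
`(1 - p₀) ^ (l + 1)`. -/
theorem measure_inter_allFail_le (h : IsQFWRun M par O Pr l N X) (hO : O.SuccessProb p₀)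
    (hp₀ : 0 ≤ p₀) {t : ℕ} (ht : t + 1 ≤ N) {A : (ℕ → ℕ → ν → Bool) → Prop}
    (hA : ∀ x x', AgreeUpTo l t x x' → (A x ↔ A x')) :
    Pr {ω | A (fun s j => X s j ω) ∧ AllFail M par l (t + 1) fun s j => X s j ω} ≤
      Pr {ω | A fun s j => X s j ω} * ENNReal.ofReal (1 - p₀) ^ (l (t + 1) + 1) := by
  classical
  let F : Finset (CallIndex l t → ν → Bool) := Finset.univ.filter fun g => A (historyTable g)
  have hset : ∀ g : CallIndex l t → ν → Bool, {ω | history l t X ω = g} =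
      {ω | ∀ s ∈ Finset.Icc 1 t, ∀ k ≤ l s, X s k ω = historyTable g s k} := fun g =>
    Set.ext fun ω => history_eq_iff
  have hsub : {ω | A (fun s j => X s j ω) ∧ AllFail M par l (t + 1) fun s j => X s j ω} ⊆
      ⋃ g ∈ F, ({ω | history l t X ω = g} ∩ {ω | AllFail M par l (t + 1) fun s j => X s j ω}) := by
    rintro ω ⟨hω, hf⟩
    simp only [Set.mem_iUnion]
    refine ⟨history l t X ω, Finset.mem_filter.2 ⟨Finset.mem_univ _, ?_⟩, rfl, hf⟩
    exact (hA _ _ (agreeUpTo_historyTable l t X ω)).1 hω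
  have hsup : ⋃ g ∈ F, {ω | history l t X ω = g} ⊆ {ω | A fun s j => X s j ω} := by
    intro ω hω
    simp only [Set.mem_iUnion] at hω
    obtain ⟨g, hg, rfl⟩ := hω
    exact (hA _ _ (agreeUpTo_historyTable l t X ω)).2 (Finset.mem_filter.1 hg).2
  calc _ ≤ ∑ g ∈ F, Pr ({ω | history l t X ω = g} ∩
        {ω | AllFail M par l (t + 1) fun s j => X s j ω}) :=
        (measure_mono hsub).trans (measure_biUnion_finset_le _ _)
    _ ≤ ∑ g ∈ F, Pr {ω | history l t X ω = g} * ENNReal.ofReal (1 - p₀) ^ (l (t + 1) + 1) := by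
        refine Finset.sum_le_sum fun g _ => ?_
        rw [hset]
        exact h.measure_history_inter_allFail_le hO hp₀ ht _
    _ = Pr (⋃ g ∈ F, {ω | history l t X ω = g}) * ENNReal.ofReal (1 - p₀) ^ (l (t + 1) + 1) := by
        rw [← Finset.sum_mul, measure_biUnion_finset]
        · intro g _ g' _ hne
          exact Set.disjoint_left.2 fun ω h1 h2 => hne (h1.symm.trans h2)
        · intro g _
          exact h.measurable_history (by omega) (measurableSet_singleton g)
    _ ≤ _ := by gcongr

theorem measure_allFail_le [IsProbabilityMeasure Pr] (h : IsQFWRun M par O Pr l N X)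
    (hO : O.SuccessProb p₀) (hp₀ : 0 ≤ p₀) {s : ℕ} (hs : s ∈ Finset.Icc 1 N) :
    Pr {ω | AllFail M par l s fun s j => X s j ω} ≤ ENNReal.ofReal (1 - p₀) ^ (l s + 1) := by
  obtain ⟨h1, h2⟩ := Finset.mem_Icc.1 hs
  obtain ⟨t, rfl⟩ := Nat.exists_eq_add_of_le' h1
  simpa using h.measure_inter_allFail_le hO hp₀ h2 (A := fun _ => True) fun _ _ _ => Iff.rfl

/-- The failure at `s` is decided by the history before iteration `t`, so the conditional bound at
`t` multiplies the bound at `s`. -/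
theorem measure_two_allFail_le [IsProbabilityMeasure Pr] (h : IsQFWRun M par O Pr l N X)
    (hO : O.SuccessProb p₀) (hp₀ : 0 ≤ p₀) {s t : ℕ} (hs : 1 ≤ s) (hst : s < t) (ht : t ≤ N) :
    Pr {ω | AllFail M par l s (fun s j => X s j ω) ∧ AllFail M par l t fun s j => X s j ω} ≤
      ENNReal.ofReal (1 - p₀) ^ (l s + 1) * ENNReal.ofReal (1 - p₀) ^ (l t + 1) := by
  obtain ⟨r, rfl⟩ := Nat.exists_eq_add_of_le' (by omega : 1 ≤ t)
  refine (h.measure_inter_allFail_le hO hp₀ ht (A := AllFail M par l s) fun x x' hx =>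
    allFail_congr hs (hx.mono (by omega))).trans ?_
  gcongr
  exact h.measure_allFail_le hO hp₀ (Finset.mem_Icc.2 ⟨hs, by omega⟩)

end IsQFWRun

/-! ## The completely positive reformulation -/

namespace QCBO
variable {n d e : ℕ}

theorem quboEnergy_bordered (s : ℝ) (u : Fin n → ℝ) (X : Matrix (Fin n) (Fin n) ℝ)
    (w : Option (Fin n) → Bool) : quboEnergy (bordered s u X) w =
      s * bitVec w none + 2 * bitVec w none * ∑ j, u j * bitVec w (some j)
        + quboEnergy X fun j => w (some j) := by
  have h0 := bitVec_mul_self w none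
  simp only [quboEnergy, dotProduct, Matrix.mulVec, Fintype.sum_option, bordered, Matrix.of_apply]
  have h1 : ∀ j, bitVec (fun j => w (some j)) j = bitVec w (some j) := fun j => rfl
  simp only [h1, mul_add, Finset.sum_add_distrib]
  have h2 : bitVec w none * (s * bitVec w none) = s * bitVec w none := by linear_combination s * h0
  have h3 : ∑ i, bitVec w (some i) * (u i * bitVec w none) =
      bitVec w none * ∑ j, u j * bitVec w (some j) := by
    rw [Finset.mul_sum]; exact Finset.sum_congr rfl fun _ _ => by ring
  rw [h2, h3]
  ring

theorem quboEnergy_zero {ν : Type*} [Fintype ν] (w : ν → Bool) :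
    quboEnergy (0 : Matrix ν ν ℝ) w = 0 := by
  simp [quboEnergy]

theorem quboEnergy_vecMulVec {ν : Type*} [Fintype ν] (a : ν → ℝ) (w : ν → Bool) :
    quboEnergy (Matrix.vecMulVec a a) w = (a ⬝ᵥ bitVec w) ^ 2 := by
  rw [quboEnergy, Matrix.vecMulVec_mulVec, dotProduct_smul, dotProduct_comm]
  simp [sq]

variable (P : QCBO n d e) (w : Option (Fin n) → Bool)

theorem objective_rankOne :
    P.toProgram.objective (rankOne w) = P.objective fun j => w (some j) := by
  rw [CopositiveProgram.objective, trace_mul_rankOne]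
  change quboEnergy (bordered 0 0 P.Q) w = _
  rw [quboEnergy_bordered]
  simp [quboEnergy, QCBO.objective]

theorem eqRes_rankOne_unit :
    P.toProgram.eqRes (rankOne w) (Sum.inl ()) = bitVec w none - 1 := by
  rw [CopositiveProgram.eqRes, trace_mul_rankOne]
  change quboEnergy (bordered 1 0 0) w - 1 = _
  rw [quboEnergy_bordered, quboEnergy_zero]
  simp

theorem eqRes_rankOne_diag (j : Fin n) :
    P.toProgram.eqRes (rankOne w) (Sum.inr (Sum.inl j)) =
      (1 - bitVec w none) * bitVec w (some j) := by
  rw [CopositiveProgram.eqRes, trace_mul_rankOne]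
  change quboEnergy (bordered 0 (Pi.single j (-1 / 2)) (Matrix.single j j 1)) w - 0 = _
  rw [quboEnergy_bordered]
  have h1 : ∑ i, (Pi.single j (-1 / 2) : Fin n → ℝ) i * bitVec w (some i) =
      -1 / 2 * bitVec w (some j) := by
    rw [Finset.sum_eq_single j] <;> simp +contextual
  have h2 : quboEnergy (Matrix.single j j 1) (fun i => w (some i)) = bitVec w (some j) := by
    rw [Matrix.single_eq_single_vecMulVec_single, quboEnergy_vecMulVec, single_dotProduct, one_mul,
      sq]
    exact bitVec_mul_self w (some j)
  rw [h1, h2]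
  ring

theorem eqRes_rankOne_linear (i : Fin d) :
    P.toProgram.eqRes (rankOne w) (Sum.inr (Sum.inr (Sum.inl i))) =
      bitVec w none * P.A.mulVec (bitVec fun j => w (some j)) i - P.b i := by
  rw [CopositiveProgram.eqRes, trace_mul_rankOne]
  change quboEnergy (bordered 0 (fun j => P.A i j / 2) 0) w - P.b i = _
  rw [quboEnergy_bordered, quboEnergy_zero, Matrix.mulVec, dotProduct, Finset.mul_sum,
    Finset.mul_sum, zero_mul, zero_add, add_zero]
  congr 1
  refine Finset.sum_congr rfl fun j _ => ?_
  change _ = bitVec w none * (P.A i j * bitVec w (some j))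
  ring

theorem eqRes_rankOne_quadratic (i : Fin d) :
    P.toProgram.eqRes (rankOne w) (Sum.inr (Sum.inr (Sum.inr i))) =
      P.A.mulVec (bitVec fun j => w (some j)) i ^ 2 - P.b i ^ 2 := by
  rw [CopositiveProgram.eqRes, trace_mul_rankOne]
  change quboEnergy (bordered 0 0 (Matrix.vecMulVec (P.A i) (P.A i))) w - P.b i ^ 2 = _
  rw [quboEnergy_bordered, quboEnergy_vecMulVec]
  simp [Matrix.mulVec]

theorem ineqRes_rankOne (k : Fin e) :
    P.toProgram.ineqRes (rankOne w) k =
      quboEnergy (P.R k) (fun j => w (some j)) - P.r k := by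
  rw [CopositiveProgram.ineqRes, trace_mul_rankOne]
  change quboEnergy (bordered 0 0 (P.R k)) w - P.r k = _
  rw [quboEnergy_bordered]
  simp

variable {P w}

theorem rankOne_eq_liftPoint (hw : w none = true) : rankOne w = liftPoint fun j => w (some j) := by
  ext i j
  rcases i with _ | i <;> rcases j with _ | j <;>
    simp [rankOne_apply, liftPoint, bordered, bitVec, hw]

theorem liftPoint_eq_rankOne (x : Fin n → Bool) :
    liftPoint x = rankOne fun o : Option (Fin n) => o.elim true x :=
  (rankOne_eq_liftPoint (w := fun o : Option (Fin n) => o.elim true x) rfl).symm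

theorem objective_liftPoint (x : Fin n → Bool) :
    P.toProgram.objective (liftPoint x) = P.objective x := by
  rw [liftPoint_eq_rankOne, objective_rankOne]; rfl

theorem IsFeasible.liftPoint_mem {x : Fin n → Bool} (hx : P.IsFeasible x) :
    liftPoint x ∈ P.toProgram.feasibleSet := by
  have h0 : bitVec (fun o : Option (Fin n) => o.elim true x) none = 1 := rfl
  have h1 : ∀ i, P.A.mulVec (bitVec x) i = P.b i := fun i => congrFun hx.1 i
  rw [liftPoint_eq_rankOne]
  refine ⟨rankOne_mem_binaryHull _, ?_, fun k => ?_⟩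
  · rintro (_ | j | i | i)
    · rw [eqRes_rankOne_unit, h0, sub_self]
    · rw [eqRes_rankOne_diag, h0, sub_self, zero_mul]
    · rw [eqRes_rankOne_linear, h0, one_mul]
      exact sub_eq_zero.2 (h1 i)
    · rw [eqRes_rankOne_quadratic]
      exact sub_eq_zero.2 (congrArg (· ^ 2) (h1 i))
  · rw [ineqRes_rankOne]
    exact sub_nonpos.2 (hx.2 k)

/-- Exactness of the reformulation without inequality constraints and with a unique minimizer. -/
theorem optimalSet_eq_singleton (he : e = 0) {x₀ : Fin n → Bool}
    (hx₀ : ∀ x, P.IsMinimizer x ↔ x = x₀) : P.toProgram.optimalSet = {liftPoint x₀} := by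
  have hmin := (hx₀ x₀).2 rfl
  have hmem := hmin.1.liftPoint_mem
  have hsub : ∀ V ∈ P.toProgram.optimalSet, V = liftPoint x₀ := by
    intro V hV
    have hle := hV.2 _ hmem
    obtain ⟨c, hc, hc1, rfl⟩ := exists_weights_of_mem_binaryHull hV.1.1
    have heq := fun i => (P.toProgram.eqRes_sum hc1 rankOne i).symm.trans (hV.1.2.1 i)
    -- A quantity that is nonnegative on the support and has nonpositive mean vanishes on the
    -- support. This is applied to `1 - w none`, to the squared defect of each linear equation, and
    -- to the excess of the objective.
    have hzero : ∀ φ : (Option (Fin n) → Bool) → ℝ, (∀ w, 0 ≤ c w * φ w) →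
        ∑ w, c w * φ w ≤ 0 → ∀ w, c w ≠ 0 → φ w = 0 := fun φ h1 h2 w hw => by
      have h3 := (Finset.sum_eq_zero_iff_of_nonneg fun w _ => h1 w).1
        (le_antisymm h2 (Finset.sum_nonneg fun w _ => h1 w)) w (Finset.mem_univ _)
      exact (mul_eq_zero.1 h3).resolve_left hw
    have hnone : ∀ w, c w ≠ 0 → w none = true := fun w hw => by
      have h1 := hzero (fun w => -P.toProgram.eqRes (rankOne w) (Sum.inl ())) (fun w => by
        refine mul_nonneg (hc w) ?_
        rw [eqRes_rankOne_unit]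
        unfold bitVec
        split_ifs <;> norm_num) (by
        simp only [mul_neg, Finset.sum_neg_distrib, heq (Sum.inl ()), neg_zero, le_refl]) w hw
      rw [eqRes_rankOne_unit] at h1
      by_contra hcon
      simp [bitVec, hcon] at h1
    have hlin : ∀ i w, c w ≠ 0 → P.A.mulVec (bitVec fun j => w (some j)) i - P.b i = 0 := by
      intro i w hw
      -- The identity `(y - b)² = (y² - b²) - 2 b (y - b)`: the quadratic and the linear constraint
      -- together annihilate the mean square deviation from `b`.
      have h1 : ∀ w, c w * (P.A.mulVec (bitVec fun j => w (some j)) i - P.b i) ^ 2 =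
          c w * P.toProgram.eqRes (rankOne w) (Sum.inr (Sum.inr (Sum.inr i)))
          - 2 * P.b i *
            (c w * P.toProgram.eqRes (rankOne w) (Sum.inr (Sum.inr (Sum.inl i)))) := fun w => by
        by_cases h : c w = 0
        · simp [h]
        · have h0 : bitVec w none = 1 := by simp [bitVec, hnone w h]
          rw [eqRes_rankOne_quadratic, eqRes_rankOne_linear, h0]
          ring
      have h2 := hzero (fun w => (P.A.mulVec (bitVec fun j => w (some j)) i - P.b i) ^ 2)
        (fun w => mul_nonneg (hc w) (sq_nonneg _)) (by
        simp only [h1, Finset.sum_sub_distrib, ← Finset.mul_sum, heq, mul_zero, sub_zero, le_refl])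
        w hw
      exact pow_eq_zero_iff (two_ne_zero) |>.1 h2
    -- Here `e = 0` matters: the program imposes an inequality only on the average over the support.
    have hfeas : ∀ w, c w ≠ 0 → P.IsFeasible fun j => w (some j) := fun w hw =>
      ⟨funext fun i => sub_eq_zero.1 (hlin i w hw), fun k => absurd k.2 (by omega)⟩
    rw [P.toProgram.objective_sum, objective_liftPoint] at hle
    have hobj : ∀ w, c w ≠ 0 →
        P.toProgram.objective (rankOne w) - P.objective x₀ = 0 := by
      refine hzero (fun w => P.toProgram.objective (rankOne w) - P.objective x₀) (fun w => ?_) ?_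
      · by_cases h : c w = 0
        · simp [h]
        · refine mul_nonneg (hc w) (sub_nonneg.2 ?_)
          rw [objective_rankOne]
          exact hmin.2 _ (hfeas w h)
      · simp only [mul_sub, Finset.sum_sub_distrib, ← Finset.sum_mul, hc1, one_mul]
        linarith
    have hpt : ∀ w, c w • rankOne w = c w • liftPoint x₀ := fun w => by
      by_cases h : c w = 0
      · simp [h]
      · have h1 : (fun j => w (some j)) = x₀ := (hx₀ _).1 ⟨hfeas w h, fun y hy => by
          have h2 := hobj w h
          rw [objective_rankOne, sub_eq_zero] at h2
          rw [h2]
          exact hmin.2 y hy⟩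
        rw [rankOne_eq_liftPoint (hnone w h), h1]
    rw [Finset.sum_congr rfl fun w _ => hpt w, ← Finset.sum_smul, hc1, one_smul]
  refine Set.eq_singleton_iff_unique_mem.2 ⟨?_, hsub⟩
  obtain ⟨V, hV⟩ := CopositiveProgram.optimalSet_nonempty ⟨_, hmem⟩
  exact hsub V hV ▸ hV

end QCBO

/-! ## Number of samples and time to solution -/

/-- For `p₀ < 1`, the constant `c` is chosen so that `(1 - p₀) ^ (c * log t) = t ^ (-2)`. The
additional sample contributes the factor `1 - p₀`. -/
theorem pow_extraSamples_le {p₀ : ℝ} (hp₀ : 0 < p₀) (hp₀' : p₀ ≤ 1) {t : ℕ} (ht : 1 ≤ t) :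
    (1 - p₀) ^ (extraSamples p₀ t + 1) ≤ (1 - p₀) / (t : ℝ) ^ 2 := by
  rcases hp₀'.eq_or_lt with rfl | h
  · simp
  have ht0 : (0 : ℝ) < t := by exact_mod_cast ht
  have ha : 0 < 1 - p₀ := by linarith
  have hlog : Real.log (1 - p₀) < 0 := Real.log_neg ha (by linarith)
  have h1 : 2 / (-Real.log (1 - p₀)) * Real.log t ≤ extraSamples p₀ t := Nat.le_ceil _
  have h2 : (1 - p₀) ^ extraSamples p₀ t ≤ 1 / (t : ℝ) ^ 2 := by
    rw [← Real.log_le_log_iff (by positivity) (by positivity), Real.log_pow, Real.log_div one_ne_zero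
      (by positivity), Real.log_one, Real.log_pow, zero_sub]
    rw [div_mul_eq_mul_div, div_le_iff₀ (by linarith)] at h1
    push_cast
    linarith
  rw [pow_succ, div_eq_mul_one_div, mul_comm]
  exact mul_le_mul_of_nonneg_left h2 ha.le

theorem ofReal_pow_extraSamples_le {p₀ : ℝ} (hp₀ : 0 < p₀) (hp₀' : p₀ ≤ 1) {t : ℕ} (ht : 1 ≤ t) :
    ENNReal.ofReal (1 - p₀) ^ (extraSamples p₀ t + 1) ≤
      ENNReal.ofReal ((1 - p₀) / (t : ℝ) ^ 2) := by
  rw [← ENNReal.ofReal_pow (by linarith)]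
  exact ENNReal.ofReal_le_ofReal (pow_extraSamples_le hp₀ hp₀' ht)

/-- A success probability of at least `p₀` needs a number of repetitions independent of `T`, and a
run makes `T` times O(log T) + O(1) calls, which is O(T log n). -/
theorem exists_time_bound {p₀ : ℝ} (hp₀ : 0 < p₀) (pR : ℝ) (hpR : pR < 1) (q : ℕ) :
    ∃ K : ℝ, ∀ (n T : ℕ) (τ s : ℝ), 2 ≤ n → 1 ≤ T → T ≤ n ^ q → 0 ≤ τ → p₀ ≤ s → s ≤ 1 →
      timeToSolution (runTime τ (fun _ => extraSamples p₀ T) T) s pR ≤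
        ENNReal.ofReal (K * (τ * T * Real.log n)) := by
  obtain ⟨R₀, hR₀⟩ : ∃ R : ℕ, (1 - min p₀ 1) ^ R < 1 - pR :=
    exists_pow_lt_of_lt_one (by linarith) (by
      have := lt_min hp₀ one_pos
      linarith)
  set c := 2 / (-Real.log (1 - p₀)) with hc
  -- `R₀ + 1` guarantees at least one repetition. The term `2 / log 2` turns the units from the
  -- ceiling and the additional sample into a multiple of `log n`.
  refine ⟨(R₀ + 1) * (|c| * q + 2 / Real.log 2), fun n T τ s hn hT hTn hτ hs hs1 => ?_⟩
  have hR : pR ≤ 1 - (1 - s) ^ (R₀ + 1) := by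
    have h1 : (1 - s) ^ (R₀ + 1) ≤ (1 - s) ^ R₀ :=
      pow_le_pow_of_le_one (by linarith) (by linarith) (by omega)
    have h2 : (1 - s) ^ R₀ ≤ (1 - min p₀ 1) ^ R₀ :=
      pow_le_pow_left₀ (by linarith) (by linarith [min_le_left p₀ 1]) _
    linarith
  refine (iInf₂_le (R₀ + 1) ⟨by omega, hR⟩).trans (ENNReal.ofReal_le_ofReal ?_)
  have hlog2 : 0 < Real.log 2 := Real.log_pos (by norm_num)
  have hlogn : Real.log 2 ≤ Real.log n := Real.log_le_log (by norm_num) (by exact_mod_cast hn)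
  have hlogT0 : 0 ≤ Real.log T := Real.log_nonneg (by exact_mod_cast hT)
  have hlogT : Real.log T ≤ q * Real.log n := by
    rw [← Real.log_pow]
    exact Real.log_le_log (by exact_mod_cast hT) (by exact_mod_cast hTn)
  have hl : (extraSamples p₀ T : ℝ) + 1 ≤ (|c| * q + 2 / Real.log 2) * Real.log n := by
    have h1 : (extraSamples p₀ T : ℝ) ≤ |c| * Real.log T + 1 := by
      have h2 : extraSamples p₀ T ≤ ⌈|c| * Real.log T⌉₊ :=
        Nat.ceil_mono (mul_le_mul_of_nonneg_right (le_abs_self _) hlogT0)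
      exact (Nat.cast_le.2 h2).trans (Nat.ceil_lt_add_one (by positivity)).le
    have h3 : |c| * Real.log T ≤ |c| * (q * Real.log n) :=
      mul_le_mul_of_nonneg_left hlogT (abs_nonneg _)
    have h4 : 2 ≤ 2 / Real.log 2 * Real.log n := by
      rw [div_mul_eq_mul_div, le_div_iff₀ hlog2]
      linarith
    linarith
  rw [runTime, Finset.sum_const, Nat.card_Icc, nsmul_eq_mul]
  push_cast
  have h5 : 0 ≤ (R₀ + 1 : ℝ) * T * τ := by positivity
  have h6 := mul_le_mul_of_nonneg_left hl h5
  linarith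

/-! ### Failure counts of the random runs -/

section Random
variable {ν ι κ Ω : Type*} [Fintype ν] [Fintype ι] [Fintype κ] [MeasurableSpace Ω]
  {M : CopositiveProgram ν ι κ} {par : QFWParams ν ι κ} {O : RandomOracle ν} {Pr : Measure Ω}
  {p₀ : ℝ}

open Classical in
theorem failCount_qfwChoice_le (l : ℕ → ℕ) (x : ℕ → ℕ → ν → Bool) (t : ℕ) :
    M.failCount par (M.qfwChoice par l x) t ≤
      ((Finset.Icc 1 t).filter fun s => AllFail M par l s x).card := by
  refine Finset.card_le_card fun s hs => ?_
  simp only [Finset.mem_filter] at hs ⊢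
  refine ⟨hs.1, allFail_of_not_isQuboMin ?_⟩
  rw [← M.qfwState_eq_trajectory] at hs
  exact hs.2

theorem failCount_mono (M : CopositiveProgram ν ι κ) (par : QFWParams ν ι κ) (w : ℕ → ν → Bool)
    {s t : ℕ} (h : s ≤ t) : M.failCount par w s ≤ M.failCount par w t := by
  classical
  exact Finset.card_le_card (Finset.filter_subset_filter _ (Finset.Icc_subset_Icc_right h))

theorem failCount_eq_zero (l : ℕ → ℕ) {x : ℕ → ℕ → ν → Bool} {t : ℕ}
    (h : ∀ s ∈ Finset.Icc 1 t, IsQuboMin (M.qfwQubo par l x s) (M.qfwChoice par l x s)) :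
    M.failCount par (M.qfwChoice par l x) t = 0 := by
  classical
  refine Finset.card_eq_zero.2 (Finset.filter_eq_empty_iff.2 fun s hs => not_not.2 ?_)
  rw [← M.qfwState_eq_trajectory]
  exact h s hs

/-- Some iteration of the run of `T` iterations fails with probability at most `(1 - p₀) / T`. -/
theorem measure_some_fail_le [IsProbabilityMeasure Pr] (hO : O.SuccessProb p₀) (hp₀ : 0 < p₀)
    (hp₀' : p₀ ≤ 1) {T : ℕ} (hT : 1 ≤ T) {X : ℕ → ℕ → Ω → ν → Bool}
    (h : IsQFWRun M par O Pr (fun _ => extraSamples p₀ T) T X) :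
    Pr {ω | ∃ s ∈ Finset.Icc 1 T,
      AllFail M par (fun _ => extraSamples p₀ T) s fun s j => X s j ω} ≤
      ENNReal.ofReal ((1 - p₀) / T) := by
  have hsub : {ω | ∃ s ∈ Finset.Icc 1 T,
      AllFail M par (fun _ => extraSamples p₀ T) s fun s j => X s j ω} ⊆
      ⋃ s ∈ Finset.Icc 1 T,
        {ω | AllFail M par (fun _ => extraSamples p₀ T) s fun s j => X s j ω} := by
    rintro ω ⟨s, hs, hf⟩
    simp only [Set.mem_iUnion]
    exact ⟨s, hs, hf⟩
  refine (measure_mono hsub).trans ((measure_biUnion_finset_le _ _).trans ?_)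
  refine (Finset.sum_le_sum fun s hs => (h.measure_allFail_le hO hp₀.le hs).trans
    (ofReal_pow_extraSamples_le hp₀ hp₀' hT)).trans (le_of_eq ?_)
  have hT0 : (0 : ℝ) < T := by exact_mod_cast hT
  rw [Finset.sum_const, Nat.card_Icc, Nat.add_sub_cancel, nsmul_eq_mul, ← ENNReal.ofReal_natCast,
    ← ENNReal.ofReal_mul (by positivity)]
  congr 1
  field_simp

/-- Almost surely all but finitely many of the runs have at most one failed iteration. -/
theorem ae_eventually_failCount_le_one [IsProbabilityMeasure Pr] (hO : O.SuccessProb p₀)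
    (hp₀ : 0 < p₀) (hp₀' : p₀ ≤ 1) {X : ℕ → ℕ → ℕ → Ω → ν → Bool}
    (h : ∀ T, 1 ≤ T → IsQFWRun M par O Pr (fun _ => extraSamples p₀ T) T (X T)) :
    ∀ᵐ ω ∂Pr, ∀ᶠ T in atTop, M.failCount par
      (M.qfwChoice par (fun _ => extraSamples p₀ T) fun s j => X T s j ω) T ≤ 1 := by
  classical
  let E : ℕ → Set Ω := fun T => {ω | 1 < M.failCount par
      (M.qfwChoice par (fun _ => extraSamples p₀ T) fun s j => X T s j ω) T}
  -- The available bound for one failure is of order `1 / T`, not summable. For two failures, at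
  -- most `T ^ 2` pairs of iterations with probability at most `1 / T ^ 4` each give a summable
  -- bound.
  suffices hE : ∀ T, Pr (E T) ≤ ENNReal.ofReal (1 / (T : ℝ) ^ 2) by
    have h1 : ∑' T, Pr (E T) ≠ ⊤ := ne_top_of_le_ne_top
      (Real.summable_one_div_nat_pow.2 one_lt_two).tsum_ofReal_ne_top
      (ENNReal.tsum_le_tsum hE)
    filter_upwards [ae_eventually_notMem h1] with ω hω
    exact hω.mono fun T hT => not_lt.1 hT
  intro T
  rcases Nat.eq_zero_or_pos T with rfl | hT
  · have : E 0 = ∅ := Set.eq_empty_iff_forall_notMem.2 fun ω hω => by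
      simp [E, CopositiveProgram.failCount] at hω
    rw [this, measure_empty]
    exact zero_le
  have hsub : E T ⊆ ⋃ p ∈ (Finset.Icc 1 T ×ˢ Finset.Icc 1 T).filter fun p => p.1 < p.2,
      {ω | AllFail M par (fun _ => extraSamples p₀ T) p.1 (fun s j => X T s j ω) ∧
        AllFail M par (fun _ => extraSamples p₀ T) p.2 fun s j => X T s j ω} := by
    intro ω hω
    obtain ⟨a, b, ha, hb, hab⟩ := Finset.one_lt_card_iff.1
      (lt_of_lt_of_le (show 1 < _ from hω) (failCount_qfwChoice_le _ _ _))
    simp only [Finset.mem_filter] at ha hb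
    simp only [Set.mem_iUnion]
    rcases lt_or_gt_of_ne hab with hlt | hlt
    · exact ⟨(a, b), Finset.mem_filter.2 ⟨Finset.mk_mem_product ha.1 hb.1, hlt⟩, ha.2, hb.2⟩
    · exact ⟨(b, a), Finset.mem_filter.2 ⟨Finset.mk_mem_product hb.1 ha.1, hlt⟩, hb.2, ha.2⟩
  have hT0 : (0 : ℝ) < T := by exact_mod_cast hT
  have hterm : ∀ p ∈ (Finset.Icc 1 T ×ˢ Finset.Icc 1 T).filter fun p => p.1 < p.2,
      Pr {ω | AllFail M par (fun _ => extraSamples p₀ T) p.1 (fun s j => X T s j ω) ∧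
        AllFail M par (fun _ => extraSamples p₀ T) p.2 fun s j => X T s j ω} ≤
      ENNReal.ofReal (1 / (T : ℝ) ^ 4) := by
    intro p hp
    obtain ⟨hp1, hp2⟩ := Finset.mem_filter.1 hp
    obtain ⟨hp3, hp4⟩ := Finset.mem_product.1 hp1
    refine ((h T hT).measure_two_allFail_le hO hp₀.le (Finset.mem_Icc.1 hp3).1 hp2
      (Finset.mem_Icc.1 hp4).2).trans ?_
    have h1 := ofReal_pow_extraSamples_le hp₀ hp₀' hT
    have h2 : 0 ≤ (1 - p₀) / (T : ℝ) ^ 2 := div_nonneg (by linarith) (by positivity)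
    refine (mul_le_mul' h1 h1).trans ?_
    rw [← ENNReal.ofReal_mul h2]
    refine ENNReal.ofReal_le_ofReal ?_
    have h3 : (1 - p₀) / (T : ℝ) ^ 2 ≤ 1 / (T : ℝ) ^ 2 :=
      div_le_div_of_nonneg_right (by linarith) (by positivity)
    refine (mul_le_mul h3 h3 h2 (by positivity)).trans (le_of_eq ?_)
    field_simp
  refine (measure_mono hsub).trans ((measure_biUnion_finset_le _ _).trans
    ((Finset.sum_le_sum hterm).trans ?_))
  rw [Finset.sum_const, nsmul_eq_mul]
  have hcard : (((Finset.Icc 1 T ×ˢ Finset.Icc 1 T).filter fun p => p.1 < p.2).card : ENNReal) ≤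
      ENNReal.ofReal ((T : ℝ) ^ 2) := by
    have h1 : ((Finset.Icc 1 T ×ˢ Finset.Icc 1 T).filter fun p => p.1 < p.2).card ≤ T ^ 2 :=
      (Finset.card_filter_le _ _).trans (by
        rw [Finset.card_product, Nat.card_Icc, Nat.add_sub_cancel, sq])
    rw [show (T : ℝ) ^ 2 = ((T ^ 2 : ℕ) : ℝ) by push_cast; rfl, ENNReal.ofReal_natCast]
    exact_mod_cast h1
  refine (mul_le_mul_left hcard _).trans ?_
  rw [← ENNReal.ofReal_mul (by positivity)]
  refine ENNReal.ofReal_le_ofReal (le_of_eq ?_)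
  field_simp

/-- Almost surely an infinite run has finitely many failed iterations. -/
theorem ae_exists_failCount_le [IsProbabilityMeasure Pr] (hO : O.SuccessProb p₀)
    (hp₀ : 0 < p₀) (hp₀' : p₀ ≤ 1) {Y : ℕ → ℕ → Ω → ν → Bool}
    (h : ∀ N, IsQFWRun M par O Pr (extraSamples p₀) N Y) :
    ∀ᵐ ω ∂Pr, ∃ J, ∀ t, M.failCount par
      (M.qfwChoice par (extraSamples p₀) fun s j => Y s j ω) t ≤ J := by
  classical
  let E : ℕ → Set Ω := fun t =>
    {ω | 1 ≤ t ∧ AllFail M par (extraSamples p₀) t fun s j => Y s j ω}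
  have hE : ∀ t, Pr (E t) ≤ ENNReal.ofReal (1 / (t : ℝ) ^ 2) := fun t => by
    rcases Nat.eq_zero_or_pos t with rfl | ht
    · have : E 0 = ∅ := Set.eq_empty_iff_forall_notMem.2 fun ω hω => absurd hω.1 (by simp)
      rw [this, measure_empty]
      exact zero_le
    · refine (measure_mono fun ω hω => hω.2).trans
        (((h t).measure_allFail_le hO hp₀.le (Finset.mem_Icc.2 ⟨ht, le_rfl⟩)).trans
        ((ofReal_pow_extraSamples_le hp₀ hp₀' ht).trans (ENNReal.ofReal_le_ofReal ?_)))
      exact div_le_div_of_nonneg_right (by linarith) (by positivity)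
  -- The sample size grows with `t`, so single failures are summable here; the resulting bound `J`
  -- depends on `ω`.
  have h1 : ∑' t, Pr (E t) ≠ ⊤ := ne_top_of_le_ne_top
    (Real.summable_one_div_nat_pow.2 one_lt_two).tsum_ofReal_ne_top (ENNReal.tsum_le_tsum hE)
  filter_upwards [ae_eventually_notMem h1] with ω hω
  obtain ⟨J, hJ⟩ := eventually_atTop.1 hω
  refine ⟨J, fun t => (failCount_qfwChoice_le _ _ _).trans ?_⟩
  refine (Finset.card_le_card (t := Finset.range J) fun s hs => ?_).trans (Finset.card_range J).le
  obtain ⟨hs1, hs2⟩ := Finset.mem_filter.1 hs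
  by_contra hcon
  exact hJ s (not_lt.1 fun h => hcon (Finset.mem_range.2 h)) ⟨(Finset.mem_Icc.1 hs1).1, hs2⟩

/-- Applied with `E` the event that some iteration fails: the rate holds outside `E`, the uniform
bound inside. -/
theorem integral_le_of_small_off_event [IsProbabilityMeasure Pr] {f : Ω → ℝ} (hf : Measurable f)
    {E : Set Ω} (hE : MeasurableSet E) {a B : ℝ} (ha : 0 ≤ a) (hB : ∀ ω, |f ω| ≤ B)
    (hfa : ∀ ω ∉ E, |f ω| ≤ a) :
    Integrable f Pr ∧ ∫ ω, |f ω| ∂Pr ≤ a + B * Pr.real E := by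
  have hint : Integrable f Pr := Integrable.of_bound hf.aestronglyMeasurable B
    (Eventually.of_forall hB)
  refine ⟨hint, ?_⟩
  have h1 : Integrable (fun ω => a + E.indicator (fun _ => B) ω) Pr :=
    (integrable_const a).add ((integrable_const B).indicator hE)
  refine (integral_mono hint.abs h1 fun ω => ?_).trans (le_of_eq ?_)
  · by_cases hω : ω ∈ E
    · simp only [Set.indicator_of_mem hω]
      linarith [hB ω]
    · simp only [Set.indicator_of_notMem hω]
      linarith [hfa ω hω]
  · rw [integral_add (integrable_const a) ((integrable_const B).indicator hE), integral_const,
      integral_indicator_const _ hE]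
    simp [mul_comm]

end Random

/-- Uniform approach to a one-point optimal set is convergence. -/
theorem tendsto_of_near {ν ι κ : Type*} [Fintype ν] {M : CopositiveProgram ν ι κ} {Vopt : Matrix ν ν ℝ} (hopt : M.optimalSet = {Vopt})
    {V : ℕ → Matrix ν ν ℝ} (h : ∀ ε > 0, ∃ t₀ : ℕ, ∀ t, t₀ ≤ t →
      ∃ W ∈ M.optimalSet, ∀ i j, |V t i j - W i j| < ε) : Tendsto V atTop (𝓝 Vopt) := by
  refine tendsto_matrix_iff.2 fun i j => Metric.tendsto_atTop.2 fun ε hε => ?_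
  obtain ⟨t₀, ht₀⟩ := h ε hε
  refine ⟨t₀, fun t ht => ?_⟩
  obtain ⟨W, hW, hd⟩ := ht₀ t ht
  rw [hopt, Set.mem_singleton_iff] at hW
  rw [Real.dist_eq, ← hW]
  exact hd i j

/-! ### The main theorem -/

theorem mainTheorem1 (p₀ pR : ℝ) (hp₀ : 0 < p₀) (hp₀' : p₀ ≤ 1) (hpR : pR < 1) (q : ℕ) :
    ∃ K : ℝ, ∀ (n d e : ℕ) (P : QCBO n d e) (_ : ∃ x, P.IsFeasible x)
      (par : QFWParams (Option (Fin n)) (Unit ⊕ Fin n ⊕ Fin d ⊕ Fin d) (Fin e))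
      (_ : 0 < par.δ) (_ : par.δ ≤ 1) (_ : 0 < par.α₀)
      (_ : par.init.V ∈ binaryHull (Option (Fin n))) (μ σ : ℝ),
    ∃ C : ℝ, ∀ (O : RandomOracle (Option (Fin n))) (_ : O.SuccessProb p₀)
      (Ω : Type*) (_ : MeasurableSpace Ω) (Pr : Measure Ω) (_ : IsProbabilityMeasure Pr),
    -- runs with horizon `T = 1, 2, …`, where `⌈c log T⌉ + 1` samples are drawn in each iteration
    (∀ (X : ℕ → ℕ → ℕ → Ω → Option (Fin n) → Bool)
      (_ : ∀ T, 1 ≤ T → IsQFWRun P.toProgram par O Pr (fun _ => extraSamples p₀ T) T (X T))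
      (_ : ∀ T, 1 ≤ T →
        BoundedOracleError P.toProgram par Pr (fun _ => extraSamples p₀ T) T (X T) μ σ)
      (V : ℕ → ℕ → Ω → Matrix (Option (Fin n)) (Option (Fin n)) ℝ)
      (_ : ∀ T t ω, V T t ω = (P.toProgram.qfwState par (fun _ => extraSamples p₀ T)
        (fun s j => X T s j ω) t).V),
      -- almost sure convergence
      (∀ᵐ ω ∂Pr, ∀ ε > 0, ∃ t₀ : ℕ, ∀ T t, 1 ≤ T → t₀ ≤ t → t ≤ T →
        ∃ W ∈ P.toProgram.optimalSet, ∀ i j, |V T t ω i j - W i j| < ε) ∧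
      (∀ Vopt, P.toProgram.optimalSet = {Vopt} →
        ∀ᵐ ω ∂Pr, Tendsto (fun T => V T T ω) atTop (𝓝 Vopt)) ∧
      (e = 0 → ∀ xopt, (∀ x, P.IsMinimizer x ↔ x = xopt) →
        ∀ᵐ ω ∂Pr, Tendsto (fun T => V T T ω) atTop (𝓝 (liftPoint xopt))) ∧
      -- rates in expectation
      (∀ T : ℕ, 1 ≤ T →
        Integrable (fun ω => P.toProgram.objectiveGap (V T T ω)) Pr ∧
        ∫ ω, |P.toProgram.objectiveGap (V T T ω)| ∂Pr ≤ C / √T ∧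
        Integrable (fun ω => P.toProgram.infeasibility (V T T ω)) Pr ∧
        ∫ ω, P.toProgram.infeasibility (V T T ω) ∂Pr ≤ C / √T) ∧
      -- time to solution
      (∀ T : ℕ, 1 ≤ T →
        1 - 1 / (T : ℝ) ≤ Pr.real
          (successEvent P.toProgram par (fun _ => extraSamples p₀ T) T (X T) (C / √T)) ∧
        ∀ τ : ℝ, 0 ≤ τ → 2 ≤ n → T ≤ n ^ q →
          timeToSolution (runTime τ (fun _ => extraSamples p₀ T) T)
              (Pr.real (successEvent P.toProgram par (fun _ => extraSamples p₀ T) T (X T)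
                (C / √T))) pR
            ≤ ENNReal.ofReal (K * (τ * T * Real.log n)))) ∧
    -- a single infinite run, where `⌈c log t⌉ + 1` samples are drawn in iteration `t`
    (∀ (Y : ℕ → ℕ → Ω → Option (Fin n) → Bool)
      (_ : ∀ N, IsQFWRun P.toProgram par O Pr (extraSamples p₀) N Y)
      (_ : ∀ N, BoundedOracleError P.toProgram par Pr (extraSamples p₀) N Y μ σ)
      (V : ℕ → Ω → Matrix (Option (Fin n)) (Option (Fin n)) ℝ)
      (_ : ∀ t ω, V t ω = (P.toProgram.qfwState par (extraSamples p₀)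
        (fun s j => Y s j ω) t).V),
      (∀ᵐ ω ∂Pr, ∀ ε > 0, ∃ t₀ : ℕ, ∀ t, t₀ ≤ t →
        ∃ W ∈ P.toProgram.optimalSet, ∀ i j, |V t ω i j - W i j| < ε) ∧
      (∀ Vopt, P.toProgram.optimalSet = {Vopt} →
        ∀ᵐ ω ∂Pr, Tendsto (fun t => V t ω) atTop (𝓝 Vopt)) ∧
      (e = 0 → ∀ xopt, (∀ x, P.IsMinimizer x ↔ x = xopt) →
        ∀ᵐ ω ∂Pr, Tendsto (fun t => V t ω) atTop (𝓝 (liftPoint xopt)))) := by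

  obtain ⟨K, hK⟩ := exists_time_bound hp₀ pR hpR q
  refine ⟨K, fun n d e P hP par hδ hδ' hα _ μ σ => ?_⟩
  have hM : P.toProgram.feasibleSet.Nonempty := by
    obtain ⟨x, hx⟩ := hP
    exact ⟨_, hx.liftPoint_mem⟩
  obtain ⟨C, hC0, hC⟩ := CopositiveProgram.exists_trajectory_rate hM hδ hδ' hα 0
  obtain ⟨B, hB0, hB⟩ := CopositiveProgram.exists_uniform_bound P.toProgram hδ hδ' hα
  -- `C` is the rate of runs without failures; `B` pays for the failure event, whose probability is
  -- at most `1 / T ≤ 1 / √T`.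
  refine ⟨C + B, fun O hO Ω _ Pr _ => ⟨fun X hX _ V hV => ?_, fun Y hY _ V hV => ?_⟩⟩
  · have hnear : ∀ᵐ ω ∂Pr, ∀ ε > 0, ∃ t₀ : ℕ, ∀ T t, 1 ≤ T → t₀ ≤ t → t ≤ T →
        ∃ W ∈ P.toProgram.optimalSet, ∀ i j, |V T t ω i j - W i j| < ε := by
      filter_upwards [ae_eventually_failCount_le_one hO hp₀ hp₀' hX] with ω hω ε hε
      obtain ⟨T₀, hT₀⟩ := eventually_atTop.1 hω
      obtain ⟨t₀, ht₀⟩ := CopositiveProgram.exists_time_near_optimal hM hδ hδ' hα 1 hε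
      refine ⟨max t₀ T₀, fun T t _ ht htT => ?_⟩
      rw [hV, CopositiveProgram.qfwState_eq_trajectory]
      -- A prefix has no more failures than the whole run, which makes the convergence uniform in `T
      -- ≥ t`.
      exact ht₀ _ t ((le_max_left _ _).trans ht) ((failCount_mono _ _ _ htT).trans
        (hT₀ T (((le_max_right _ _).trans ht).trans htT)))
    have hlim : ∀ Vopt, P.toProgram.optimalSet = {Vopt} →
        ∀ᵐ ω ∂Pr, Tendsto (fun T => V T T ω) atTop (𝓝 Vopt) := fun Vopt hopt => by
      filter_upwards [hnear] with ω hω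
      refine tendsto_of_near hopt fun ε hε => ?_
      obtain ⟨t₀, ht₀⟩ := hω ε hε
      exact ⟨t₀ + 1, fun t ht => ht₀ t t (by omega) (by omega) le_rfl⟩
    refine ⟨hnear, hlim, fun he x₀ hx₀ => hlim _ (QCBO.optimalSet_eq_singleton he hx₀),
      fun T hT => ?_, fun T hT => ?_⟩
    all_goals
      have hT0 : (0 : ℝ) < T := by exact_mod_cast hT
      have hsqrt : 0 < √(T : ℝ) := Real.sqrt_pos.2 hT0
      set l : ℕ → ℕ := fun _ => extraSamples p₀ T with hl
      set E := {ω | ∃ s ∈ Finset.Icc 1 T, AllFail P.toProgram par l s fun s j => X T s j ω} with hE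
      have hEm : MeasurableSet E := (hX T hT).measurableSet_of_agree le_rfl
        (A := fun x => ∃ s ∈ Finset.Icc 1 T, AllFail P.toProgram par l s x) fun x x' hx =>
          exists_congr fun s => and_congr_right fun hs =>
            allFail_congr (Finset.mem_Icc.1 hs).1 (hx.mono (Finset.mem_Icc.1 hs).2)
      have hPE : Pr.real E ≤ (1 - p₀) / T := by
        refine ENNReal.toReal_le_of_le_ofReal (div_nonneg (by linarith) hT0.le) ?_
        exact measure_some_fail_le hO hp₀ hp₀' hT (hX T hT)
      have hgood : ∀ ω ∉ E, ∀ t ∈ Finset.Icc 1 T,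
          IsQuboMin (P.toProgram.qfwQubo par l (fun s j => X T s j ω) t)
            (P.toProgram.qfwChoice par l (fun s j => X T s j ω) t) := fun ω hω t ht => by
        by_contra hcon
        exact hω ⟨t, ht, allFail_of_not_isQuboMin hcon⟩
      have hrate : ∀ ω ∉ E,
          |P.toProgram.objectiveGap (P.toProgram.qfwState par l (fun s j => X T s j ω) T).V| ≤
            C / √(T : ℝ) ∧
          P.toProgram.infeasibility (P.toProgram.qfwState par l (fun s j => X T s j ω) T).V ≤
            C / √(T : ℝ) := fun ω hω => by
        rw [CopositiveProgram.qfwState_eq_trajectory]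
        exact hC _ T hT (failCount_eq_zero l (hgood ω hω)).le
    · have hmeas : ∀ Φ : Matrix (Option (Fin n)) (Option (Fin n)) ℝ → ℝ,
          Measurable fun ω => Φ (V T T ω) := fun Φ => by
        simp only [hV]
        exact (hX T hT).measurable_of_agree le_rfl
          (Φ := fun x => Φ (P.toProgram.qfwState par l x T).V) fun x x' hx => by
            rw [qfwState_congr _ _ hx]
      have hfinal : C / √(T : ℝ) + B * Pr.real E ≤ (C + B) / √(T : ℝ) := by
        have h1 : (1 - p₀) / (T : ℝ) ≤ 1 / √(T : ℝ) := by
          have h2 : √(T : ℝ) ≤ T := by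
            rw [Real.sqrt_le_left hT0.le]
            have : (1 : ℝ) ≤ T := by exact_mod_cast hT
            nlinarith
          exact (div_le_div_of_nonneg_right (by linarith) hT0.le).trans
            (one_div_le_one_div_of_le hsqrt h2)
        have h3 := mul_le_mul_of_nonneg_left (hPE.trans h1) hB0
        rw [add_div]
        rw [mul_one_div] at h3
        linarith
      obtain ⟨g1, g2⟩ := integral_le_of_small_off_event (Pr := Pr)
        (hmeas P.toProgram.objectiveGap) hEm (a := C / √(T : ℝ)) (B := B) (by positivity)
        (fun ω => by rw [hV, CopositiveProgram.qfwState_eq_trajectory]; exact (hB _ _).1)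
        (fun ω hω => by rw [hV]; exact (hrate ω hω).1)
      have habs : ∀ W, |P.toProgram.infeasibility W| = P.toProgram.infeasibility W := fun W =>
        abs_of_nonneg (CopositiveProgram.infeasibility_nonneg _ _)
      obtain ⟨g3, g4⟩ := integral_le_of_small_off_event (Pr := Pr)
        (hmeas P.toProgram.infeasibility) hEm (a := C / √(T : ℝ)) (B := B) (by positivity)
        (fun ω => by rw [habs, hV, CopositiveProgram.qfwState_eq_trajectory]; exact (hB _ _).2)
        (fun ω hω => by rw [habs, hV]; exact (hrate ω hω).2)
      simp only [habs] at g4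
      exact ⟨g1, g2.trans hfinal, g3, g4.trans hfinal⟩
    · have hle : C / √(T : ℝ) ≤ (C + B) / √(T : ℝ) :=
        div_le_div_of_nonneg_right (by linarith) hsqrt.le
      have hsub : Eᶜ ⊆ successEvent P.toProgram par l T (X T) ((C + B) / √(T : ℝ)) :=
        fun ω hω => ⟨hgood ω hω, (hrate ω hω).1.trans hle, (hrate ω hω).2.trans hle⟩
      -- The factor `1 - p₀` is kept: `1 - 1 / T` is void at `T = 1`, whereas this bound is at least
      -- `p₀` for every `T`, as the bound on the repetitions requires.
      have hprob : 1 - (1 - p₀) / T ≤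
          Pr.real (successEvent P.toProgram par l T (X T) ((C + B) / √(T : ℝ))) := by
        refine le_trans ?_ (measureReal_mono hsub)
        rw [probReal_compl_eq_one_sub hEm]
        linarith
      have h1 : (1 - p₀) / (T : ℝ) ≤ 1 / T := div_le_div_of_nonneg_right (by linarith) hT0.le
      refine ⟨by linarith, fun τ hτ hn hTn => hK n T τ _ hn hT hTn hτ ?_ measureReal_le_one⟩
      have h2 : (1 - p₀) / (T : ℝ) ≤ 1 - p₀ :=
        div_le_self (by linarith) (by exact_mod_cast hT)
      linarith
  · have hnear : ∀ᵐ ω ∂Pr, ∀ ε > 0, ∃ t₀ : ℕ, ∀ t, t₀ ≤ t →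
        ∃ W ∈ P.toProgram.optimalSet, ∀ i j, |V t ω i j - W i j| < ε := by
      filter_upwards [ae_exists_failCount_le hO hp₀ hp₀' hY] with ω ⟨J, hJ⟩ ε hε
      obtain ⟨t₀, ht₀⟩ := CopositiveProgram.exists_time_near_optimal hM hδ hδ' hα J hε
      refine ⟨t₀, fun t ht => ?_⟩
      rw [hV, CopositiveProgram.qfwState_eq_trajectory]
      exact ht₀ _ t ht (hJ t)
    have hlim : ∀ Vopt, P.toProgram.optimalSet = {Vopt} →
        ∀ᵐ ω ∂Pr, Tendsto (fun t => V t ω) atTop (𝓝 Vopt) := fun Vopt hopt => by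
      filter_upwards [hnear] with ω hω
      exact tendsto_of_near hopt hω
    exact ⟨hnear, hlim, fun he x₀ hx₀ => hlim _ (QCBO.optimalSet_eq_singleton he hx₀)⟩
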